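/- **Setting.** Let $d\in\{2,3\}$, let $\Omega\subset\mathbb R^d$ be bounded and open (in particular, any polygonal or polyhedral Lipschitz domain is allowed), $T>0$, $I=(0,T]$, let $\rho,\varepsilon,\nu>0$ be constants, $\alpha\in L^\infty(\Omega)$, $g\in L^2(0,T;H^{-1}(\Omega))$, $u_0\in L^2(\Omega)$, $\boldsymbol f\in H^{-1}(\Omega)^d$. Write $(\cdot,\cdot)$ for the $L^2(\Omega)$ inner product and for the duality pairing of $H^{-1}(\Omega)$ and $H^1_0(\Omega)$, and $(\cdot,\cdot)_K$ for the $L^2(K)$ inner product. Let $X=\{u\in L^2(0,T;H_0^1(\Omega)) : \partial_t u\in L^2(0,T;H^{-1}(\Omega))\}$, whose elements are identified with their representatives in $C([0,T];L^2(\Omega))$. *Flow.* Let $\{\boldsymbol v,p\}\in H_0^1(\Omega)^d\times L^2_0(\Omega)$ be a weak solution of the Stokes problem, $B(\boldsymbol v,p)(\boldsymbol\psi,\chi):=\nu(\nabla \boldsymbol v,\nabla\boldsymbol\psi)-(p,\nabla\cdot\boldsymbol\psi)+(\nabla\cdot \boldsymbol v,\chi)=(\boldsymbol f,\boldsymbol\psi)$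 for all $\{\boldsymbol\psi,\chi\}\in H_0^1(\Omega)^d\times L^2_0(\Omega)$. *Forms.* Put $a(u,\boldsymbol v)(\varphi)=(\varepsilon\nabla u,\nabla\varphi)+(\boldsymbol v\cdot\nabla u,\varphi)+(\alpha u,\varphi)$ and $$A(u,\boldsymbol v)(\varphi)=\int_I\{(\rho\partial_t u,\varphi)+a(u,\boldsymbol v)(\varphi)\}\,dt+(\rho u(0),\varphi(0)),\qquad G(\varphi)=\int_I(g,\varphi)\,dt+(u_0,\varphi(0)).$$ (So the datum $u_0$ prescribes the initial value of $\rho u$.) *Discretization in time.* Let $0=t_0<\dots<t_N=T$, $I_n=(t_{n-1},t_n]$, $r\ge 0$. Let $X_\tau$ be the set of $u:[0,T]\to L^2(\Omega)$ that on each $I_n$ are polynomials in $t$ of degree at most $r$ with coefficients in $H_0^1(\Omega)$. Write $u_n^\pm$ for the one-sided limits at $t_n$, $[u]_n=u_n^+-u_n^-$, and, with $\partial_t$ taken on each $I_n$ separately, $$A_\tau(u,\boldsymbol v)(\varphi)=\sum_{n=1}^N\int_{I_n}\{(\rho\partial_tu,\varphi)+a(u,\boldsymbol v)(\varphi)\}\,dt+\sum_{n=2}^N(\rho[u]_{n-1},\varphi_{n-1}^+)+(\rho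 u_0^+,\varphi_0^+),\qquad G_\tau(\varphi)=\int_I(g,\varphi)\,dt+(u_0,\varphi_0^+).$$ *Discretization in space.* For $n=0,\dots,N$ let $\mathcal T_h^n$ be a decomposition of $\Omega$ into finitely many disjoint open quadrilaterals ($d=2$) or hexahedra ($d=3$), each the image of the reference cube under a nondegenerate injective map that is affine in each variable; hanging nodes are allowed. $H_h^{p,n}$ is the space of functions in $C(\overline\Omega)\cap H_0^1(\Omega)$ that on each $K\in\mathcal T_h^n$ are mapped polynomials of degree at most $p$ in each variable. $X_{\tau h}$ is the set of $u\in X_\tau$ whose polynomial coefficients on $I_n$ lie in $H_h^{p_u,n}$, $n=1,\dots,N$, and with $u(0)\in H_h^{p_u,0}$. Let $\{\boldsymbol v_h,p_h\}$ solve the discrete Stokes problem $B(\boldsymbol v_h,p_h)(\boldsymbol\psi_h,\chi_h)=(\boldsymbol f,\boldsymbol\psi_h)$ in $(H_h^{p_v})^d\times L_h^{p_p}$, built in the same way on some mesh of this kind, where $L_h^{p_p}$ consists of the continuous mapped piecewise polynomials in $L^2_0(\Omega)$. Assume here that $g\in L^2(0,T;L^2(\Omega))$, let $\delta_K\in\mathbb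 R$ for $K\in\mathcal T_h^n$, and put $$S(u,\boldsymbol v_h)(\varphi)=\sum_{n=1}^N\int_{I_n}\sum_{K\in\mathcal T_h^n}\delta_K\big(\rho\partial_tu-\nabla\cdot(\varepsilon\nabla u)+\boldsymbol v_h\cdot\nabla u+\alpha u-g,\ \boldsymbol v_h\cdot\nabla\varphi\big)_K dt+\sum_{n=2}^N\sum_{K\in\mathcal T_h^n}\delta_K(\rho[u]_{n-1},\boldsymbol v_h\cdot\nabla\varphi_{n-1}^+)_K+\sum_{K\in\mathcal T_h^1}\delta_K(\rho u_0^+-u_0,\boldsymbol v_h\cdot\nabla\varphi_0^+)_K$$ (in the last sum, $u_0^+$ is the limit of $u$ at $t_0$ and $u_0$ is the initial datum), with $A_S=A_\tau+S$. *Goal functional and Lagrangians.* Let $J(u)=\int_0^TJ_1(u(t))\,dt+J_2(u(T))$ with $J_1:H_0^1(\Omega)\to\mathbb R$, $J_2:L^2(\Omega)\to\mathbb R$ Gateaux differentiable, such that on $X+X_\tau$ the functional $J$ is well defined and three times Gateaux differentiable with $J'(u)(\varphi)=\int_0^TJ_1'(u(t))(\varphi(t))\,dt+J_2'(u(T))(\varphi(T))$,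 and such that $s\mapsto J'''(y+se)(e,e,e)$ is integrable on $(0,1)$ for all $y,e\in X+X_\tau$. Put $$\mathcal L(u,z)=J(u)+G(z)-A(u,\boldsymbol v)(z),\quad \mathcal L_\tau(u,z)=J(u)+G_\tau(z)-A_\tau(u,\boldsymbol v)(z),\quad \mathcal L_{\tau h}(u,z)=J(u)+G_\tau(z)-A_S(u,\boldsymbol v_h)(z),$$ and, with derivatives in the sense of Gateaux, $\rho_{\mathrm t}(u)(\varphi)=\mathcal L_{\tau,z}'(u,z)(\varphi)$ (which does not depend on $z$) and $\rho_{\mathrm t}^*(u,z)(\varphi)=\mathcal L_{\tau,u}'(u,z)(\varphi)$. **Theorem.** Let $\{u,z\}\in X\times X$, $\{u_\tau,z_\tau\}\in X_\tau\times X_\tau$ and $\{u_{\tau h},z_{\tau h}\}\in X_{\tau h}\times X_{\tau h}$ be stationary points of $\mathcal L$, $\mathcal L_\tau$ and $\mathcal L_{\tau h}$ on $X\times X$, $X_\tau\times X_\tau$ and $X_{\tau h}\times X_{\tau h}$, i.e. the derivatives there vanish in all directions of these spaces. Then, for all $\varphi\in X_{\tau h}$, $$A_\tau(u_\tau-u_{\tau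 h},\boldsymbol v_h)(\varphi)=S(u_{\tau h},\boldsymbol v_h)(\varphi)-\sum_{n=1}^N\int_{I_n}\big((\boldsymbol v-\boldsymbol v_h)\cdot\nabla u_\tau,\varphi\big)\,dt,$$ and for arbitrary $\tilde u_\tau,\tilde z_\tau\in X_\tau$ and $\tilde u_{\tau h},\tilde z_{\tau h}\in X_{\tau h}$, $$J(u)-J(u_\tau)=\tfrac12\rho_{\mathrm t}(u_\tau)(z-\tilde z_\tau)+\tfrac12\rho_{\mathrm t}^*(u_\tau,z_\tau)(u-\tilde u_\tau)+\mathcal R_\tau,$$ $$J(u_\tau)-J(u_{\tau h})=\tfrac12\rho_{\mathrm t}(u_{\tau h})(z_\tau-\tilde z_{\tau h})+\tfrac12\rho_{\mathrm t}^*(u_{\tau h},z_{\tau h})(u_\tau-\tilde u_{\tau h})+\tfrac12\mathcal D_{\tau h}'(u_{\tau h},z_{\tau h})(\tilde u_{\tau h}-u_{\tau h},\tilde z_{\tau h}-z_{\tau h})+\mathcal D_{\tau h}(u_{\tau h},z_{\tau h})+\mathcal R_h,$$ where $$\mathcal D_{\tau h}(\varphi,\psi)=S(\varphi,\boldsymbol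 v_h)(\psi)-\sum_{n=1}^N\int_{I_n}\big((\boldsymbol v-\boldsymbol v_h)\cdot\nabla\varphi,\psi\big)\,dt$$ and the remainders are $$\mathcal R_\tau=\tfrac12\int_0^1\mathcal L_\tau'''(y_\tau+se)(e,e,e)\,s(s-1)\,ds,\qquad y_\tau=(u_\tau,z_\tau),\quad e=(u-u_\tau,z-z_\tau),$$ $$\mathcal R_h=\tfrac12\int_0^1\mathcal L_\tau'''(y_{\tau h}+se)(e,e,e)\,s(s-1)\,ds,\qquad y_{\tau h}=(u_{\tau h},z_{\tau h}),\quad e=(u_\tau-u_{\tau h},z_\tau-z_{\tau h}).$$ The first representation formula needs only the statements about $\{u,z\}$ and $\{u_\tau,z_\tau\}$. -/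

import Mathlib

open MeasureTheory Set
open scoped ContDiff Pointwise

namespace TransportDWR

noncomputable section

/-! ### Function spaces on the spatial domain -/

/-- Euclidean space of dimension `d`. -/
abbrev E (d : ℕ) : Type := EuclideanSpace ℝ (Fin d)

/-- `L²(Ω)`. -/
abbrev L2 {d : ℕ} (Ω : Set (E d)) : Type := Lp ℝ 2 (volume.restrict Ω)

/-- Pairs (function, gradient) with the Hilbert norm `(‖u‖² + ‖∇u‖²)^(1/2)`. -/
abbrev L2Pair {d : ℕ} (Ω : Set (E d)) : Type :=
  WithLp 2 (Lp ℝ 2 (volume.restrict Ω) × Lp (E d) 2 (volume.restrict Ω))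

/-- `C_c^∞(U)`. -/
def IsTest {V : Type*} [NormedAddCommGroup V] [NormedSpace ℝ V] (U : Set V) (ψ : V → ℝ) : Prop :=
  ContDiff ℝ ∞ ψ ∧ HasCompactSupport ψ ∧ tsupport ψ ⊆ U

/-- `H¹₀(Ω)`: the closure of `C_c^∞(Ω)` in the `H¹`-norm, each function being stored together
with its weak gradient. -/
def H01 {d : ℕ} (Ω : Set (E d)) : Submodule ℝ (L2Pair Ω) :=
  (Submodule.span ℝ {w : L2Pair Ω | ∃ ψ : E d → ℝ, IsTest Ω ψ ∧
    w.fst =ᵐ[volume.restrict Ω] ψ ∧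
    w.snd =ᵐ[volume.restrict Ω] gradient ψ}).topologicalClosure

/-- `H⁻¹(Ω)`, the dual of `H¹₀(Ω)`. -/
abbrev Hm1 {d : ℕ} (Ω : Set (E d)) : Type := StrongDual ℝ (H01 Ω)

/-- The embedding of `H¹₀(Ω)` into `L²(Ω)`. -/
def val {d : ℕ} {Ω : Set (E d)} (w : H01 Ω) : L2 Ω := (w : L2Pair Ω).fst

/-- The weak gradient. -/
def grad {d : ℕ} {Ω : Set (E d)} (w : H01 Ω) : Lp (E d) 2 (volume.restrict Ω) :=
  (w : L2Pair Ω).snd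

open Classical in
/-- The element of `H¹₀(Ω)` whose underlying `L²`-function is `f` (it is unique, because the weak
gradient is determined by the function); `0` if `f` is not in `H¹₀(Ω)`. -/
def lift {d : ℕ} {Ω : Set (E d)} (f : L2 Ω) : H01 Ω :=
  if h : ∃ w : H01 Ω, val w = f then h.choose else 0

/-- `L²₀(Ω)`: mean value zero. -/
def L20 {d : ℕ} (Ω : Set (E d)) : Set (L2 Ω) := {q | ∫ x in Ω, q x = 0}

/-- The function `v · G` for a field `v ∈ H¹₀(Ω)^d` and a vector field `G`. -/
def adv {d : ℕ} {Ω : Set (E d)} (v : Fin d → H01 Ω) (G : E d → E d) (x : E d) : ℝ :=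
  ∑ i, val (v i) x * G x i

/-- The function `∇ · v`. -/
def dvg {d : ℕ} {Ω : Set (E d)} (v : Fin d → H01 Ω) (x : E d) : ℝ := ∑ i, grad (v i) x i

/-- `q ∈ L²(K)` is the weak divergence of the vector field `G` on the open set `K`. -/
def IsWeakDivOn {d : ℕ} (K : Set (E d)) (G : E d → E d) (q : E d → ℝ) : Prop :=
  MemLp q 2 (volume.restrict K) ∧
    ∀ ψ : E d → ℝ, IsTest K ψ →
      ∫ x in K, q x * ψ x = - ∫ x in K, inner ℝ (G x) (gradient ψ x)

open Classical in
/-- The weak divergence of `G` on `K` (unique almost everywhere on `K`). -/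
def weakDivOn {d : ℕ} (K : Set (E d)) (G : E d → E d) : E d → ℝ :=
  if h : ∃ q, IsWeakDivOn K G q then h.choose else 0

/-! ### Functions of time with values in `L²(Ω)` -/

/-- `f ∈ L²(a,b; H⁻¹(Ω))` is the weak time derivative of `u` on `(a,b)`. -/
def IsWeakDt {d : ℕ} {Ω : Set (E d)} (a b : ℝ) (u : ℝ → L2 Ω) (f : ℝ → Hm1 Ω) : Prop :=
  MemLp f 2 (volume.restrict (Ioc a b)) ∧
    ∀ η : ℝ → ℝ, IsTest (Ioo a b) η → ∀ w : H01 Ω,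
      ∫ t in Ioc a b, deriv η t * inner ℝ (u t) (val w) = - ∫ t in Ioc a b, η t * f t w

open Classical in
/-- The weak time derivative `∂ₜu` of `u` on `(a,b)` (unique almost everywhere on `(a,b)`). -/
def dt {d : ℕ} {Ω : Set (E d)} (a b : ℝ) (u : ℝ → L2 Ω) : ℝ → Hm1 Ω :=
  if h : ∃ f, IsWeakDt a b u f then h.choose else 0

/-- The space `X = {u ∈ L²(0,T;H¹₀(Ω)) | ∂ₜu ∈ L²(0,T;H⁻¹(Ω))}`, every element being represented
by its continuous representative `[0,T] → L²(Ω)`, so that `u(0)` and `u(T)` are values. (Values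
outside `[0,T]` are irrelevant.) -/
def X {d : ℕ} (Ω : Set (E d)) (T : ℝ) : Set (ℝ → L2 Ω) :=
  {u | ContinuousOn u (Icc 0 T) ∧
    (∃ U : ℝ → H01 Ω, MemLp U 2 (volume.restrict (Ioc 0 T)) ∧
      ∀ᵐ t ∂(volume.restrict (Ioc 0 T)), u t = val (U t)) ∧
    ∃ f, IsWeakDt 0 T u f}

/-- A partition `0 = t₀ < t₁ < ⋯ < t_N = T`; the subintervals are `(t n, t (n+1)]`, `n < N`. -/
structure TimeGrid (T : ℝ) where
  N : ℕ
  t : ℕ → ℝ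
  t_zero : t 0 = 0
  t_last : t N = T
  t_lt : ∀ n < N, t n < t (n + 1)

/-- The dG(r) space: on each subinterval a polynomial in time of degree at most `r` with
coefficients in `H¹₀(Ω)`; the value at time `0` is any element of `L²(Ω)`. -/
def Xtau {d : ℕ} (Ω : Set (E d)) {T : ℝ} (τ : TimeGrid T) (r : ℕ) : Set (ℝ → L2 Ω) :=
  {u | ∀ n < τ.N, ∃ c : Fin (r + 1) → H01 Ω,
    ∀ s ∈ Ioc (τ.t n) (τ.t (n + 1)), u s = ∑ j : Fin (r + 1), s ^ (j : ℕ) • val (c j)}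

/-- The limit of `u` from above at `t`. -/
def limPlus {d : ℕ} {Ω : Set (E d)} (u : ℝ → L2 Ω) (t : ℝ) : L2 Ω := Function.rightLim u t

/-- The limit of `u` from below at `t`. -/
def limMinus {d : ℕ} {Ω : Set (E d)} (u : ℝ → L2 Ω) (t : ℝ) : L2 Ω := Function.leftLim u t

/-- The jump of `u` at `t`. -/
def jump {d : ℕ} {Ω : Set (E d)} (u : ℝ → L2 Ω) (t : ℝ) : L2 Ω := limPlus u t - limMinus u t

/-! ### The continuous problem -/

/-- Domain, coefficients and data of the transport and of the Stokes problem. -/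
structure Problem (d : ℕ) where
  Ω : Set (E d)
  isOpen : IsOpen Ω
  bounded : Bornology.IsBounded Ω
  T : ℝ
  T_pos : 0 < T
  /-- density -/
  ρ : ℝ
  ρ_pos : 0 < ρ
  /-- diffusion -/
  ε : ℝ
  ε_pos : 0 < ε
  /-- viscosity -/
  ν : ℝ
  ν_pos : 0 < ν
  /-- reaction -/
  α : E d → ℝ
  α_mem : MemLp α ⊤ (volume.restrict Ω)
  /-- source of the transport problem -/
  g : ℝ → Hm1 Ω
  g_mem : MemLp g 2 (volume.restrict (Ioc 0 T))
  /-- initial datum -/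
  u0 : L2 Ω
  /-- force of the Stokes problem -/
  f : Fin d → Hm1 Ω

namespace Problem

variable {d : ℕ} (P : Problem d)

/-- `a(u,v)(φ) = (ε∇u,∇φ) + (v·∇u,φ) + (αu,φ)`. -/
def a (u : H01 P.Ω) (v : Fin d → H01 P.Ω) (φ : H01 P.Ω) : ℝ :=
  (∫ x in P.Ω, inner ℝ (P.ε • grad u x) (grad φ x))
    + (∫ x in P.Ω, adv v (grad u) x * val φ x)
    + ∫ x in P.Ω, P.α x * val u x * val φ x

/-- `A(u,v)(φ) = ∫_I {⟨ρ∂ₜu,φ⟩ + a(u,v)(φ)} dt + (ρu(0),φ(0))`. -/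
def A (u : ℝ → L2 P.Ω) (v : Fin d → H01 P.Ω) (φ : ℝ → L2 P.Ω) : ℝ :=
  (∫ t in Ioc 0 P.T, (P.ρ * dt 0 P.T u t (lift (φ t)) + P.a (lift (u t)) v (lift (φ t))))
    + inner ℝ (P.ρ • u 0) (φ 0)

/-- `G(φ) = ∫_I ⟨g,φ⟩ dt + (u₀,φ(0))`. -/
def G (φ : ℝ → L2 P.Ω) : ℝ :=
  (∫ t in Ioc 0 P.T, P.g t (lift (φ t))) + inner ℝ P.u0 (φ 0)

/-- The Stokes form `B(v,p)(ψ,χ) = ν(∇v,∇ψ) - (p,∇·ψ) + (∇·v,χ)`. -/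
def B (v : Fin d → H01 P.Ω) (p : L2 P.Ω) (ψ : Fin d → H01 P.Ω) (χ : L2 P.Ω) : ℝ :=
  P.ν * (∑ i, ∫ x in P.Ω, inner ℝ (grad (v i) x) (grad (ψ i) x))
    - (∫ x in P.Ω, p x * dvg ψ x) + ∫ x in P.Ω, dvg v x * χ x

/-- `F(ψ) = ⟨f,ψ⟩`. -/
def F (ψ : Fin d → H01 P.Ω) : ℝ := ∑ i, P.f i (ψ i)

/-- `{v,p} ∈ H¹₀(Ω)^d × L²₀(Ω)` is the weak solution of the Stokes problem. -/
def IsStokesSolution (v : Fin d → H01 P.Ω) (p : L2 P.Ω) : Prop :=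
  p ∈ L20 P.Ω ∧ ∀ ψ : Fin d → H01 P.Ω, ∀ χ ∈ L20 P.Ω, P.B v p ψ χ = P.F ψ

/-! ### The dG(r) forms -/

/-- `A_τ(u,v)(φ)`, with the time derivative taken on each subinterval separately. -/
def Atau (τ : TimeGrid P.T) (u : ℝ → L2 P.Ω) (v : Fin d → H01 P.Ω) (φ : ℝ → L2 P.Ω) : ℝ :=
  (∑ n ∈ Finset.range τ.N, ∫ t in Ioc (τ.t n) (τ.t (n + 1)),
      (P.ρ * dt (τ.t n) (τ.t (n + 1)) u t (lift (φ t)) + P.a (lift (u t)) v (lift (φ t))))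
    + (∑ n ∈ Finset.Ico 1 τ.N, inner ℝ (P.ρ • jump u (τ.t n)) (limPlus φ (τ.t n)))
    + inner ℝ (P.ρ • limPlus u (τ.t 0)) (limPlus φ (τ.t 0))

/-- `G_τ(φ) = ∫_I ⟨g,φ⟩ dt + (u₀,φ₀⁺)`. -/
def Gtau (τ : TimeGrid P.T) (φ : ℝ → L2 P.Ω) : ℝ :=
  (∫ t in Ioc 0 P.T, P.g t (lift (φ t))) + inner ℝ P.u0 (limPlus φ (τ.t 0))

/-! ### Goal functional, Lagrangians, residuals -/

/-- `J(u) = ∫₀ᵀ J₁(u(t)) dt + J₂(u(T))`. -/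
def J (J₁ : H01 P.Ω → ℝ) (J₂ : L2 P.Ω → ℝ) (u : ℝ → L2 P.Ω) : ℝ :=
  (∫ t in Ioc 0 P.T, J₁ (lift (u t))) + J₂ (u P.T)

/-- The Lagrangian `L(u,z) = J(u) + G(z) - A(u,v)(z)`. -/
def lagr (J₁ : H01 P.Ω → ℝ) (J₂ : L2 P.Ω → ℝ) (v : Fin d → H01 P.Ω)
    (y : (ℝ → L2 P.Ω) × (ℝ → L2 P.Ω)) : ℝ :=
  P.J J₁ J₂ y.1 + P.G y.2 - P.A y.1 v y.2

/-- The Lagrangian `L_τ(u,z) = J(u) + G_τ(z) - A_τ(u,v)(z)`. -/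
def lagrTau (τ : TimeGrid P.T) (J₁ : H01 P.Ω → ℝ) (J₂ : L2 P.Ω → ℝ) (v : Fin d → H01 P.Ω)
    (y : (ℝ → L2 P.Ω) × (ℝ → L2 P.Ω)) : ℝ :=
  P.J J₁ J₂ y.1 + P.Gtau τ y.2 - P.Atau τ y.1 v y.2

/-- The primal residual: the directional derivative of `L_τ` in its second argument. (`L_τ` is
affine in that argument, so the point `z` does not matter.) -/
def primalRes (τ : TimeGrid P.T) (J₁ : H01 P.Ω → ℝ) (J₂ : L2 P.Ω → ℝ) (v : Fin d → H01 P.Ω)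
    (u z φ : ℝ → L2 P.Ω) : ℝ :=
  lineDeriv ℝ (fun z' => P.lagrTau τ J₁ J₂ v (u, z')) z φ

/-- The dual residual: the directional derivative of `L_τ` in its first argument. -/
def dualRes (τ : TimeGrid P.T) (J₁ : H01 P.Ω → ℝ) (J₂ : L2 P.Ω → ℝ) (v : Fin d → H01 P.Ω)
    (u z φ : ℝ → L2 P.Ω) : ℝ :=
  lineDeriv ℝ (fun u' => P.lagrTau τ J₁ J₂ v (u', z)) u φ

end Problem

/-- `L` has at `y` a vanishing directional derivative in each direction of `D₁ × D₂`. -/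
def IsStationaryPoint {V : Type*} [AddCommGroup V] [Module ℝ V] (L : V × V → ℝ) (D₁ D₂ : Set V)
    (y : V × V) : Prop :=
  ∀ δu ∈ D₁, ∀ δz ∈ D₂, HasLineDerivAt ℝ L 0 y (δu, δz)

/-- The third directional derivative `L'''(y)(e,e,e)`. -/
def gateaux3 {V : Type*} [AddCommGroup V] [Module ℝ V] (L : V → ℝ) (y e : V) : ℝ :=
  lineDeriv ℝ (fun y₁ => lineDeriv ℝ (fun y₂ => lineDeriv ℝ L y₂ e) y₁ e) y e

/-- The remainder `½ ∫₀¹ L'''(y + s e)(e,e,e) s (s - 1) ds`. -/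
def remainder {V : Type*} [AddCommGroup V] [Module ℝ V] (L : V → ℝ) (y e : V) : ℝ :=
  (1 / 2) * ∫ s in (0 : ℝ)..1, gateaux3 L (y + s • e) e * (s * (s - 1))

/-- `J` is three times Gateaux differentiable on the linear space `Y`, with third derivatives
integrable along segments. -/
def IsGateaux3On {V : Type*} [AddCommGroup V] [Module ℝ V] (J : V → ℝ) (Y : Set V) : Prop :=
  (∀ y ∈ Y, ∀ φ ∈ Y, ∀ ψ ∈ Y, ∀ χ ∈ Y,
    LineDifferentiableAt ℝ J y φ ∧
    LineDifferentiableAt ℝ (fun y₁ => lineDeriv ℝ J y₁ φ) y ψ ∧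
    LineDifferentiableAt ℝ (fun y₁ => lineDeriv ℝ (fun y₂ => lineDeriv ℝ J y₂ φ) y₁ ψ) y χ) ∧
  ∀ y ∈ Y, ∀ e ∈ Y, IntervalIntegrable (fun s : ℝ => gateaux3 J (y + s • e) e) volume 0 1

/-- Admissible goal functionals: `J₁` and `J₂` are Gateaux differentiable, `J` is well defined and
three times Gateaux differentiable on `Y`, and
`J'(u)(φ) = ∫₀ᵀ J₁'(u(t))(φ(t)) dt + J₂'(u(T))(φ(T))`. -/
def IsAdmissibleGoal {d : ℕ} (P : Problem d) (J₁ : H01 P.Ω → ℝ) (J₂ : L2 P.Ω → ℝ)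
    (Y : Set (ℝ → L2 P.Ω)) : Prop :=
  IsGateaux3On (P.J J₁ J₂) Y ∧
  (∀ y ∈ Y, IntegrableOn (fun t => J₁ (lift (y t))) (Ioc 0 P.T)) ∧
  ∃ (J₁' : H01 P.Ω → StrongDual ℝ (H01 P.Ω)) (J₂' : L2 P.Ω → StrongDual ℝ (L2 P.Ω)),
    (∀ w φ, HasLineDerivAt ℝ J₁ (J₁' w φ) w φ) ∧
    (∀ w φ, HasLineDerivAt ℝ J₂ (J₂' w φ) w φ) ∧
    ∀ y ∈ Y, ∀ φ ∈ Y,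
      IntegrableOn (fun t => J₁' (lift (y t)) (lift (φ t))) (Ioc 0 P.T) ∧
      HasLineDerivAt ℝ (P.J J₁ J₂)
        ((∫ t in Ioc 0 P.T, J₁' (lift (y t)) (lift (φ t))) + J₂' (y P.T) (φ P.T)) y φ

/-! ### Meshes and finite element spaces -/

/-- The polynomial map of the reference space with components `F i`. -/
def polyMap {d : ℕ} (F : Fin d → MvPolynomial (Fin d) ℝ) (x : E d) : E d :=
  WithLp.toLp 2 fun i => MvPolynomial.eval (fun j => x j) (F i)

/-- The open reference cube. -/
def refCube (d : ℕ) : Set (E d) := {x | ∀ i, x i ∈ Ioo (0 : ℝ) 1}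

/-- The closed reference cube. -/
def refCubeClosed (d : ℕ) : Set (E d) := {x | ∀ i, x i ∈ Icc (0 : ℝ) 1}

/-- A decomposition of `Ω` into finitely many disjoint open quadrilaterals or hexahedra: images of
the open reference cube under maps that are affine in each variable, injective on the closed cube
and nondegenerate there. Hanging nodes are allowed. -/
structure Mesh {d : ℕ} (Ω : Set (E d)) where
  card : ℕ
  map : Fin card → Fin d → MvPolynomial (Fin d) ℝ
  degree_le : ∀ K i j, (map K i).degreeOf j ≤ 1
  injOn : ∀ K, InjOn (polyMap (map K)) (refCubeClosed d)
  det_ne : ∀ K, ∀ x ∈ refCubeClosed d, (fderiv ℝ (polyMap (map K)) x).det ≠ 0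
  subset : ∀ K, polyMap (map K) '' refCube d ⊆ Ω
  disjoint : ∀ K K', K ≠ K' →
    Disjoint (polyMap (map K) '' refCube d) (polyMap (map K') '' refCube d)
  cover : closure Ω = ⋃ K, closure (polyMap (map K) '' refCube d)

/-- The mesh cell `K`. -/
def Mesh.cell {d : ℕ} {Ω : Set (E d)} (M : Mesh Ω) (K : Fin M.card) : Set (E d) :=
  polyMap (M.map K) '' refCube d

/-- `V_h^p` as a subset of `L²(Ω)`: continuous functions on the closure of `Ω` that on each cell
are mapped polynomials of degree at most `p` in each variable. -/
def Mesh.Vh {d : ℕ} {Ω : Set (E d)} (M : Mesh Ω) (p : ℕ) : Set (L2 Ω) :=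
  {w | ∃ f : E d → ℝ, ContinuousOn f (closure Ω) ∧ w =ᵐ[volume.restrict Ω] f ∧
    ∀ K, ∃ q : MvPolynomial (Fin d) ℝ, (∀ i, q.degreeOf i ≤ p) ∧
      ∀ x ∈ refCube d, f (polyMap (M.map K) x) = MvPolynomial.eval (fun j => x j) q}

/-- `H_h^p = V_h^p ∩ H¹₀(Ω)`. -/
def Mesh.Hh {d : ℕ} {Ω : Set (E d)} (M : Mesh Ω) (p : ℕ) : Set (H01 Ω) := {w | val w ∈ M.Vh p}

/-- `L_h^p = V_h^p ∩ L²₀(Ω)`. -/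
def Mesh.Lh {d : ℕ} {Ω : Set (E d)} (M : Mesh Ω) (p : ℕ) : Set (L2 Ω) := M.Vh p ∩ L20 Ω

/-- The discretization in space: a mesh for each of the `N` time intervals (`mesh n` belongs to
the interval that ends in `t n`) and for the time `0`, a mesh for the flow problem, polynomial
degrees, and the SUPG parameters `δ_K`. -/
structure SpaceDisc {d : ℕ} (P : Problem d) where
  mesh : ℕ → Mesh P.Ω
  flowMesh : Mesh P.Ω
  pu : ℕ
  pv : ℕ
  pp : ℕ
  δ : ∀ n, Fin (mesh n).card → ℝ

namespace SpaceDisc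

variable {d : ℕ} {P : Problem d} (D : SpaceDisc P)

/-- The fully discrete space. -/
def Xtauh (τ : TimeGrid P.T) (r : ℕ) : Set (ℝ → L2 P.Ω) :=
  {u | (∀ n < τ.N, ∃ c : Fin (r + 1) → H01 P.Ω, (∀ j, c j ∈ (D.mesh (n + 1)).Hh D.pu) ∧
      ∀ s ∈ Ioc (τ.t n) (τ.t (n + 1)), u s = ∑ j : Fin (r + 1), s ^ (j : ℕ) • val (c j)) ∧
    ∃ w ∈ (D.mesh 0).Hh D.pu, u 0 = val w}

/-- `{v_h,p_h}` is the discrete solution of the Stokes problem. -/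
def IsStokesSolution (vh : Fin d → H01 P.Ω) (ph : L2 P.Ω) : Prop :=
  (∀ i, vh i ∈ D.flowMesh.Hh D.pv) ∧ ph ∈ D.flowMesh.Lh D.pp ∧
    ∀ ψ : Fin d → H01 P.Ω, (∀ i, ψ i ∈ D.flowMesh.Hh D.pv) → ∀ χ ∈ D.flowMesh.Lh D.pp,
      P.B vh ph ψ χ = P.F ψ

/-- The strong residual `r(u,v_h) = ρ∂ₜu - ∇·(ε∇u) + v_h·∇u + αu - g` at time `t` on the cell `K`;
`g` is given as a function with values in `L²(Ω)`. -/
def res (_D : SpaceDisc P) (g : ℝ → L2 P.Ω) (u : ℝ → L2 P.Ω) (vh : Fin d → H01 P.Ω)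
    (K : Set (E d)) (t : ℝ) (x : E d) : ℝ :=
  P.ρ * deriv u t x - weakDivOn K (fun x' => P.ε • grad (lift (u t)) x') x
    + adv vh (grad (lift (u t))) x + P.α x * u t x - g t x

/-- The SUPG term `S(u,v_h)(φ)`. -/
def S (τ : TimeGrid P.T) (g : ℝ → L2 P.Ω) (u : ℝ → L2 P.Ω) (vh : Fin d → H01 P.Ω)
    (φ : ℝ → L2 P.Ω) : ℝ :=
  (∑ n ∈ Finset.range τ.N, ∫ t in Ioc (τ.t n) (τ.t (n + 1)),
      ∑ K, D.δ (n + 1) K * ∫ x in (D.mesh (n + 1)).cell K,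
        D.res g u vh ((D.mesh (n + 1)).cell K) t x * adv vh (grad (lift (φ t))) x)
    + (∑ n ∈ Finset.Ico 1 τ.N, ∑ K, D.δ (n + 1) K * ∫ x in (D.mesh (n + 1)).cell K,
        (P.ρ * jump u (τ.t n) x) * adv vh (grad (lift (limPlus φ (τ.t n)))) x)
    + ∑ K, D.δ 1 K * ∫ x in (D.mesh 1).cell K,
        (P.ρ * limPlus u (τ.t 0) x - P.u0 x) * adv vh (grad (lift (limPlus φ (τ.t 0)))) x

/-- `A_S = A_τ + S`. -/
def AS (τ : TimeGrid P.T) (g : ℝ → L2 P.Ω) (u : ℝ → L2 P.Ω) (vh : Fin d → H01 P.Ω)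
    (φ : ℝ → L2 P.Ω) : ℝ :=
  P.Atau τ u vh φ + D.S τ g u vh φ

/-- The Lagrangian `L_τh(u,z) = J(u) + G_τ(z) - A_S(u,v_h)(z)`. -/
def lagrTauH (τ : TimeGrid P.T) (g : ℝ → L2 P.Ω) (J₁ : H01 P.Ω → ℝ) (J₂ : L2 P.Ω → ℝ)
    (vh : Fin d → H01 P.Ω) (y : (ℝ → L2 P.Ω) × (ℝ → L2 P.Ω)) : ℝ :=
  P.J J₁ J₂ y.1 + P.Gtau τ y.2 - D.AS τ g y.1 vh y.2

end SpaceDisc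

/-- The coupling error `Σₙ ∫_{Iₙ} ((v - v_h)·∇u, φ) dt`. -/
def coupling {d : ℕ} (P : Problem d) (τ : TimeGrid P.T) (v vh : Fin d → H01 P.Ω)
    (u φ : ℝ → L2 P.Ω) : ℝ :=
  ∑ n ∈ Finset.range τ.N, ∫ t in Ioc (τ.t n) (τ.t (n + 1)),
    ∫ x in P.Ω, adv (v - vh) (grad (lift (u t))) x * val (lift (φ t)) x

/-- `D_τh(u,z) = S(u,v_h)(z) - Σₙ ∫_{Iₙ} ((v - v_h)·∇u, z) dt`. -/
def SpaceDisc.Dtauh {d : ℕ} {P : Problem d} (D : SpaceDisc P) (τ : TimeGrid P.T)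
    (g : ℝ → L2 P.Ω) (v vh : Fin d → H01 P.Ω) (y : (ℝ → L2 P.Ω) × (ℝ → L2 P.Ω)) : ℝ :=
  D.S τ g y.1 vh y.2 - coupling P τ v vh y.1 y.2

end

end TransportDWR

open TransportDWR

/-!
The two error representations are instances of one identity. For a Lagrangian
`L(u,z) = J(u) + G(z) - A(u)(z)` that is evaluated along the segment from `y` to `y + e`, the
trapezoidal rule with its exact remainder gives
`L(y+e) - L(y) = ½ L'(y)(e) + ½ L'(y+e)(e) + R`, where `R` is the integral of
`½ L'''(y+se)(e,e,e) s(s-1)` (`trapezoidal_rule`, `IsBilinearOn.lagrangian_sub`). Here `L = L_τ`,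
which is meaningful on the space `Broken` of the functions that are regular on each time interval;
`A_τ` is bilinear there because its integrands are integrable. For the convective term this is the
Sobolev embedding `H¹₀(Ω) → L⁴(Ω)` in dimension two and three (`advForm`).

*Error in time*, `y = (u_τ,z_τ)` and `y + e = (u,z)`. Both values of `L_τ` are values of `J`, since
the primal equations hold. The derivative at `(u,z)` vanishes in the direction of the error, because
the continuous solution is consistent with the dG scheme. Stationarity on `X × X` tested with
products `p(t) w(x)` shows that the primal equation holds in `H⁻¹(Ω)` at almost every time and that
`ρu(0) = u₀`; thus `u` solves the dG equation for every test function in `Broken`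
(`Problem.Atau_eq_Gtau`). For the dual problem only directions in `X_τ` are needed. There the
equation is integrated by parts on each time interval, coefficient by coefficient of the polynomial
in time, and the jump terms telescope (`Problem.Atau_eq_goalDeriv`). The derivative at
`(u_τ,z_τ)` vanishes on `X_τ × X_τ`, so that arbitrary elements of `X_τ` may be inserted.

*Error in space*, `y = (u_τh,z_τh)` and `y + e = (u_τ,z_τ)`. The derivative at `(u_τ,z_τ)` vanishes
in the direction of the error, since `X_τh ⊆ X_τ`. The fully discrete Lagrangian is `L_τ - D_τh`
(`SpaceDisc.lagrTauH_eq`), so that `L_τ'` equals `D_τh'` in discrete directions, and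
`L_τ(u_τh,z_τh) = J(u_τh) + D_τh(u_τh,z_τh)` by the discrete primal equation, which also gives the
perturbed Galerkin orthogonality.

To read the discrete primal equation off the stationarity, the stabilization term must be linear in
the test function (`SpaceDisc.S_add_smul`), hence its integrands must be integrable in time. This
concerns the weak divergence of `ε∇u_τh` on the mesh cells, a polynomial in time with values in
`L²(K)` at almost every time (`exists_weakDivOn_sum_pow`).
-/

namespace TransportDWR

-- Instances on spaces of operators between `H01 Ω` and `Hm1 Ω` need a deeper search.
set_option maxSynthPendingDepth 3

noncomputable section

/-! ### The space `H¹₀(Ω)`: uniqueness of the weak gradient, density in `L²(Ω)` -/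

/-- The embedding `H¹₀(Ω) → L²(Ω)` as a continuous linear map. -/
def valL {d : ℕ} (Ω : Set (E d)) : H01 Ω →L[ℝ] L2 Ω :=
  (WithLp.fstL 2 ℝ (L2 Ω) (Lp (E d) 2 (volume.restrict Ω))) ∘L (H01 Ω).subtypeL

/-- The weak gradient as a continuous linear map. -/
def gradL {d : ℕ} (Ω : Set (E d)) : H01 Ω →L[ℝ] Lp (E d) 2 (volume.restrict Ω) :=
  (WithLp.sndL 2 ℝ (L2 Ω) (Lp (E d) 2 (volume.restrict Ω))) ∘L (H01 Ω).subtypeL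

variable {d : ℕ} {Ω : Set (E d)}

@[simp] lemma val_add (w w' : H01 Ω) : val (w + w') = val w + val w' := rfl
@[simp] lemma val_sub (w w' : H01 Ω) : val (w - w') = val w - val w' := rfl
@[simp] lemma val_smul (c : ℝ) (w : H01 Ω) : val (c • w) = c • val w := rfl
@[simp] lemma val_zero : val (0 : H01 Ω) = 0 := rfl
@[simp] lemma grad_add (w w' : H01 Ω) : grad (w + w') = grad w + grad w' := rfl
@[simp] lemma grad_smul (c : ℝ) (w : H01 Ω) : grad (c • w) = c • grad w := rfl

lemma val_sum {ι : Type*} (s : Finset ι) (w : ι → H01 Ω) :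
    val (∑ i ∈ s, w i) = ∑ i ∈ s, val (w i) := map_sum (valL Ω) w s

lemma grad_sum {ι : Type*} (s : Finset ι) (w : ι → H01 Ω) :
    grad (∑ i ∈ s, w i) = ∑ i ∈ s, grad (w i) := map_sum (gradL Ω) w s

lemma IsTest.memLp {V : Type*} [NormedAddCommGroup V] [NormedSpace ℝ V] [MeasurableSpace V]
    [BorelSpace V] {U : Set V} {ψ : V → ℝ} (h : IsTest U ψ) (p : ENNReal) (μ : Measure V)
    [IsFiniteMeasureOnCompacts μ] : MemLp ψ p μ :=
  h.1.continuous.memLp_of_hasCompactSupport h.2.1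

lemma IsTest.continuous_gradient {U : Set (E d)} {ψ : E d → ℝ} (h : IsTest U ψ) :
    Continuous (gradient ψ) :=
  (InnerProductSpace.toDual ℝ (E d)).symm.continuous.comp
    (h.1.continuous_fderiv (by simp))

lemma IsTest.hasCompactSupport_gradient {U : Set (E d)} {ψ : E d → ℝ} (h : IsTest U ψ) :
    HasCompactSupport (gradient ψ) :=
  (h.2.1.fderiv (𝕜 := ℝ)).comp_left (g := (InnerProductSpace.toDual ℝ (E d)).symm) (map_zero _)

lemma IsTest.memLp_gradient {U : Set (E d)} {ψ : E d → ℝ} (h : IsTest U ψ)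
    (p : ENNReal) (μ : Measure (E d)) [IsFiniteMeasureOnCompacts μ] : MemLp (gradient ψ) p μ :=
  h.continuous_gradient.memLp_of_hasCompactSupport h.hasCompactSupport_gradient

/-- The pairs `(ψ, ∇ψ)` of a test function and its gradient, which generate `H¹₀(Ω)`. -/
def testPairs (Ω : Set (E d)) : Set (L2Pair Ω) :=
  {w : L2Pair Ω | ∃ ψ : E d → ℝ, IsTest Ω ψ ∧
    w.fst =ᵐ[volume.restrict Ω] ψ ∧ w.snd =ᵐ[volume.restrict Ω] gradient ψ}

lemma IsTest.exists_H01 {ψ : E d → ℝ} (h : IsTest Ω ψ) :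
    ∃ w : H01 Ω, val w =ᵐ[volume.restrict Ω] ψ := by
  let w : L2Pair Ω := WithLp.toLp 2 ((h.memLp 2 _).toLp, (h.memLp_gradient 2 _).toLp)
  have hw : w ∈ testPairs Ω := ⟨ψ, h, (h.memLp 2 _).coeFn_toLp, (h.memLp_gradient 2 _).coeFn_toLp⟩
  exact ⟨⟨w, Submodule.le_topologicalClosure _ (Submodule.subset_span hw)⟩,
    (h.memLp 2 _).coeFn_toLp⟩

/-- A closed linear condition that holds for the test functions holds on `H¹₀(Ω)`. -/
lemma H01_le {Z : Submodule ℝ (L2Pair Ω)} (hZ : IsClosed (Z : Set (L2Pair Ω)))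
    (h : testPairs Ω ⊆ Z) : H01 Ω ≤ Z :=
  Submodule.topologicalClosure_minimal _ (Submodule.span_le.2 h) hZ

lemma setIntegral_eq_of_tsupport_subset {V : Type*} [NormedAddCommGroup V] [NormedSpace ℝ V]
    [MeasurableSpace V] {μ : Measure V} {U : Set V}
    {η : V → ℝ} (h : IsTest U η) (f : V → ℝ) : ∫ x in U, η x * f x ∂μ = ∫ x, η x * f x ∂μ := by
  apply setIntegral_eq_integral_of_forall_compl_eq_zero
  intro x hx
  rw [image_eq_zero_of_notMem_tsupport (fun hh => hx (h.2.2 hh)), zero_mul]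

/-- The defining identity of the weak gradient. -/
lemma integral_grad_mul_test (w : H01 Ω) {η : E d → ℝ} (h : IsTest Ω η) (e : E d) :
    ∫ x in Ω, inner ℝ (grad w x) (η x • e) =
      - ∫ x in Ω, val w x * (fderiv ℝ η x e) := by
  have m1 : MemLp (fun x => η x • e) 2 (volume.restrict Ω) :=
    (h.1.continuous.smul continuous_const).memLp_of_hasCompactSupport h.2.1.smul_right
  have m2 : MemLp (fun x => fderiv ℝ η x e) 2 (volume.restrict Ω) :=
    (((h.1.continuous_fderiv (by simp))).clm_apply continuous_const).memLp_of_hasCompactSupport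
      (h.2.1.fderiv_apply (𝕜 := ℝ) e)
  let F : L2Pair Ω →L[ℝ] ℝ :=
    (innerSL ℝ m1.toLp) ∘L (WithLp.sndL 2 ℝ (L2 Ω) (Lp (E d) 2 (volume.restrict Ω))) +
    (innerSL ℝ m2.toLp) ∘L (WithLp.fstL 2 ℝ (L2 Ω) (Lp (E d) 2 (volume.restrict Ω)))
  have hF : ∀ w : L2Pair Ω, F w = (∫ x in Ω, inner ℝ (w.snd x) (η x • e)) +
      ∫ x in Ω, w.fst x * (fderiv ℝ η x e) := by
    intro w
    have e1 : inner ℝ m1.toLp w.snd = ∫ x in Ω, inner ℝ (w.snd x) (η x • e) := by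
      rw [MeasureTheory.L2.inner_def]
      refine integral_congr_ae ?_
      filter_upwards [m1.coeFn_toLp] with x hx
      rw [hx, real_inner_comm]
    have e2 : inner ℝ m2.toLp w.fst = ∫ x in Ω, w.fst x * (fderiv ℝ η x e) := by
      rw [MeasureTheory.L2.inner_def]
      refine integral_congr_ae ?_
      filter_upwards [m2.coeFn_toLp] with x hx
      rw [hx]
      simp [inner]
    rw [← e1, ← e2]
    rfl
  have hle : H01 Ω ≤ LinearMap.ker F.toLinearMap := by
    refine H01_le F.isClosed_ker ?_
    rintro w ⟨ψ, hψ, h1, h2⟩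
    change F w = 0
    rw [hF]
    have a1 : ∫ x in Ω, inner ℝ (w.snd x) (η x • e) = ∫ x in Ω, η x * fderiv ℝ ψ x e := by
      refine integral_congr_ae ?_
      filter_upwards [h2] with x hx
      rw [hx, inner_smul_right, inner_gradient_left]
    have a2 : ∫ x in Ω, w.fst x * (fderiv ℝ η x e) = ∫ x in Ω, ψ x * fderiv ℝ η x e := by
      refine integral_congr_ae ?_
      filter_upwards [h1] with x hx
      rw [hx]
    rw [a1, a2, setIntegral_eq_of_tsupport_subset h, setIntegral_eq_of_tsupport_subset hψ]
    have cη := h.1.continuous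
    have cψ := hψ.1.continuous
    have dη : Continuous (fun x => fderiv ℝ η x e) :=
      (h.1.continuous_fderiv (by simp)).clm_apply continuous_const
    have dψ : Continuous (fun x => fderiv ℝ ψ x e) :=
      (hψ.1.continuous_fderiv (by simp)).clm_apply continuous_const
    rw [integral_mul_fderiv_eq_neg_fderiv_mul_of_integrable]
    · rw [neg_add_eq_zero]
      exact integral_congr_ae (Filter.Eventually.of_forall fun x => mul_comm _ _)
    · exact (dη.mul cψ).integrable_of_hasCompactSupport (hψ.2.1.mul_left)
    · exact (cη.mul dψ).integrable_of_hasCompactSupport (h.2.1.mul_right)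
    · exact (cη.mul cψ).integrable_of_hasCompactSupport (h.2.1.mul_right)
    · exact fun x _ => h.1.differentiable (by simp) x
    · exact fun x _ => hψ.1.differentiable (by simp) x
  have := hF w
  rw [show F w = 0 from hle w.2] at this
  change (∫ x in Ω, inner ℝ ((w : L2Pair Ω).snd x) (η x • e)) =
    - ∫ x in Ω, (w : L2Pair Ω).fst x * (fderiv ℝ η x e)
  linarith

/-- The fundamental lemma of the calculus of variations. -/
lemma ae_eq_zero_of_forall_test {V F : Type*} [NormedAddCommGroup V] [NormedSpace ℝ V]
    [FiniteDimensional ℝ V] [MeasurableSpace V] [BorelSpace V]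
    [NormedAddCommGroup F] [NormedSpace ℝ F] [CompleteSpace F]
    {U : Set V} (hU : IsOpen U) {μ : Measure V} {f : V → F}
    (hf : LocallyIntegrableOn f U μ) (h : ∀ η : V → ℝ, IsTest U η → ∫ x in U, η x • f x ∂μ = 0) :
    f =ᵐ[μ.restrict U] 0 := by
  rw [Filter.EventuallyEq, ae_restrict_iff' hU.measurableSet]
  refine hU.ae_eq_zero_of_integral_contDiff_smul_eq_zero hf fun g g1 g2 g3 => ?_
  rw [← h g ⟨g1, g2, g3⟩]
  symm
  apply setIntegral_eq_integral_of_forall_compl_eq_zero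
  intro x hx
  rw [image_eq_zero_of_notMem_tsupport (fun hh => hx (g3 hh)), zero_smul]

lemma MemLp.locallyIntegrableOn_of_two {V F : Type*} [NormedAddCommGroup V]
    [MeasurableSpace V] [BorelSpace V]
    [NormedAddCommGroup F] [ProperSpace V] {U : Set V} {μ : Measure V}
    [IsLocallyFiniteMeasure μ] {f : V → F} (hU : IsOpen U)
    (hf : MemLp f 2 (μ.restrict U)) : LocallyIntegrableOn f U μ := by
  rw [locallyIntegrableOn_iff hU.isLocallyClosed]
  intro k hk hk'
  have : IsFiniteMeasure (μ.restrict k) := ⟨by simpa using hk'.measure_lt_top⟩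
  exact (hf.mono_measure (Measure.restrict_mono hk le_rfl)).integrable (by norm_num)

lemma grad_eq_zero_of_val_eq_zero (hΩ : IsOpen Ω) {w : H01 Ω} (hw : val w = 0) : grad w = 0 := by
  have h0 : ⇑(grad w) =ᵐ[volume.restrict Ω] 0 := by
    have key : ∀ i : Fin d, ∀ᵐ x ∂(volume.restrict Ω), grad w x i = 0 := by
      intro i
      have hm : MemLp (fun x => grad w x i) 2 (volume.restrict Ω) :=
        ((EuclideanSpace.proj i : E d →L[ℝ] ℝ)).comp_memLp' (Lp.memLp (grad w))
      refine ae_eq_zero_of_forall_test hΩ (MemLp.locallyIntegrableOn_of_two hΩ hm) fun η hη => ?_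
      have := integral_grad_mul_test w hη (EuclideanSpace.single i 1)
      have h2 : ∫ x in Ω, val w x * (fderiv ℝ η x (EuclideanSpace.single i 1)) = 0 := by
        rw [hw]
        refine integral_eq_zero_of_ae ?_
        filter_upwards [Lp.coeFn_zero ℝ 2 (volume.restrict Ω)] with x hx
        rw [hx]; simp
      rw [h2, neg_zero] at this
      rw [← this]
      refine integral_congr_ae (Filter.Eventually.of_forall fun x => ?_)
      simp [inner_smul_right, EuclideanSpace.inner_single_right]
    filter_upwards [ae_all_iff.2 key] with x hx
    ext i
    exact hx i
  exact Lp.ext (h0.trans (Lp.coeFn_zero _ _ _).symm)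

/-- The weak gradient is determined by the function. -/
lemma val_injective (hΩ : IsOpen Ω) : Function.Injective (val : H01 Ω → L2 Ω) := by
  intro w w' h
  have h1 : val (w - w') = 0 := by rw [val_sub, h, sub_self]
  have h2 := grad_eq_zero_of_val_eq_zero hΩ h1
  rw [← sub_eq_zero]
  apply Subtype.ext
  apply WithLp.ofLp_injective
  exact Prod.ext h1 h2

@[simp] lemma lift_val (hΩ : IsOpen Ω) (w : H01 Ω) : lift (val w) = w := by
  have h : ∃ w' : H01 Ω, val w' = val w := ⟨w, rfl⟩
  rw [lift, dif_pos h]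
  exact val_injective hΩ h.choose_spec

/-- `H¹₀(Ω)` is dense in `L²(Ω)`. -/
lemma eq_zero_of_forall_inner_val (hΩ : IsOpen Ω) {q : L2 Ω}
    (h : ∀ w : H01 Ω, inner ℝ q (val w) = 0) : q = 0 := by
  have h0 : ⇑q =ᵐ[volume.restrict Ω] 0 := by
    refine ae_eq_zero_of_forall_test hΩ
      (MemLp.locallyIntegrableOn_of_two hΩ (Lp.memLp q)) fun η hη => ?_
    obtain ⟨w, hw⟩ := hη.exists_H01
    rw [← h w, MeasureTheory.L2.inner_def]
    refine integral_congr_ae ?_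
    filter_upwards [hw] with x hx
    rw [hx]; simp [inner]
  exact Lp.ext (h0.trans (Lp.coeFn_zero _ _ _).symm)

end

noncomputable section

/-! ### The Sobolev embedding `H¹₀(Ω) → L⁴(Ω)` and the spatial form -/

variable {d : ℕ} {Ω : Set (E d)}

lemma testPairs_add {w w' : L2Pair Ω} (hw : w ∈ testPairs Ω) (hw' : w' ∈ testPairs Ω) :
    w + w' ∈ testPairs Ω := by
  obtain ⟨ψ, hψ, h1, h2⟩ := hw
  obtain ⟨ψ', hψ', h1', h2'⟩ := hw'
  refine ⟨ψ + ψ', ⟨hψ.1.add hψ'.1, hψ.2.1.add hψ'.2.1,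
    (tsupport_add _ _).trans (union_subset hψ.2.2 hψ'.2.2)⟩, ?_, ?_⟩
  · exact (Lp.coeFn_add _ _).trans (h1.add h1')
  · refine (Lp.coeFn_add _ _).trans ((h2.add h2').trans (Filter.Eventually.of_forall fun x => ?_))
    simp only [Pi.add_apply, gradient]
    rw [fderiv_add (hψ.1.differentiable (by simp) x) (hψ'.1.differentiable (by simp) x), map_add]

lemma testPairs_smul (c : ℝ) {w : L2Pair Ω} (hw : w ∈ testPairs Ω) : c • w ∈ testPairs Ω := by
  obtain ⟨ψ, hψ, h1, h2⟩ := hw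
  refine ⟨c • ψ, ⟨contDiff_const.smul hψ.1, hψ.2.1.smul_left (f := fun _ => c),
    (tsupport_smul_subset_right (fun _ => c) ψ).trans hψ.2.2⟩, ?_, ?_⟩
  · exact (Lp.coeFn_smul _ _).trans (h1.const_smul c)
  · refine (Lp.coeFn_smul _ _).trans ((h2.const_smul c).trans
      (Filter.Eventually.of_forall fun x => ?_))
    simp only [Pi.smul_apply, gradient]
    rw [fderiv_const_smul (hψ.1.differentiable (by simp) x), map_smul]

lemma testPairs_zero : (0 : L2Pair Ω) ∈ testPairs Ω := by
  refine ⟨0, ⟨contDiff_const, HasCompactSupport.zero, by simp [tsupport]⟩, Lp.coeFn_zero _ _ _,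
    (Lp.coeFn_zero _ _ _).trans (Filter.Eventually.of_forall fun x => ?_)⟩
  simp [gradient]

lemma H01_eq_closure : (H01 Ω : Set (L2Pair Ω)) = closure (testPairs Ω) := by
  let Z : Submodule ℝ (L2Pair Ω) :=
    { carrier := testPairs Ω
      add_mem' := testPairs_add
      zero_mem' := testPairs_zero
      smul_mem' := fun c _ h => testPairs_smul c h }
  have : Submodule.span ℝ (testPairs Ω) = Z := Submodule.span_eq Z
  change ((Submodule.span ℝ (testPairs Ω)).topologicalClosure : Set (L2Pair Ω)) = _
  rw [this]
  rfl

/-- The Gagliardo–Nirenberg–Sobolev inequality for test functions. The exponent `7/4` is less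
than `2 ≤ d` and its Sobolev conjugate is at least `4` for `d ≤ 3`. -/
lemma exists_sobolev_test (hd : d = 2 ∨ d = 3) (hb : Bornology.IsBounded Ω) :
    ∃ C : ENNReal, C ≠ ⊤ ∧ ∀ ψ : E d → ℝ, IsTest Ω ψ →
      eLpNorm ψ 4 (volume.restrict Ω) ≤ C * eLpNorm (gradient ψ) 2 (volume.restrict Ω) := by
  have hfin : volume Ω ≠ ⊤ := hb.measure_lt_top.ne
  let C₀ := eLpNormLESNormFDerivOfLeConst ℝ (volume : Measure (E d)) Ω (7 / 4) 4
  refine ⟨C₀ * volume Ω ^ (1 / (7 / 4 : ℝ) - 1 / 2), ENNReal.mul_ne_top (by simp)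
    (ENNReal.rpow_ne_top_of_nonneg (by norm_num) hfin), fun ψ hψ => ?_⟩
  have hs : Function.support ψ ⊆ Ω := (subset_tsupport ψ).trans hψ.2.2
  have h1 : eLpNorm ψ ((4 : NNReal) : ENNReal) volume ≤
      C₀ * eLpNorm (fderiv ℝ ψ) ((7 / 4 : NNReal) : ENNReal) volume := by
    refine eLpNorm_le_eLpNorm_fderiv_of_le (p := 7 / 4) (q := 4) volume (hψ.1.of_le (by simp))
      hs ?_ ?_ ?_ hb
    · rw [← NNReal.coe_le_coe]; push_cast; norm_num
    · rw [← NNReal.coe_lt_coe]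
      rcases hd with rfl | rfl <;> simp <;> norm_num
    · rcases hd with rfl | rfl <;> simp <;> norm_num
  have hsg : Function.support (fderiv ℝ ψ) ⊆ Ω :=
    (support_fderiv_subset ℝ).trans hψ.2.2
  rw [← eLpNorm_restrict_eq_of_support_subset hs,
    ← eLpNorm_restrict_eq_of_support_subset (f := fderiv ℝ ψ) hsg] at h1
  have h2 : eLpNorm (fderiv ℝ ψ) ((7 / 4 : NNReal) : ENNReal) (volume.restrict Ω) ≤
      eLpNorm (fderiv ℝ ψ) 2 (volume.restrict Ω) * volume Ω ^ (1 / (7 / 4 : ℝ) - 1 / 2) := by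
    have := eLpNorm_le_eLpNorm_mul_rpow_measure_univ (μ := volume.restrict Ω)
      (p := ((7 / 4 : NNReal) : ENNReal)) (q := ((2 : NNReal) : ENNReal)) (f := fderiv ℝ ψ)
      (by rw [ENNReal.coe_le_coe, ← NNReal.coe_le_coe]; push_cast; norm_num)
      (hψ.1.continuous_fderiv (by simp)).aestronglyMeasurable
    simpa using this
  have h3 : eLpNorm (fderiv ℝ ψ) 2 (volume.restrict Ω) =
      eLpNorm (gradient ψ) 2 (volume.restrict Ω) := by
    refine eLpNorm_congr_norm_ae (Filter.Eventually.of_forall fun x => ?_)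
    simp [gradient]
  calc eLpNorm ψ 4 (volume.restrict Ω) ≤
        C₀ * eLpNorm (fderiv ℝ ψ) ((7 / 4 : NNReal) : ENNReal) (volume.restrict Ω) := by
        simpa using h1
    _ ≤ C₀ * (eLpNorm (fderiv ℝ ψ) 2 (volume.restrict Ω) *
        volume Ω ^ (1 / (7 / 4 : ℝ) - 1 / 2)) := by gcongr
    _ = _ := by rw [h3]; ring

lemma exists_sobolev (hd : d = 2 ∨ d = 3) (hb : Bornology.IsBounded Ω) :
    ∃ C : ENNReal, C ≠ ⊤ ∧ ∀ w : H01 Ω,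
      eLpNorm (val w) 4 (volume.restrict Ω) ≤ C * ‖grad w‖ₑ := by
  obtain ⟨C, hC, h⟩ := exists_sobolev_test (Ω := Ω) hd hb
  refine ⟨C, hC, fun w => ?_⟩
  have hw : (w : L2Pair Ω) ∈ closure (testPairs Ω) := by
    rw [← H01_eq_closure]; exact w.2
  obtain ⟨s, hs, hlim⟩ := mem_closure_iff_seq_limit.1 hw
  have l1 : Filter.Tendsto (fun n => (s n).fst) Filter.atTop (nhds (val w)) :=
    ((WithLp.fstL 2 ℝ (L2 Ω) (Lp (E d) 2 (volume.restrict Ω))).continuous.tendsto _).comp hlim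
  have l2 : Filter.Tendsto (fun n => (s n).snd) Filter.atTop (nhds (grad w)) :=
    ((WithLp.sndL 2 ℝ (L2 Ω) (Lp (E d) 2 (volume.restrict Ω))).continuous.tendsto _).comp hlim
  obtain ⟨k, hk, hae⟩ := (tendstoInMeasure_of_tendsto_Lp l1).exists_seq_tendsto_ae
  have hbound : ∀ n, eLpNorm (s n).fst 4 (volume.restrict Ω) ≤ C * ‖(s n).snd‖ₑ := by
    intro n
    obtain ⟨ψ, hψ, h1, h2⟩ := hs n
    rw [eLpNorm_congr_ae h1, Lp.enorm_def, eLpNorm_congr_ae h2]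
    exact h ψ hψ
  refine (Lp.eLpNorm_lim_le_liminf_eLpNorm (fun n => Lp.aestronglyMeasurable (s (k n)).fst)
    _ hae).trans ?_
  have l3 : Filter.Tendsto (fun n => C * ‖(s (k n)).snd‖ₑ) Filter.atTop (nhds (C * ‖grad w‖ₑ)) :=
    ENNReal.Tendsto.const_mul
      ((continuous_enorm.tendsto _).comp (l2.comp hk.tendsto_atTop)) (Or.inr hC)
  rw [← l3.liminf_eq]
  exact Filter.liminf_le_liminf (Filter.Eventually.of_forall fun n => hbound (k n))

instance fact_one_le_four : Fact ((1 : ENNReal) ≤ 4) := ⟨by norm_num⟩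

instance holderTriple_four : ENNReal.HolderTriple 4 4 2 where
  inv_add_inv_eq_inv := by
    rw [show (4 : ENNReal) = 2 * 2 by norm_num, ENNReal.mul_inv (by simp) (by simp), ← mul_add,
      ENNReal.inv_two_add_inv_two, mul_one]

lemma memLp_four_val (hd : d = 2 ∨ d = 3) (hb : Bornology.IsBounded Ω) (w : H01 Ω) :
    MemLp (val w) 4 (volume.restrict Ω) := by
  obtain ⟨C, hC, h⟩ := exists_sobolev (Ω := Ω) hd hb
  exact ⟨Lp.aestronglyMeasurable _,
    (h w).trans_lt (ENNReal.mul_lt_top hC.lt_top enorm_lt_top)⟩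

/-- The Sobolev embedding as a linear map. -/
def val4Linear (hd : d = 2 ∨ d = 3) (hb : Bornology.IsBounded Ω) :
    H01 Ω →ₗ[ℝ] Lp ℝ 4 (volume.restrict Ω) where
  toFun w := (memLp_four_val hd hb w).toLp
  map_add' w w' := by
    apply Lp.ext
    filter_upwards [(memLp_four_val hd hb (w + w')).coeFn_toLp,
      (memLp_four_val hd hb w).coeFn_toLp, (memLp_four_val hd hb w').coeFn_toLp,
      Lp.coeFn_add (val w) (val w'),
      Lp.coeFn_add (memLp_four_val hd hb w).toLp (memLp_four_val hd hb w').toLp]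
      with x h1 h2 h3 h4 h5
    rw [h5, Pi.add_apply, h1, h2, h3, val_add, h4, Pi.add_apply]
  map_smul' c w := by
    apply Lp.ext
    filter_upwards [(memLp_four_val hd hb (c • w)).coeFn_toLp,
      (memLp_four_val hd hb w).coeFn_toLp, Lp.coeFn_smul c (val w),
      Lp.coeFn_smul c (memLp_four_val hd hb w).toLp] with x h1 h2 h3 h4
    rw [RingHom.id_apply, h4, Pi.smul_apply, h1, h2, val_smul, h3, Pi.smul_apply]

lemma exists_val4Linear_bound (hd : d = 2 ∨ d = 3) (hb : Bornology.IsBounded Ω) :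
    ∃ C : ℝ, ∀ w, ‖val4Linear (Ω := Ω) hd hb w‖ ≤ C * ‖w‖ := by
  obtain ⟨C, hC, h⟩ := exists_sobolev (Ω := Ω) hd hb
  refine ⟨C.toReal * ‖gradL Ω‖, fun w => ?_⟩
  have h1 : ‖val4Linear hd hb w‖ = (eLpNorm (val w) 4 (volume.restrict Ω)).toReal :=
    Lp.norm_toLp _ (memLp_four_val hd hb w)
  have h2 : (eLpNorm (val w) 4 (volume.restrict Ω)).toReal ≤ (C * ‖grad w‖ₑ).toReal :=
    ENNReal.toReal_mono (ENNReal.mul_ne_top hC enorm_ne_top) (h w)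
  rw [ENNReal.toReal_mul, toReal_enorm] at h2
  rw [h1, mul_assoc]
  refine h2.trans (mul_le_mul_of_nonneg_left ?_ ENNReal.toReal_nonneg)
  exact (gradL Ω).le_opNorm w

/-- The Sobolev embedding `H¹₀(Ω) → L⁴(Ω)`. -/
def val4 (hd : d = 2 ∨ d = 3) (hb : Bornology.IsBounded Ω) :
    H01 Ω →L[ℝ] Lp ℝ 4 (volume.restrict Ω) :=
  (val4Linear hd hb).mkContinuousOfExistsBound (exists_val4Linear_bound hd hb)

lemma val4_coe (hd : d = 2 ∨ d = 3) (hb : Bornology.IsBounded Ω) (w : H01 Ω) :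
    ⇑(val4 hd hb w) =ᵐ[volume.restrict Ω] val w :=
  MemLp.coeFn_toLp (memLp_four_val hd hb w)

lemma real_inner_eq_mul (a b : ℝ) : inner ℝ a b = a * b := by
  simp [inner, mul_comm]

/-- The inner product of a real Hilbert space as a bounded bilinear form. -/
def innerForm (F : Type*) [NormedAddCommGroup F] [InnerProductSpace ℝ F] : F →L[ℝ] F →L[ℝ] ℝ :=
  (innerₗ F).mkContinuous₂ 1 fun x y => by
    rw [one_mul]; exact norm_inner_le_norm x y

/-- The `i`-th partial derivative. -/
def partialL (Ω : Set (E d)) (i : Fin d) : H01 Ω →L[ℝ] L2 Ω :=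
  ((EuclideanSpace.proj i : E d →L[ℝ] ℝ).compLpL 2 (volume.restrict Ω)) ∘L gradL Ω

lemma partialL_coe (i : Fin d) (w : H01 Ω) :
    ⇑(partialL Ω i w) =ᵐ[volume.restrict Ω] fun x => grad w x i :=
  ContinuousLinearMap.coeFn_compLpL _ _

/-- The convection form `(u, φ) ↦ (v·∇u, φ)` as a bounded bilinear form on `H¹₀(Ω)`. -/
def advForm (hd : d = 2 ∨ d = 3) (hb : Bornology.IsBounded Ω) (v : Fin d → H01 Ω) :
    H01 Ω →L[ℝ] H01 Ω →L[ℝ] ℝ :=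
  ∑ i, (innerForm _).bilinearComp (partialL Ω i)
    (((ContinuousLinearMap.mul ℝ ℝ).holderL (volume.restrict Ω) 4 4 2 (val4 hd hb (v i))) ∘L
      val4 hd hb)

lemma advForm_apply_eq_sum (hd : d = 2 ∨ d = 3) (hb : Bornology.IsBounded Ω)
    (v : Fin d → H01 Ω) (u φ : H01 Ω) :
    advForm hd hb v u φ = ∑ i, inner ℝ (partialL Ω i u)
      ((ContinuousLinearMap.mul ℝ ℝ).holderL (volume.restrict Ω) 4 4 2 (val4 hd hb (v i))
        (val4 hd hb φ)) := by
  simp only [advForm, sum_apply]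
  rfl

lemma advForm_apply (hd : d = 2 ∨ d = 3) (hb : Bornology.IsBounded Ω) (v : Fin d → H01 Ω)
    (u φ : H01 Ω) : advForm hd hb v u φ = ∫ x in Ω, adv v (grad u) x * val φ x := by
  rw [advForm_apply_eq_sum]
  simp only [MeasureTheory.L2.inner_def]
  rw [← integral_finsetSum _ fun i _ => MeasureTheory.L2.integrable_inner _ _]
  refine integral_congr_ae ?_
  have h1 : ∀ᵐ x ∂(volume.restrict Ω), ∀ i, partialL Ω i u x = grad u x i :=
    ae_all_iff.2 fun i => partialL_coe i u
  have h2 : ∀ᵐ x ∂(volume.restrict Ω), ∀ i,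
      (ContinuousLinearMap.mul ℝ ℝ).holderL (volume.restrict Ω) 4 4 2 (val4 hd hb (v i))
        (val4 hd hb φ) x = val (v i) x * val φ x := by
    refine ae_all_iff.2 fun i => ?_
    filter_upwards [(ContinuousLinearMap.mul ℝ ℝ).coeFn_holder (r := 2) (val4 hd hb (v i))
      (val4 hd hb φ), val4_coe hd hb (v i), val4_coe hd hb φ] with x hx h3 h4
    rw [ContinuousLinearMap.holderL_apply_apply, hx, h3, h4]; rfl
  filter_upwards [h1, h2] with x h1 h2
  rw [adv, Finset.sum_mul]
  refine Finset.sum_congr rfl fun i _ => ?_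
  rw [h1, h2]
  simp only [real_inner_eq_mul]
  ring

lemma advForm_sub_apply (hd : d = 2 ∨ d = 3) (hb : Bornology.IsBounded Ω)
    (v v' : Fin d → H01 Ω) (u φ : H01 Ω) :
    advForm hd hb (v - v') u φ = advForm hd hb v u φ - advForm hd hb v' u φ := by
  simp only [sub_apply, advForm_apply_eq_sum, Pi.sub_apply, map_sub,
    inner_sub_right, Finset.sum_sub_distrib]

namespace Problem

variable (P : Problem d)

/-- The spatial form `a(·,v)(·)` as a bounded bilinear form on `H¹₀(Ω)`. -/
def aForm (hd : d = 2 ∨ d = 3) (v : Fin d → H01 P.Ω) : H01 P.Ω →L[ℝ] H01 P.Ω →L[ℝ] ℝ :=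
  P.ε • (innerForm _).bilinearComp (gradL P.Ω) (gradL P.Ω) + advForm hd P.bounded v +
    (innerForm _).bilinearComp
      (((ContinuousLinearMap.mul ℝ ℝ).holderL (volume.restrict P.Ω) ⊤ 2 2 P.α_mem.toLp) ∘L
        valL P.Ω) (valL P.Ω)

lemma aForm_apply (hd : d = 2 ∨ d = 3) (v : Fin d → H01 P.Ω) (u φ : H01 P.Ω) :
    P.aForm hd v u φ = P.a u v φ := by
  rw [a, ← advForm_apply hd P.bounded]
  change P.ε * inner ℝ (grad u) (grad φ) + advForm hd P.bounded v u φ +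
    inner ℝ ((ContinuousLinearMap.mul ℝ ℝ).holderL (volume.restrict P.Ω) ⊤ 2 2 P.α_mem.toLp
      (val u)) (val φ) = _
  congr 1
  · congr 1
    rw [MeasureTheory.L2.inner_def, ← integral_const_mul]
    simp only [inner_smul_left, conj_trivial]
  · rw [MeasureTheory.L2.inner_def]
    refine integral_congr_ae ?_
    filter_upwards [(ContinuousLinearMap.mul ℝ ℝ).coeFn_holder (r := 2) P.α_mem.toLp (val u),
      P.α_mem.coeFn_toLp] with x hx h3
    rw [ContinuousLinearMap.holderL_apply_apply, hx, h3]
    simp only [ContinuousLinearMap.mul_apply', real_inner_eq_mul]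

lemma a_sub_a (hd : d = 2 ∨ d = 3) (v v' : Fin d → H01 P.Ω) (u φ : H01 P.Ω) :
    P.a u v φ - P.a u v' φ = ∫ x in P.Ω, adv (v - v') (grad u) x * val φ x := by
  have h := advForm_sub_apply hd P.bounded v v' u φ
  simp only [advForm_apply] at h
  simp only [a, h]
  ring

end Problem

end

noncomputable section

/-! ### Integration by parts for weakly differentiable functions of one variable -/

/-- The primitive, normalized at `a`, of a test function on `(a,b)` with integral zero is itself a
test function on `(a,b)`. -/
lemma IsTest.primitive {a b : ℝ} {θ : ℝ → ℝ} (hab : a < b) (h : IsTest (Ioo a b) θ)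
    (h0 : ∫ t in Ioc a b, θ t = 0) :
    IsTest (Ioo a b) (fun t => ∫ s in a..t, θ s) ∧
      ∀ t, HasDerivAt (fun t => ∫ s in a..t, θ s) (θ t) t := by
  have hc := h.1.continuous
  have hder : ∀ t, HasDerivAt (fun t => ∫ s in a..t, θ s) (θ t) t := fun t =>
    intervalIntegral.integral_hasDerivAt_right (hc.intervalIntegrable _ _)
      (hc.stronglyMeasurableAtFilter _ _) hc.continuousAt
  have hsm : ContDiff ℝ ∞ (fun t => ∫ s in a..t, θ s) := by
    rw [contDiff_infty_iff_deriv]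
    refine ⟨fun t => (hder t).differentiableAt, ?_⟩
    have : deriv (fun t => ∫ s in a..t, θ s) = θ := funext fun t => (hder t).deriv
    rw [this]; exact h.1
  obtain ⟨c, d, hcd, hsub⟩ : ∃ c d, Icc c d ⊆ Ioo a b ∧ tsupport θ ⊆ Icc c d := by
    rcases (tsupport θ).eq_empty_or_nonempty with he | hne
    · exact ⟨1, 0, by simp, by simp [he]⟩
    · have hK : IsCompact (tsupport θ) := h.2.1
      refine ⟨sInf (tsupport θ), sSup (tsupport θ), ?_, fun x hx =>
        ⟨csInf_le hK.bddBelow hx, le_csSup hK.bddAbove hx⟩⟩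
      have h1 := h.2.2 (hK.sInf_mem hne)
      have h2 := h.2.2 (hK.sSup_mem hne)
      exact fun x hx => ⟨h1.1.trans_le hx.1, hx.2.trans_lt h2.2⟩
  have hz : ∀ t, t ∉ Icc c d → θ t = 0 := fun t ht =>
    image_eq_zero_of_notMem_tsupport fun hh => ht (hsub hh)
  have hz' : ∀ t, t ∉ Ioo a b → θ t = 0 := fun t ht => hz t fun hh => ht (hcd hh)
  have hsupp : Function.support (fun t => ∫ s in a..t, θ s) ⊆ Icc c d := by
    intro t ht
    by_contra hn
    apply ht
    change ∫ s in a..t, θ s = 0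
    rcases le_or_gt c t with h1 | h1
    · -- to the right of the support the primitive is the total integral
      have h2 : d < t := by
        by_contra h2; exact hn ⟨h1, not_lt.1 h2⟩
      have e1 : ∫ s in t..b, θ s = 0 := by
        apply intervalIntegral.integral_zero_ae
        refine Filter.Eventually.of_forall fun s hs => ?_
        rcases le_total t b with h3 | h3
        · rw [uIoc_of_le h3] at hs
          exact hz s fun hh => absurd hh.2 (not_le.2 (h2.trans hs.1))
        · rw [uIoc_of_ge h3] at hs
          exact hz' s fun hh => absurd hh.2 (not_lt.2 hs.1.le)
      have e2 := intervalIntegral.integral_add_adjacent_intervals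
        (hc.intervalIntegrable (μ := volume) a t) (hc.intervalIntegrable t b)
      rw [e1, add_zero, intervalIntegral.integral_of_le hab.le, h0] at e2
      exact e2
    · apply intervalIntegral.integral_zero_ae
      refine Filter.Eventually.of_forall fun s hs => ?_
      rcases le_total a t with h3 | h3
      · rw [uIoc_of_le h3] at hs
        exact hz s fun hh => absurd hh.1 (not_le.2 (hs.2.trans_lt h1))
      · rw [uIoc_of_ge h3] at hs
        exact hz' s fun hh => absurd hh.1 (not_lt.2 hs.2)
  have hts : tsupport (fun t => ∫ s in a..t, θ s) ⊆ Icc c d := closure_minimal hsupp isClosed_Icc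
  exact ⟨⟨hsm, HasCompactSupport.of_support_subset_isCompact isCompact_Icc hsupp,
    hts.trans hcd⟩, hder⟩

lemma exists_isTest_integral_eq_one {a b : ℝ} (hab : a < b) :
    ∃ θ : ℝ → ℝ, IsTest (Ioo a b) θ ∧ ∫ t in Ioc a b, θ t = 1 := by
  let φ : ContDiffBump ((a + b) / 2 : ℝ) := ⟨(b - a) / 8, (b - a) / 4, by linarith, by linarith⟩
  have hsub : tsupport (φ.normed volume) ⊆ Ioo a b := by
    rw [φ.tsupport_normed_eq, Real.closedBall_eq_Icc]
    intro x hx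
    simp only [φ] at hx
    exact ⟨by linarith [hx.1], by linarith [hx.2]⟩
  refine ⟨φ.normed volume, ⟨φ.contDiff_normed, φ.hasCompactSupport_normed, hsub⟩, ?_⟩
  rw [setIntegral_eq_integral_of_forall_compl_eq_zero, φ.integral_normed]
  intro x hx
  exact image_eq_zero_of_notMem_tsupport fun hh => hx (Ioo_subset_Ioc_self (hsub hh))

/-- The lemma of du Bois-Reymond: a function with weak derivative zero is constant. -/
lemma exists_ae_eq_const_of_weakDeriv_zero {a b : ℝ} (hab : a < b) {f : ℝ → ℝ}
    (hf : IntegrableOn f (Ioc a b))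
    (h : ∀ η : ℝ → ℝ, IsTest (Ioo a b) η → ∫ t in Ioc a b, deriv η t * f t = 0) :
    ∃ c, ∀ᵐ t ∂(volume.restrict (Ioo a b)), f t = c := by
  obtain ⟨θ₀, hθ₀, h1⟩ := exists_isTest_integral_eq_one hab
  have hint : ∀ θ : ℝ → ℝ, IsTest (Ioo a b) θ →
      IntegrableOn (fun t => θ t * f t) (Ioc a b) := by
    intro θ hθ
    obtain ⟨M, hM⟩ := hθ.1.continuous.bounded_above_of_compact_support hθ.2.1
    exact hf.bdd_mul hθ.1.continuous.aestronglyMeasurable (Filter.Eventually.of_forall hM)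
  have hint' : ∀ θ : ℝ → ℝ, IsTest (Ioo a b) θ → IntegrableOn θ (Ioc a b) := fun θ hθ =>
    (hθ.1.continuous.integrable_of_hasCompactSupport hθ.2.1).integrableOn
  set c := ∫ t in Ioc a b, θ₀ t * f t
  refine ⟨c, ?_⟩
  have key : (fun t => f t - c) =ᵐ[volume.restrict (Ioo a b)] 0 := by
    refine ae_eq_zero_of_forall_test isOpen_Ioo ?_ fun θ hθ => ?_
    · refine IntegrableOn.locallyIntegrableOn ?_
      exact (hf.sub (integrableOn_const (by simp))).mono_set Ioo_subset_Ioc_self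
    · set m := ∫ t in Ioc a b, θ t
      have hT : IsTest (Ioo a b) (fun t => θ t - m * θ₀ t) := by
        refine ⟨hθ.1.sub (contDiff_const.mul hθ₀.1), hθ.2.1.sub hθ₀.2.1.mul_left, ?_⟩
        exact (tsupport_sub _ _).trans (union_subset hθ.2.2
          ((tsupport_mul_subset_right (f := fun _ => m)).trans hθ₀.2.2))
      have hzero : ∫ t in Ioc a b, (θ t - m * θ₀ t) = 0 := by
        rw [integral_sub (hint' θ hθ) ((hint' θ₀ hθ₀).const_mul m), integral_const_mul, h1,
          mul_one, sub_self]
      obtain ⟨hη, hder⟩ := hT.primitive hab hzero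
      have h2 := h _ hη
      have e1 : ∀ t, deriv (fun t => ∫ s in a..t, (θ s - m * θ₀ s)) t * f t =
          θ t * f t - m * (θ₀ t * f t) := fun t => by rw [(hder t).deriv]; ring
      simp only [e1] at h2
      rw [integral_sub (hint θ hθ) ((hint θ₀ hθ₀).const_mul m), integral_const_mul] at h2
      rw [← integral_Ioc_eq_integral_Ioo]
      have e2 : ∀ t, θ t • (f t - c) = θ t * f t - c * θ t := fun t => by
        simp only [smul_eq_mul]; ring
      simp only [e2]
      rw [integral_sub (hint θ hθ) ((hint' θ hθ).const_mul c), integral_const_mul]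
      linarith
  filter_upwards [key] with t ht
  exact sub_eq_zero.1 ht

/-- Integration by parts of a smooth function against a primitive. -/
lemma integral_deriv_mul_primitive {a b : ℝ} {k : ℝ → ℝ} (C : ℝ)
    (hk : IntervalIntegrable k volume a b) {p : ℝ → ℝ} (hp : ContDiff ℝ 1 p) :
    ∫ t in a..b, deriv p t * (C + ∫ s in a..t, k s) =
      p b * (C + ∫ s in a..b, k s) - p a * C - ∫ t in a..b, p t * k t := by
  have hH : AbsolutelyContinuousOnInterval (fun t => C + ∫ s in a..t, k s) a b := by
    have h1 := hk.absolutelyContinuousOnInterval_intervalIntegral (c := a) (by simp)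
    have h2 : AbsolutelyContinuousOnInterval (fun _ : ℝ => C) a b :=
      (contDiff_const.contDiffOn (n := 1)).absolutelyContinuousOnInterval
    exact h2.add h1
  have hpa : AbsolutelyContinuousOnInterval p a b :=
    hp.contDiffOn.absolutelyContinuousOnInterval
  have h := hpa.integral_mul_deriv_eq_deriv_mul hH
  have e : ∫ t in a..b, p t * deriv (fun t => C + ∫ s in a..t, k s) t =
      ∫ t in a..b, p t * k t := by
    apply intervalIntegral.integral_congr_ae
    filter_upwards [hk.ae_hasDerivAt_integral] with t ht hm
    rw [((ht (uIoc_subset_uIcc hm) a (by simp)).const_add C).deriv]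
  rw [e] at h
  simp only [intervalIntegral.integral_same, add_zero] at h
  linarith

/-- Integration by parts, without boundary conditions, for a continuous function `h` on `[a,b]`
with integrable weak derivative `k`. -/
lemma integral_deriv_mul_of_weakDeriv {a b : ℝ} (hab : a < b) {h k : ℝ → ℝ}
    (hh : ContinuousOn h (Icc a b)) (hk : IntegrableOn k (Ioc a b))
    (hw : ∀ η : ℝ → ℝ, IsTest (Ioo a b) η →
      ∫ t in Ioc a b, deriv η t * h t = - ∫ t in Ioc a b, η t * k t)
    {p : ℝ → ℝ} (hp : ContDiff ℝ 1 p) :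
    ∫ t in Ioc a b, deriv p t * h t = p b * h b - p a * h a - ∫ t in Ioc a b, p t * k t := by
  have hk' : IntervalIntegrable k volume a b := (intervalIntegrable_iff_integrableOn_Ioc_of_le
    hab.le).2 hk
  have hHc : ContinuousOn (fun t => ∫ s in a..t, k s) (Icc a b) := by
    have := intervalIntegral.continuousOn_primitive_interval' hk' (left_mem_uIcc)
    rwa [uIcc_of_le hab.le] at this
  have hi : ∀ {f : ℝ → ℝ}, ContinuousOn f (Icc a b) → IntegrableOn f (Ioc a b) := fun hf =>
    (hf.integrableOn_compact isCompact_Icc).mono_set Ioc_subset_Icc_self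
  obtain ⟨c, hc⟩ := exists_ae_eq_const_of_weakDeriv_zero hab (f := fun t => h t - ∫ s in a..t, k s)
    (hi (hh.sub hHc)) (by
      intro η hη
      have dη : Continuous (deriv η) := hη.1.continuous_deriv (by simp)
      have h1 := integral_deriv_mul_primitive 0 hk' (hη.1.of_le (by simp))
      have za : η a = 0 := image_eq_zero_of_notMem_tsupport fun hh => (lt_irrefl _ (hη.2.2 hh).1)
      have zb : η b = 0 := image_eq_zero_of_notMem_tsupport fun hh => (lt_irrefl _ (hη.2.2 hh).2)
      rw [za, zb] at h1
      simp only [zero_add, zero_mul, sub_zero, zero_sub] at h1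
      rw [intervalIntegral.integral_of_le hab.le, intervalIntegral.integral_of_le hab.le] at h1
      have i1 : IntegrableOn (fun t => deriv η t * h t) (Ioc a b) := hi (dη.continuousOn.mul hh)
      have i2 : IntegrableOn (fun t => deriv η t * ∫ s in a..t, k s) (Ioc a b) :=
        hi (dη.continuousOn.mul hHc)
      simp only [mul_sub]
      rw [integral_sub i1 i2, hw η hη, h1, sub_self])
  have hev : ∀ t ∈ Icc a b, h t - ∫ s in a..t, k s = c := by
    have := Measure.eqOn_Icc_of_ae_eq volume hab.ne
      (f := fun t => h t - ∫ s in a..t, k s) (g := fun _ => c)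
      (by rw [← restrict_Ioo_eq_restrict_Icc]; exact hc) (hh.sub hHc) continuousOn_const
    exact this
  have hev' : ∀ t ∈ Icc a b, h t = c + ∫ s in a..t, k s := fun t ht => by
    linarith [hev t ht]
  have h2 := integral_deriv_mul_primitive c hk' hp
  rw [← hev' b (right_mem_Icc.2 hab.le), intervalIntegral.integral_of_le hab.le,
    intervalIntegral.integral_of_le (f := fun t => p t * k t) hab.le] at h2
  have ha := hev' a (left_mem_Icc.2 hab.le)
  rw [intervalIntegral.integral_same, add_zero] at ha
  rw [ha, ← h2]
  refine setIntegral_congr_fun measurableSet_Ioc fun t ht => ?_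
  simp only [hev' t (Ioc_subset_Icc_self ht)]

end

noncomputable section

/-! ### Functions that are regular on one time interval -/

variable {d : ℕ} {Ω : Set (E d)}

/-- The regularity of a function on a single time interval `(a,b]` that the dG form needs: it is in
`L²(a,b;H¹₀(Ω))`, has a weak time derivative in `L²(a,b;H⁻¹(Ω))`, and has one-sided limits in
`L²(Ω)` at both ends. -/
structure IsRegularOn (a b : ℝ) (u : ℝ → L2 Ω) : Prop where
  exists_H01 : ∃ U : ℝ → H01 Ω, MemLp U 2 (volume.restrict (Ioc a b)) ∧
    ∀ᵐ t ∂(volume.restrict (Ioc a b)), u t = val (U t)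
  exists_dt : ∃ f, IsWeakDt a b u f
  exists_limPlus : ∃ y, Filter.Tendsto u (nhdsWithin a (Ioi a)) (nhds y)
  exists_limMinus : ∃ y, Filter.Tendsto u (nhdsWithin b (Iio b)) (nhds y)

lemma tendsto_limPlus_of_exists {u : ℝ → L2 Ω} {a : ℝ}
    (h : ∃ y, Filter.Tendsto u (nhdsWithin a (Ioi a)) (nhds y)) :
    Filter.Tendsto u (nhdsWithin a (Ioi a)) (nhds (limPlus u a)) := by
  obtain ⟨y, hy⟩ := h
  rwa [limPlus, rightLim_eq_of_tendsto hy]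

lemma limPlus_eq {u : ℝ → L2 Ω} {a : ℝ} {y : L2 Ω}
    (h : Filter.Tendsto u (nhdsWithin a (Ioi a)) (nhds y)) : limPlus u a = y :=
  rightLim_eq_of_tendsto h

lemma limMinus_eq {u : ℝ → L2 Ω} {a : ℝ} {y : L2 Ω}
    (h : Filter.Tendsto u (nhdsWithin a (Iio a)) (nhds y)) : limMinus u a = y :=
  leftLim_eq_of_tendsto h

lemma tendsto_limMinus_of_exists {u : ℝ → L2 Ω} {a : ℝ}
    (h : ∃ y, Filter.Tendsto u (nhdsWithin a (Iio a)) (nhds y)) :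
    Filter.Tendsto u (nhdsWithin a (Iio a)) (nhds (limMinus u a)) := by
  obtain ⟨y, hy⟩ := h
  rwa [limMinus_eq hy]

namespace IsRegularOn

variable {a b : ℝ} {u w : ℝ → L2 Ω}

lemma eq_val_lift (hΩ : IsOpen Ω) (h : IsRegularOn a b u) :
    ∀ᵐ t ∂(volume.restrict (Ioc a b)), u t = val (lift (u t)) := by
  obtain ⟨U, -, h2⟩ := h.exists_H01
  filter_upwards [h2] with t ht
  rw [ht, lift_val hΩ]

lemma memLp_lift (hΩ : IsOpen Ω) (h : IsRegularOn a b u) :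
    MemLp (fun t => lift (u t)) 2 (volume.restrict (Ioc a b)) := by
  obtain ⟨U, h1, h2⟩ := h.exists_H01
  refine (memLp_congr_ae ?_).1 h1
  filter_upwards [h2] with t ht
  rw [ht, lift_val hΩ]

lemma memLp_self (h : IsRegularOn a b u) : MemLp u 2 (volume.restrict (Ioc a b)) := by
  obtain ⟨U, h1, h2⟩ := h.exists_H01
  refine (memLp_congr_ae ?_).1 ((valL Ω).comp_memLp' h1)
  filter_upwards [h2] with t ht
  rw [ht]; rfl

lemma lift_add_smul (hΩ : IsOpen Ω) (hu : IsRegularOn a b u) (hw : IsRegularOn a b w) (c : ℝ) :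
    ∀ᵐ t ∂(volume.restrict (Ioc a b)),
      lift ((u + c • w) t) = lift (u t) + c • lift (w t) := by
  filter_upwards [hu.eq_val_lift hΩ, hw.eq_val_lift hΩ] with t h1 h2
  rw [Pi.add_apply, Pi.smul_apply]
  conv_lhs => rw [h1, h2, ← val_smul, ← val_add, lift_val hΩ]

lemma isWeakDt_dt (h : IsRegularOn a b u) : IsWeakDt a b u (dt a b u) := by
  rw [dt, dif_pos h.exists_dt]
  exact h.exists_dt.choose_spec

lemma integrable_inner_val (h : IsRegularOn a b u) (w : H01 Ω) :
    IntegrableOn (fun t => inner ℝ (u t) (val w)) (Ioc a b) :=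
  (h.memLp_self.inner_const (val w)).integrable (by norm_num)

end IsRegularOn

lemma IsTest.integrableOn_mul {a b : ℝ} {η : ℝ → ℝ} {I : Set ℝ} (hη : IsTest (Ioo a b) η)
    {f : ℝ → ℝ} (hf : IntegrableOn f I) : IntegrableOn (fun t => η t * f t) I := by
  obtain ⟨M, hM⟩ := hη.1.continuous.bounded_above_of_compact_support hη.2.1
  exact hf.bdd_mul hη.1.continuous.aestronglyMeasurable (Filter.Eventually.of_forall hM)

lemma IsTest.deriv {a b : ℝ} {η : ℝ → ℝ} (hη : IsTest (Ioo a b) η) :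
    IsTest (Ioo a b) (deriv η) := by
  refine ⟨?_, hη.2.1.deriv,
    (closure_minimal support_deriv_subset (isClosed_tsupport η)).trans hη.2.2⟩
  exact (contDiff_infty_iff_deriv.1 hη.1).2

lemma IsWeakDt.integrable_apply {a b : ℝ} {u : ℝ → L2 Ω} {f : ℝ → Hm1 Ω}
    (h : IsWeakDt a b u f) (w : H01 Ω) : IntegrableOn (fun t => f t w) (Ioc a b) :=
  MemLp.integrable (q := 2) (by norm_num)
    ((ContinuousLinearMap.apply ℝ ℝ w).comp_memLp' h.1)

lemma IsWeakDt.add_smul {a b : ℝ} {u w : ℝ → L2 Ω} (hu : IsRegularOn a b u)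
    (hw : IsRegularOn a b w) {f k : ℝ → Hm1 Ω} (hf : IsWeakDt a b u f) (hk : IsWeakDt a b w k)
    (c : ℝ) : IsWeakDt a b (u + c • w) (fun t => f t + c • k t) := by
  refine ⟨hf.1.add (hk.1.const_smul c), fun η hη φ => ?_⟩
  have e1 : ∀ t, deriv η t * inner ℝ ((u + c • w) t) (val φ) =
      deriv η t * inner ℝ (u t) (val φ) + c * (deriv η t * inner ℝ (w t) (val φ)) := fun t => by
    rw [Pi.add_apply, Pi.smul_apply, inner_add_left, inner_smul_left]
    simp only [conj_trivial]; ring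
  have e2 : ∀ t, η t * (f t + c • k t) φ = η t * f t φ + c * (η t * k t φ) := fun t => by
    rw [add_apply, smul_apply, smul_eq_mul]; ring
  simp only [e1, e2]
  rw [integral_add (hη.deriv.integrableOn_mul (hu.integrable_inner_val φ))
      ((hη.deriv.integrableOn_mul (hw.integrable_inner_val φ)).const_mul c), integral_const_mul,
    integral_add (hη.integrableOn_mul (hf.integrable_apply φ))
      ((hη.integrableOn_mul (hk.integrable_apply φ)).const_mul c), integral_const_mul,
    hf.2 η hη φ, hk.2 η hη φ]
  ring

lemma IsTest.mono {V : Type*} [NormedAddCommGroup V] [NormedSpace ℝ V] {U U' : Set V} {ψ : V → ℝ}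
    (h : IsTest U ψ) (hU : U ⊆ U') : IsTest U' ψ := ⟨h.1, h.2.1, h.2.2.trans hU⟩

lemma ae_eq_zero_of_forall_test_apply {F : Type*} [NormedAddCommGroup F] [NormedSpace ℝ F]
    {a b : ℝ} {f : ℝ → StrongDual ℝ F} (hf : MemLp f 2 (volume.restrict (Ioc a b)))
    (h : ∀ η : ℝ → ℝ, IsTest (Ioo a b) η → ∀ φ, ∫ t in Ioc a b, η t * f t φ = 0) :
    f =ᵐ[volume.restrict (Ioc a b)] 0 := by
  rw [← restrict_Ioo_eq_restrict_Ioc] at hf ⊢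
  refine ae_eq_zero_of_forall_test isOpen_Ioo
    (MemLp.locallyIntegrableOn_of_two isOpen_Ioo hf) fun η hη => ?_
  have hi : Integrable (fun t => η t • f t) (volume.restrict (Ioo a b)) := by
    obtain ⟨M, hM⟩ := hη.1.continuous.bounded_above_of_compact_support hη.2.1
    exact (hf.integrable (by norm_num)).bdd_smul M hη.1.continuous.aestronglyMeasurable
      (Filter.Eventually.of_forall hM)
  ext φ
  rw [ContinuousLinearMap.integral_apply hi, ← integral_Ioc_eq_integral_Ioo]
  exact h η hη φ

/-- The weak time derivative is unique almost everywhere. -/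
lemma IsWeakDt.unique {a b : ℝ} {u w : ℝ → L2 Ω} {f k : ℝ → Hm1 Ω} (hf : IsWeakDt a b u f)
    (hk : IsWeakDt a b w k) (huw : u =ᵐ[volume.restrict (Ioc a b)] w) :
    f =ᵐ[volume.restrict (Ioc a b)] k := by
  have h0 : (fun t => f t - k t) =ᵐ[volume.restrict (Ioc a b)] 0 := by
    refine ae_eq_zero_of_forall_test_apply (hf.1.sub hk.1) fun η hη φ => ?_
    have e : ∀ t, η t * (f t - k t) φ = η t * f t φ - η t * k t φ := fun t => by
      rw [sub_apply, mul_sub]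
    simp only [e]
    rw [integral_sub (hη.integrableOn_mul (hf.integrable_apply φ))
      (hη.integrableOn_mul (hk.integrable_apply φ))]
    have h1 := hf.2 η hη φ
    have h2 := hk.2 η hη φ
    have h3 : ∫ t in Ioc a b, deriv η t * inner ℝ (u t) (val φ) =
        ∫ t in Ioc a b, deriv η t * inner ℝ (w t) (val φ) := by
      refine integral_congr_ae ?_
      filter_upwards [huw] with t ht
      rw [ht]
    linarith
  filter_upwards [h0] with t ht
  exact sub_eq_zero.1 ht

/-- The weak time derivative restricts to subintervals. -/
lemma IsWeakDt.mono {a b a' b' : ℝ} {u : ℝ → L2 Ω} {f : ℝ → Hm1 Ω} (hf : IsWeakDt a b u f)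
    (ha : a ≤ a') (hb : b' ≤ b) : IsWeakDt a' b' u f := by
  refine ⟨hf.1.mono_measure (Measure.restrict_mono (Ioc_subset_Ioc ha hb) le_rfl),
    fun η hη φ => ?_⟩
  have hη' : IsTest (Ioo a b) η := hη.mono (Ioo_subset_Ioo ha hb)
  have hI : ∀ (θ : ℝ → ℝ), IsTest (Ioo a' b') θ → ∀ F : ℝ → ℝ,
      ∫ t in Ioc a' b', θ t * F t = ∫ t in Ioc a b, θ t * F t := by
    intro θ hθ F
    rw [setIntegral_eq_of_tsupport_subset (hθ.mono Ioo_subset_Ioc_self |>.mono le_rfl),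
      setIntegral_eq_of_tsupport_subset
        (hθ.mono ((Ioo_subset_Ioo ha hb).trans Ioo_subset_Ioc_self))]
  rw [hI _ hη.deriv, hI _ hη, hf.2 η hη' φ]

namespace IsRegularOn

variable {a b : ℝ} {u w : ℝ → L2 Ω}

lemma dt_ae_eq {f : ℝ → Hm1 Ω} (hf : IsWeakDt a b u f) :
    dt a b u =ᵐ[volume.restrict (Ioc a b)] f := by
  have h : ∃ f, IsWeakDt a b u f := ⟨f, hf⟩
  have h1 : IsWeakDt a b u (dt a b u) := by
    rw [dt, dif_pos h]
    exact h.choose_spec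
  exact h1.unique hf (Filter.EventuallyEq.refl _ _)

lemma dt_add_smul (hu : IsRegularOn a b u) (hw : IsRegularOn a b w) (c : ℝ) :
    dt a b (u + c • w) =ᵐ[volume.restrict (Ioc a b)] fun t => dt a b u t + c • dt a b w t :=
  dt_ae_eq (IsWeakDt.add_smul hu hw hu.isWeakDt_dt hw.isWeakDt_dt c)

lemma add_smul (hu : IsRegularOn a b u) (hw : IsRegularOn a b w) (c : ℝ) :
    IsRegularOn a b (u + c • w) := by
  obtain ⟨U, hU, hU'⟩ := hu.exists_H01
  obtain ⟨W, hW, hW'⟩ := hw.exists_H01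
  obtain ⟨f, hf⟩ := hu.exists_dt
  obtain ⟨k, hk⟩ := hw.exists_dt
  obtain ⟨y, hy⟩ := hu.exists_limPlus
  obtain ⟨y', hy'⟩ := hw.exists_limPlus
  obtain ⟨z, hz⟩ := hu.exists_limMinus
  obtain ⟨z', hz'⟩ := hw.exists_limMinus
  refine ⟨⟨U + c • W, hU.add (hW.const_smul c), ?_⟩, ⟨_, hf.add_smul hu hw hk c⟩,
    ⟨_, hy.add (hy'.const_smul c)⟩, ⟨_, hz.add (hz'.const_smul c)⟩⟩
  filter_upwards [hU', hW'] with t h1 h2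
  simp [h1, h2]

lemma limPlus_add_smul (hu : IsRegularOn a b u) (hw : IsRegularOn a b w) (c : ℝ) :
    limPlus (u + c • w) a = limPlus u a + c • limPlus w a :=
  limPlus_eq ((tendsto_limPlus_of_exists hu.exists_limPlus).add
    ((tendsto_limPlus_of_exists hw.exists_limPlus).const_smul c))

lemma limMinus_add_smul (hu : IsRegularOn a b u) (hw : IsRegularOn a b w) (c : ℝ) :
    limMinus (u + c • w) b = limMinus u b + c • limMinus w b :=
  limMinus_eq ((tendsto_limMinus_of_exists hu.exists_limMinus).add
    ((tendsto_limMinus_of_exists hw.exists_limMinus).const_smul c))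

lemma zero : IsRegularOn a b (0 : ℝ → L2 Ω) := by
  refine ⟨⟨0, MemLp.zero, by simp⟩, ⟨0, MemLp.zero, fun η hη w => by simp⟩,
    ⟨0, tendsto_const_nhds⟩, ⟨0, tendsto_const_nhds⟩⟩

end IsRegularOn

/-- The integrand of the duality pairing of `L²(I;H⁻¹(Ω))` and `L²(I;H¹₀(Ω))` is integrable. -/
lemma integrable_dual_apply {I : Set ℝ} {f : ℝ → Hm1 Ω} {Φ : ℝ → H01 Ω}
    (hf : MemLp f 2 (volume.restrict I)) (hΦ : MemLp Φ 2 (volume.restrict I)) :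
    IntegrableOn (fun t => f t (Φ t)) I :=
  memLp_one_iff_integrable.1
    ((ContinuousLinearMap.id ℝ (Hm1 Ω)).memLp_of_bilin 1 hf hΦ)

lemma integrable_bilin_apply {I : Set ℝ} (a : H01 Ω →L[ℝ] H01 Ω →L[ℝ] ℝ) {U Φ : ℝ → H01 Ω}
    (hU : MemLp U 2 (volume.restrict I)) (hΦ : MemLp Φ 2 (volume.restrict I)) :
    IntegrableOn (fun t => a (U t) (Φ t)) I :=
  memLp_one_iff_integrable.1 (a.memLp_of_bilin 1 hU hΦ)

/-! ### Polynomials in time -/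

/-- The functional `φ ↦ (w, φ)`, that is, `w` as an element of `H⁻¹(Ω)`. -/
def innerVal (w : H01 Ω) : Hm1 Ω := (innerSL ℝ (val w)) ∘L valL Ω

lemma innerVal_apply (w φ : H01 Ω) : innerVal w φ = inner ℝ (val w) (val φ) := rfl

lemma memLp_smul_const {F : Type*} [NormedAddCommGroup F] [NormedSpace ℝ F] {a b : ℝ} {p : ℝ → ℝ}
    (hp : Continuous p) (w : F) : MemLp (fun t => p t • w) 2 (volume.restrict (Ioc a b)) := by
  have hc : Continuous (fun t => p t • w) := hp.smul continuous_const
  obtain ⟨M, hM⟩ := isCompact_Icc.exists_bound_of_continuousOn (s := Icc a b) hc.continuousOn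
  refine MemLp.of_bound hc.aestronglyMeasurable M ?_
  exact (ae_restrict_iff' measurableSet_Ioc).2
    (Filter.Eventually.of_forall fun t ht => hM t (Ioc_subset_Icc_self ht))

lemma isWeakDt_smul_val {a b : ℝ} {p : ℝ → ℝ} (hp : ContDiff ℝ 1 p) (w : H01 Ω) :
    IsWeakDt a b (fun t => p t • val w) (fun t => deriv p t • innerVal w) := by
  have dp : Continuous (deriv p) := hp.continuous_deriv le_rfl
  refine ⟨?_, fun η hη φ => ?_⟩
  · exact memLp_smul_const dp (innerVal w)
  · have h1 : ∀ t, deriv η t * inner ℝ (p t • val w) (val φ) =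
        inner ℝ (val w) (val φ) * (p t * deriv η t) := fun t => by
      rw [inner_smul_left]; simp only [conj_trivial]; ring
    have h2 : ∀ t, η t * (deriv p t • innerVal w) φ =
        inner ℝ (val w) (val φ) * (deriv p t * η t) := fun t => by
      rw [smul_apply, innerVal_apply, smul_eq_mul]; ring
    simp only [h1, h2]
    rw [integral_const_mul, integral_const_mul, ← mul_neg]
    congr 1
    have dη : Continuous (deriv η) := hη.deriv.1.continuous
    have e1 : ∀ t, p t * deriv η t = deriv η t * p t := fun t => mul_comm _ _
    have e2 : ∀ t, deriv p t * η t = η t * deriv p t := fun t => mul_comm _ _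
    simp only [e1, e2]
    rw [setIntegral_eq_of_tsupport_subset (hη.deriv.mono Ioo_subset_Ioc_self),
      setIntegral_eq_of_tsupport_subset (hη.mono Ioo_subset_Ioc_self)]
    simp only [← e1, ← e2]
    refine integral_mul_deriv_eq_deriv_mul_of_integrable
      (fun t _ => (hp.differentiable (by simp) t).hasDerivAt)
      (fun t _ => (hη.1.differentiable (by simp) t).hasDerivAt) ?_ ?_ ?_
    · exact (hp.continuous.mul dη).integrable_of_hasCompactSupport hη.2.1.deriv.mul_left
    · exact (dp.mul hη.1.continuous).integrable_of_hasCompactSupport hη.2.1.mul_left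
    · exact (hp.continuous.mul hη.1.continuous).integrable_of_hasCompactSupport hη.2.1.mul_left

lemma isRegularOn_smul_val {a b : ℝ} {p : ℝ → ℝ} (hp : ContDiff ℝ 1 p) (w : H01 Ω) :
    IsRegularOn a b (fun t => p t • val w) := by
  have hc : Continuous (fun t => p t • val w) := hp.continuous.smul continuous_const
  exact ⟨⟨fun t => p t • w, memLp_smul_const hp.continuous w, by simp⟩,
    ⟨_, isWeakDt_smul_val hp w⟩,
    ⟨_, (hc.tendsto a).mono_left nhdsWithin_le_nhds⟩,
    ⟨_, (hc.tendsto b).mono_left nhdsWithin_le_nhds⟩⟩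

lemma IsWeakDt.congr {a b : ℝ} {u w : ℝ → L2 Ω} {f : ℝ → Hm1 Ω} (hf : IsWeakDt a b u f)
    (h : u =ᵐ[volume.restrict (Ioc a b)] w) : IsWeakDt a b w f := by
  refine ⟨hf.1, fun η hη φ => ?_⟩
  rw [← hf.2 η hη φ]
  refine integral_congr_ae ?_
  filter_upwards [h] with t ht
  rw [ht]

/-- Regularity on `(a,b]` depends on the values there only. -/
lemma IsRegularOn.congr {a b : ℝ} (hab : a < b) {u w : ℝ → L2 Ω} (hu : IsRegularOn a b u)
    (h : ∀ t ∈ Ioc a b, u t = w t) : IsRegularOn a b w := by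
  have hae : u =ᵐ[volume.restrict (Ioc a b)] w :=
    (ae_restrict_iff' measurableSet_Ioc).2 (Filter.Eventually.of_forall h)
  obtain ⟨U, hU, hU'⟩ := hu.exists_H01
  obtain ⟨f, hf⟩ := hu.exists_dt
  obtain ⟨y, hy⟩ := hu.exists_limPlus
  obtain ⟨z, hz⟩ := hu.exists_limMinus
  refine ⟨⟨U, hU, ?_⟩, ⟨f, hf.congr hae⟩, ⟨y, hy.congr' ?_⟩, ⟨z, hz.congr' ?_⟩⟩
  · filter_upwards [hU', hae] with t h1 h2
    rw [← h2, h1]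
  · filter_upwards [Ioc_mem_nhdsGT hab] with t ht using h t ht
  · filter_upwards [Ioo_mem_nhdsLT hab] with t ht using h t (Ioo_subset_Ioc_self ht)

lemma isWeakDt_sum_pow {a b : ℝ} {r : ℕ} (c : Fin (r + 1) → H01 Ω) :
    IsWeakDt a b (fun s => ∑ j : Fin (r + 1), s ^ (j : ℕ) • val (c j))
      (fun s => ∑ j : Fin (r + 1), deriv (fun t : ℝ => t ^ (j : ℕ)) s • innerVal (c j)) ∧
    IsRegularOn a b (fun s => ∑ j : Fin (r + 1), s ^ (j : ℕ) • val (c j)) := by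
  suffices h : ∀ F : Finset (Fin (r + 1)),
      IsWeakDt a b (fun s => ∑ j ∈ F, s ^ (j : ℕ) • val (c j))
        (fun s => ∑ j ∈ F, deriv (fun t : ℝ => t ^ (j : ℕ)) s • innerVal (c j)) ∧
      IsRegularOn a b (fun s => ∑ j ∈ F, s ^ (j : ℕ) • val (c j)) from h Finset.univ
  intro F
  induction F using Finset.induction_on with
  | empty =>
    simp only [Finset.sum_empty]
    exact ⟨⟨MemLp.zero', fun η hη w => by simp⟩, IsRegularOn.zero⟩
  | insert j F hj ih =>
    have hp : ContDiff ℝ 1 (fun t : ℝ => t ^ (j : ℕ)) := contDiff_id.pow _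
    have e1 : (fun s : ℝ => ∑ j ∈ insert j F, s ^ (j : ℕ) • val (c j)) =
        (fun s : ℝ => ∑ j ∈ F, s ^ (j : ℕ) • val (c j)) +
          (1 : ℝ) • (fun s : ℝ => s ^ (j : ℕ) • val (c j)) := by
      funext s
      rw [Finset.sum_insert hj, Pi.add_apply, Pi.smul_apply, one_smul, add_comm]
    have e2 : (fun s : ℝ => ∑ j ∈ insert j F,
          deriv (fun t : ℝ => t ^ (j : ℕ)) s • innerVal (c j)) =
        fun s : ℝ => (∑ j ∈ F, deriv (fun t : ℝ => t ^ (j : ℕ)) s • innerVal (c j)) +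
          (1 : ℝ) • (deriv (fun t : ℝ => t ^ (j : ℕ)) s • innerVal (c j)) := by
      funext s
      rw [Finset.sum_insert hj, one_smul, add_comm]
    rw [e1, e2]
    exact ⟨ih.1.add_smul ih.2 (isRegularOn_smul_val hp (c j)) (isWeakDt_smul_val hp (c j)) 1,
      ih.2.add_smul (isRegularOn_smul_val hp (c j)) 1⟩

end

noncomputable section

/-! ### Piecewise regular functions on a time grid -/

variable {d : ℕ} {Ω : Set (E d)}

namespace TimeGrid

variable {T : ℝ} (τ : TimeGrid T)

lemma t_le {m n : ℕ} (hmn : m ≤ n) (hn : n ≤ τ.N) : τ.t m ≤ τ.t n := by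
  induction n, hmn using Nat.le_induction with
  | base => exact le_rfl
  | succ n _ ih => exact (ih (by omega)).trans (τ.t_lt n (by omega)).le

lemma zero_le {n : ℕ} (hn : n ≤ τ.N) : 0 ≤ τ.t n := by
  have := τ.t_le (Nat.zero_le n) hn
  rwa [τ.t_zero] at this

lemma le_last {n : ℕ} (hn : n ≤ τ.N) : τ.t n ≤ T := by
  have := τ.t_le hn le_rfl
  rwa [τ.t_last] at this

lemma N_pos (hT : 0 < T) : 0 < τ.N := by
  rcases Nat.eq_zero_or_pos τ.N with h | h
  · have h1 := τ.t_last
    rw [h, τ.t_zero] at h1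
    exact absurd h1 hT.ne
  · exact h

lemma slab_subset {n : ℕ} (hn : n < τ.N) : Ioc (τ.t n) (τ.t (n + 1)) ⊆ Ioc 0 T :=
  Ioc_subset_Ioc (τ.zero_le hn.le) (τ.le_last hn)

lemma slab_measure_le {n : ℕ} (hn : n < τ.N) :
    volume.restrict (Ioc (τ.t n) (τ.t (n + 1))) ≤ volume.restrict (Ioc 0 T) :=
  Measure.restrict_mono (τ.slab_subset hn) le_rfl

lemma ae_of_slabs {p : ℝ → Prop}
    (h : ∀ n < τ.N, ∀ᵐ t ∂(volume.restrict (Ioc (τ.t n) (τ.t (n + 1)))), p t) :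
    ∀ᵐ t ∂(volume.restrict (Ioc 0 T)), p t := by
  suffices H : ∀ m ≤ τ.N, ∀ᵐ t ∂(volume.restrict (Ioc (τ.t 0) (τ.t m))), p t by
    have := H τ.N le_rfl
    rwa [τ.t_zero, τ.t_last] at this
  intro m
  induction m with
  | zero => intro _; simp
  | succ m ih =>
    intro hm
    rw [← Ioc_union_Ioc_eq_Ioc (τ.t_le (Nat.zero_le m) (by omega)) (τ.t_lt m (by omega)).le,
      ae_restrict_union_iff]
    exact ⟨ih (by omega), h m (by omega)⟩

lemma integrableOn_of_slabs {F : ℝ → ℝ}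
    (h : ∀ n < τ.N, IntegrableOn F (Ioc (τ.t n) (τ.t (n + 1)))) : IntegrableOn F (Ioc 0 T) := by
  have h' : ∀ n < τ.N, IntervalIntegrable F volume (τ.t n) (τ.t (n + 1)) := fun n hn =>
    (intervalIntegrable_iff_integrableOn_Ioc_of_le (τ.t_lt n hn).le).2 (h n hn)
  have := IntervalIntegrable.trans_iterate h'
  rwa [τ.t_zero, τ.t_last, intervalIntegrable_iff_integrableOn_Ioc_of_le] at this
  simpa using τ.le_last (Nat.zero_le _) |>.trans' (τ.zero_le (Nat.zero_le _))

lemma integral_eq_sum {F : ℝ → ℝ}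
    (h : ∀ n < τ.N, IntegrableOn F (Ioc (τ.t n) (τ.t (n + 1)))) :
    ∫ t in Ioc 0 T, F t = ∑ n ∈ Finset.range τ.N, ∫ t in Ioc (τ.t n) (τ.t (n + 1)), F t := by
  have h' : ∀ n < τ.N, IntervalIntegrable F volume (τ.t n) (τ.t (n + 1)) := fun n hn =>
    (intervalIntegrable_iff_integrableOn_Ioc_of_le (τ.t_lt n hn).le).2 (h n hn)
  have := intervalIntegral.sum_integral_adjacent_intervals h'
  rw [τ.t_zero, τ.t_last, intervalIntegral.integral_of_le
    ((τ.zero_le (Nat.zero_le _)).trans (τ.le_last (Nat.zero_le _)))] at this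
  rw [← this]
  refine Finset.sum_congr rfl fun n hn => ?_
  rw [intervalIntegral.integral_of_le (τ.t_lt n (Finset.mem_range.1 hn)).le]

end TimeGrid

/-- The functions that are regular on each interval of the grid. It contains `X` and `X_τ`, and the
dG form is bilinear on it. -/
def Broken (Ω : Set (E d)) {T : ℝ} (τ : TimeGrid T) : Submodule ℝ (ℝ → L2 Ω) where
  carrier := {u | ∀ n < τ.N, IsRegularOn (τ.t n) (τ.t (n + 1)) u}
  add_mem' := fun {u w} hu hw n hn => by
    have := (hu n hn).add_smul (hw n hn) 1
    rwa [one_smul] at this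
  zero_mem' := fun n _ => IsRegularOn.zero
  smul_mem' := fun c u hu n hn => by
    have := IsRegularOn.zero.add_smul (hu n hn) c
    rwa [zero_add] at this

/-- `X` as a linear space. -/
def XSub (Ω : Set (E d)) (T : ℝ) : Submodule ℝ (ℝ → L2 Ω) where
  carrier := X Ω T
  add_mem' := by
    rintro u w ⟨h1, ⟨U, h2, h2'⟩, f, h3⟩ ⟨k1, ⟨W, k2, k2'⟩, k, k3⟩
    refine ⟨h1.add k1, ⟨U + W, h2.add k2, ?_⟩, fun t => f t + k t, h3.1.add k3.1,
      fun η hη φ => ?_⟩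
    · filter_upwards [h2', k2'] with t ht ht'
      rw [Pi.add_apply, ht, ht']; rfl
    · have hi : ∀ {u : ℝ → L2 Ω}, ContinuousOn u (Icc 0 T) →
          IntegrableOn (fun t => deriv η t * inner ℝ (u t) (val φ)) (Ioc 0 T) := fun hu =>
        hη.deriv.integrableOn_mul (((hu.inner continuousOn_const).integrableOn_compact
          isCompact_Icc).mono_set Ioc_subset_Icc_self)
      simp only [Pi.add_apply, inner_add_left, add_apply, mul_add]
      rw [integral_add (hi h1) (hi k1), integral_add (hη.integrableOn_mul (h3.integrable_apply φ))
        (hη.integrableOn_mul (k3.integrable_apply φ)), h3.2 η hη, k3.2 η hη]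
      ring
  zero_mem' := ⟨continuousOn_const, ⟨0, MemLp.zero, by simp⟩, 0, MemLp.zero, by simp⟩
  smul_mem' := by
    rintro c u ⟨h1, ⟨U, h2, h2'⟩, f, h3⟩
    refine ⟨h1.const_smul c, ⟨c • U, h2.const_smul c, ?_⟩, fun t => c • f t, h3.1.const_smul c,
      fun η hη φ => ?_⟩
    · filter_upwards [h2'] with t ht
      rw [Pi.smul_apply, ht]; rfl
    · have e1 : ∀ t, deriv η t * inner ℝ ((c • u) t) (val φ) =
          c * (deriv η t * inner ℝ (u t) (val φ)) := fun t => by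
        rw [Pi.smul_apply, real_inner_smul_left]; ring
      have e2 : ∀ t, η t * (c • f t) φ = c * (η t * f t φ) := fun t => by
        rw [smul_apply, smul_eq_mul]; ring
      simp only [e1, e2]
      rw [integral_const_mul, integral_const_mul, h3.2 η hη, mul_neg]

/-- `X_τ` as a linear space. -/
def XtauSub (Ω : Set (E d)) {T : ℝ} (τ : TimeGrid T) (r : ℕ) : Submodule ℝ (ℝ → L2 Ω) where
  carrier := Xtau Ω τ r
  add_mem' := by
    intro u w hu hw n hn
    obtain ⟨c, hc⟩ := hu n hn
    obtain ⟨k, hk⟩ := hw n hn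
    refine ⟨c + k, fun s hs => ?_⟩
    rw [Pi.add_apply, hc s hs, hk s hs, ← Finset.sum_add_distrib]
    simp
  zero_mem' := fun n hn => ⟨0, fun s hs => by simp⟩
  smul_mem' := by
    intro a u hu n hn
    obtain ⟨c, hc⟩ := hu n hn
    refine ⟨a • c, fun s hs => ?_⟩
    rw [Pi.smul_apply, hc s hs, Finset.smul_sum]
    refine Finset.sum_congr rfl fun j _ => ?_
    rw [Pi.smul_apply, val_smul, smul_comm]

lemma add_coe_eq_sup (Ω : Set (E d)) {T : ℝ} (τ : TimeGrid T) (r : ℕ) :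
    X Ω T + Xtau Ω τ r =
      ((XSub Ω T ⊔ XtauSub Ω τ r : Submodule ℝ (ℝ → L2 Ω)) : Set (ℝ → L2 Ω)) := by
  rw [Submodule.coe_sup]
  rfl

lemma tendsto_nhdsGT_of_mem_X {T : ℝ} {u : ℝ → L2 Ω} (hu : u ∈ X Ω T) {a : ℝ} (ha : 0 ≤ a)
    (haT : a < T) : Filter.Tendsto u (nhdsWithin a (Ioi a)) (nhds (u a)) :=
  (hu.1 a ⟨ha, haT.le⟩).mono_left ((nhdsWithin_Ioc_eq_nhdsGT haT).symm.trans_le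
    (nhdsWithin_mono a ((Ioc_subset_Ioc_left ha).trans Ioc_subset_Icc_self)))

lemma tendsto_nhdsLT_of_mem_X {T : ℝ} {u : ℝ → L2 Ω} (hu : u ∈ X Ω T) {b : ℝ} (hb : 0 < b)
    (hbT : b ≤ T) : Filter.Tendsto u (nhdsWithin b (Iio b)) (nhds (u b)) :=
  (hu.1 b ⟨hb.le, hbT⟩).mono_left ((nhdsWithin_Ico_eq_nhdsLT hb).symm.trans_le
    (nhdsWithin_mono b ((Ico_subset_Ico_right hbT).trans Ico_subset_Icc_self)))

lemma isRegularOn_of_mem_X {T : ℝ} {u : ℝ → L2 Ω} (hu : u ∈ X Ω T) {a b : ℝ} (ha : 0 ≤ a)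
    (hab : a < b) (hb : b ≤ T) : IsRegularOn a b u := by
  obtain ⟨-, ⟨U, h2, h2'⟩, f, h3⟩ := id hu
  have hm : volume.restrict (Ioc a b) ≤ volume.restrict (Ioc 0 T) :=
    Measure.restrict_mono (Ioc_subset_Ioc ha hb) le_rfl
  exact ⟨⟨U, h2.mono_measure hm, ae_mono hm h2'⟩, ⟨f, h3.mono ha hb⟩,
    ⟨_, tendsto_nhdsGT_of_mem_X hu ha (hab.trans_le hb)⟩,
    ⟨_, tendsto_nhdsLT_of_mem_X hu (ha.trans_lt hab) hb⟩⟩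

lemma XSub_le_Broken {T : ℝ} (τ : TimeGrid T) : XSub Ω T ≤ Broken Ω τ := fun _ hu n hn =>
  isRegularOn_of_mem_X hu (τ.zero_le hn.le) (τ.t_lt n hn) (τ.le_last hn)

lemma XtauSub_le_Broken {T : ℝ} (τ : TimeGrid T) (r : ℕ) : XtauSub Ω τ r ≤ Broken Ω τ := by
  intro u hu n hn
  obtain ⟨c, hc⟩ := hu n hn
  exact (isWeakDt_sum_pow c).2.congr (τ.t_lt n hn) fun t ht => (hc t ht).symm

/-! ### Bilinearity of the dG form -/

namespace Problem

variable (P : Problem d) (τ : TimeGrid P.T)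

/-- The integrand of the dG form is integrable, so that no integral in the form takes the default
value zero. -/
lemma integrableOn_slab (hd : d = 2 ∨ d = 3) (v : Fin d → H01 P.Ω) {a b : ℝ} {u φ : ℝ → L2 P.Ω}
    (hu : IsRegularOn a b u) (hφ : IsRegularOn a b φ) :
    IntegrableOn (fun t => P.ρ * dt a b u t (lift (φ t)) + P.a (lift (u t)) v (lift (φ t)))
      (Ioc a b) := by
  simp only [← P.aForm_apply hd]
  exact ((integrable_dual_apply hu.isWeakDt_dt.1 (hφ.memLp_lift P.isOpen)).const_mul P.ρ).add
    (integrable_bilin_apply _ (hu.memLp_lift P.isOpen) (hφ.memLp_lift P.isOpen))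

lemma integral_slab_add_smul_left (hd : d = 2 ∨ d = 3) (v : Fin d → H01 P.Ω) {a b : ℝ}
    {u w φ : ℝ → L2 P.Ω} (hu : IsRegularOn a b u) (hw : IsRegularOn a b w)
    (hφ : IsRegularOn a b φ) (c : ℝ) :
    ∫ t in Ioc a b, (P.ρ * dt a b (u + c • w) t (lift (φ t)) +
        P.a (lift ((u + c • w) t)) v (lift (φ t))) =
      (∫ t in Ioc a b, (P.ρ * dt a b u t (lift (φ t)) + P.a (lift (u t)) v (lift (φ t)))) +
      c * ∫ t in Ioc a b, (P.ρ * dt a b w t (lift (φ t)) + P.a (lift (w t)) v (lift (φ t))) := by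
  rw [← integral_const_mul, ← integral_add (P.integrableOn_slab hd v hu hφ)
    ((P.integrableOn_slab hd v hw hφ).const_mul c)]
  refine integral_congr_ae ?_
  filter_upwards [hu.dt_add_smul hw c, hu.lift_add_smul P.isOpen hw c] with t h1 h2
  simp only [h1, h2, ← P.aForm_apply hd, map_add, map_smul, add_apply, smul_apply, smul_eq_mul]
  ring

lemma integral_slab_add_smul_right (hd : d = 2 ∨ d = 3) (v : Fin d → H01 P.Ω) {a b : ℝ}
    {u φ ψ : ℝ → L2 P.Ω} (hu : IsRegularOn a b u) (hφ : IsRegularOn a b φ)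
    (hψ : IsRegularOn a b ψ) (c : ℝ) :
    ∫ t in Ioc a b, (P.ρ * dt a b u t (lift ((φ + c • ψ) t)) +
        P.a (lift (u t)) v (lift ((φ + c • ψ) t))) =
      (∫ t in Ioc a b, (P.ρ * dt a b u t (lift (φ t)) + P.a (lift (u t)) v (lift (φ t)))) +
      c * ∫ t in Ioc a b, (P.ρ * dt a b u t (lift (ψ t)) + P.a (lift (u t)) v (lift (ψ t))) := by
  rw [← integral_const_mul, ← integral_add (P.integrableOn_slab hd v hu hφ)
    ((P.integrableOn_slab hd v hu hψ).const_mul c)]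
  refine integral_congr_ae ?_
  filter_upwards [hφ.lift_add_smul P.isOpen hψ c] with t h2
  simp only [h2, ← P.aForm_apply hd, map_add, map_smul, smul_eq_mul]
  ring

variable {P τ}

lemma limPlus_add_smul {u w : ℝ → L2 P.Ω} (hu : u ∈ Broken P.Ω τ) (hw : w ∈ Broken P.Ω τ) (c : ℝ)
    {n : ℕ} (hn : n < τ.N) :
    limPlus (u + c • w) (τ.t n) = limPlus u (τ.t n) + c • limPlus w (τ.t n) :=
  (hu n hn).limPlus_add_smul (hw n hn) c

lemma limMinus_add_smul {u w : ℝ → L2 P.Ω} (hu : u ∈ Broken P.Ω τ) (hw : w ∈ Broken P.Ω τ) (c : ℝ)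
    {n : ℕ} (hn : n ∈ Finset.Ico 1 τ.N) :
    limMinus (u + c • w) (τ.t n) = limMinus u (τ.t n) + c • limMinus w (τ.t n) := by
  obtain ⟨h1, h2⟩ := Finset.mem_Ico.1 hn
  obtain ⟨m, rfl⟩ : ∃ m, n = m + 1 := ⟨n - 1, by omega⟩
  exact (hu m (by omega)).limMinus_add_smul (hw m (by omega)) c

lemma jump_add_smul {u w : ℝ → L2 P.Ω} (hu : u ∈ Broken P.Ω τ) (hw : w ∈ Broken P.Ω τ) (c : ℝ)
    {n : ℕ} (hn : n ∈ Finset.Ico 1 τ.N) :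
    jump (u + c • w) (τ.t n) = jump u (τ.t n) + c • jump w (τ.t n) := by
  rw [jump, jump, jump, limPlus_add_smul hu hw c (Finset.mem_Ico.1 hn).2,
    limMinus_add_smul hu hw c hn, smul_sub]
  abel

lemma Atau_add_smul_left (hd : d = 2 ∨ d = 3) (v : Fin d → H01 P.Ω) {u w φ : ℝ → L2 P.Ω}
    (hu : u ∈ Broken P.Ω τ) (hw : w ∈ Broken P.Ω τ) (hφ : φ ∈ Broken P.Ω τ) (c : ℝ) :
    P.Atau τ (u + c • w) v φ = P.Atau τ u v φ + c * P.Atau τ w v φ := by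
  have h1 := Finset.sum_congr rfl fun n hn => P.integral_slab_add_smul_left hd v
    (hu n (Finset.mem_range.1 hn)) (hw n (Finset.mem_range.1 hn)) (hφ n (Finset.mem_range.1 hn)) c
  have h2 : ∑ n ∈ Finset.Ico 1 τ.N, inner ℝ (P.ρ • jump (u + c • w) (τ.t n)) (limPlus φ (τ.t n)) =
      ∑ n ∈ Finset.Ico 1 τ.N, (inner ℝ (P.ρ • jump u (τ.t n)) (limPlus φ (τ.t n)) +
        c * inner ℝ (P.ρ • jump w (τ.t n)) (limPlus φ (τ.t n))) :=
    Finset.sum_congr rfl fun n hn => by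
      rw [jump_add_smul hu hw c hn, smul_add, smul_comm, inner_add_left, real_inner_smul_left _ _ c]
  rw [Atau, Atau, Atau, h1, h2, limPlus_add_smul hu hw c (τ.N_pos P.T_pos), smul_add,
    smul_comm P.ρ c, inner_add_left, real_inner_smul_left _ _ c, Finset.sum_add_distrib,
    Finset.sum_add_distrib, ← Finset.mul_sum, ← Finset.mul_sum]
  ring

lemma Atau_add_smul_right (hd : d = 2 ∨ d = 3) (v : Fin d → H01 P.Ω) {u φ ψ : ℝ → L2 P.Ω}
    (hu : u ∈ Broken P.Ω τ) (hφ : φ ∈ Broken P.Ω τ) (hψ : ψ ∈ Broken P.Ω τ) (c : ℝ) :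
    P.Atau τ u v (φ + c • ψ) = P.Atau τ u v φ + c * P.Atau τ u v ψ := by
  have h1 := Finset.sum_congr rfl fun n hn => P.integral_slab_add_smul_right hd v
    (hu n (Finset.mem_range.1 hn)) (hφ n (Finset.mem_range.1 hn)) (hψ n (Finset.mem_range.1 hn)) c
  have h2 : ∑ n ∈ Finset.Ico 1 τ.N, inner ℝ (P.ρ • jump u (τ.t n)) (limPlus (φ + c • ψ) (τ.t n)) =
      ∑ n ∈ Finset.Ico 1 τ.N, (inner ℝ (P.ρ • jump u (τ.t n)) (limPlus φ (τ.t n)) +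
        c * inner ℝ (P.ρ • jump u (τ.t n)) (limPlus ψ (τ.t n))) :=
    Finset.sum_congr rfl fun n hn => by
      rw [limPlus_add_smul hφ hψ c (Finset.mem_Ico.1 hn).2, inner_add_right,
        real_inner_smul_right]
  rw [Atau, Atau, Atau, h1, h2, limPlus_add_smul hφ hψ c (τ.N_pos P.T_pos), inner_add_right,
    real_inner_smul_right, Finset.sum_add_distrib,
    Finset.sum_add_distrib, ← Finset.mul_sum, ← Finset.mul_sum]
  ring

lemma integrableOn_g {I : Set ℝ} (hI : I ⊆ Ioc 0 P.T) {Φ : ℝ → H01 P.Ω}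
    (hΦ : MemLp Φ 2 (volume.restrict I)) : IntegrableOn (fun t => P.g t (Φ t)) I :=
  integrable_dual_apply (P.g_mem.mono_measure (Measure.restrict_mono hI le_rfl)) hΦ

lemma integrableOn_g_lift {φ : ℝ → L2 P.Ω} (hφ : φ ∈ Broken P.Ω τ) :
    IntegrableOn (fun t => P.g t (lift (φ t))) (Ioc 0 P.T) :=
  τ.integrableOn_of_slabs fun n hn =>
    integrableOn_g (τ.slab_subset hn) ((hφ n hn).memLp_lift P.isOpen)

lemma lift_add_smul {φ ψ : ℝ → L2 P.Ω} (hφ : φ ∈ Broken P.Ω τ) (hψ : ψ ∈ Broken P.Ω τ) (c : ℝ) :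
    ∀ᵐ t ∂(volume.restrict (Ioc 0 P.T)),
      lift ((φ + c • ψ) t) = lift (φ t) + c • lift (ψ t) :=
  τ.ae_of_slabs fun n hn => (hφ n hn).lift_add_smul P.isOpen (hψ n hn) c

lemma Gtau_add_smul {φ ψ : ℝ → L2 P.Ω} (hφ : φ ∈ Broken P.Ω τ) (hψ : ψ ∈ Broken P.Ω τ) (c : ℝ) :
    P.Gtau τ (φ + c • ψ) = P.Gtau τ φ + c * P.Gtau τ ψ := by
  have h : ∫ t in Ioc 0 P.T, P.g t (lift ((φ + c • ψ) t)) =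
      (∫ t in Ioc 0 P.T, P.g t (lift (φ t))) + c * ∫ t in Ioc 0 P.T, P.g t (lift (ψ t)) := by
    rw [← integral_const_mul, ← integral_add (integrableOn_g_lift hφ)
      ((integrableOn_g_lift hψ).const_mul c)]
    refine integral_congr_ae ?_
    filter_upwards [lift_add_smul hφ hψ c] with t ht
    rw [ht, map_add, map_smul, smul_eq_mul]
  rw [Gtau, Gtau, Gtau, h, limPlus_add_smul hφ hψ c (τ.N_pos P.T_pos), inner_add_right,
    real_inner_smul_right]
  ring

/-- The dG forms for two velocities differ by the coupling term. -/
lemma Atau_sub_Atau (hd : d = 2 ∨ d = 3) (v v' : Fin d → H01 P.Ω) {u φ : ℝ → L2 P.Ω}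
    (hu : u ∈ Broken P.Ω τ) (hφ : φ ∈ Broken P.Ω τ) :
    P.Atau τ u v φ - P.Atau τ u v' φ = coupling P τ v v' u φ := by
  rw [Atau, Atau, coupling, add_sub_add_right_eq_sub, add_sub_add_right_eq_sub,
    ← Finset.sum_sub_distrib]
  refine Finset.sum_congr rfl fun n hn => ?_
  have hu' := hu n (Finset.mem_range.1 hn)
  have hφ' := hφ n (Finset.mem_range.1 hn)
  rw [← integral_sub (P.integrableOn_slab hd v hu' hφ') (P.integrableOn_slab hd v' hu' hφ')]
  refine integral_congr_ae (Filter.Eventually.of_forall fun t => ?_)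
  simp only [add_sub_add_left_eq_sub]
  exact P.a_sub_a hd v v' _ _

/-! ### The continuous problem as a restriction of the dG problem -/

lemma limPlus_of_mem_X {u : ℝ → L2 P.Ω} (hu : u ∈ X P.Ω P.T) {n : ℕ} (hn : n < τ.N) :
    limPlus u (τ.t n) = u (τ.t n) :=
  limPlus_eq (tendsto_nhdsGT_of_mem_X hu (τ.zero_le hn.le)
    ((τ.t_lt n hn).trans_le (τ.le_last hn)))

lemma jump_of_mem_X {u : ℝ → L2 P.Ω} (hu : u ∈ X P.Ω P.T) {n : ℕ} (hn : n ∈ Finset.Ico 1 τ.N) :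
    jump u (τ.t n) = 0 := by
  obtain ⟨h1, h2⟩ := Finset.mem_Ico.1 hn
  have h3 : 0 < τ.t n := by
    have := τ.t_lt 0 (by omega)
    rw [τ.t_zero] at this
    exact this.trans_le (τ.t_le (by omega) h2.le)
  rw [jump, limPlus_of_mem_X hu h2, limMinus_eq (tendsto_nhdsLT_of_mem_X hu h3 (τ.le_last h2.le)),
    sub_self]

lemma dt_slab_of_mem_X {u : ℝ → L2 P.Ω} (hu : u ∈ X P.Ω P.T) {n : ℕ} (hn : n < τ.N) :
    dt (τ.t n) (τ.t (n + 1)) u =ᵐ[volume.restrict (Ioc (τ.t n) (τ.t (n + 1)))] dt 0 P.T u :=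
  IsRegularOn.dt_ae_eq
    ((isRegularOn_of_mem_X hu le_rfl P.T_pos le_rfl).isWeakDt_dt.mono (τ.zero_le hn.le)
      (τ.le_last hn))

/-- For functions without jumps, the dG form against a piecewise regular test function is the form
of the continuous problem, with the initial value of the test function taken from the right. -/
lemma Atau_of_mem_X (hd : d = 2 ∨ d = 3) (v : Fin d → H01 P.Ω) {u φ : ℝ → L2 P.Ω}
    (hu : u ∈ X P.Ω P.T) (hφ : φ ∈ Broken P.Ω τ) :
    P.Atau τ u v φ =
      (∫ t in Ioc 0 P.T, (P.ρ * dt 0 P.T u t (lift (φ t)) + P.a (lift (u t)) v (lift (φ t)))) +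
        inner ℝ (P.ρ • u 0) (limPlus φ (τ.t 0)) := by
  have hu' : u ∈ Broken P.Ω τ := XSub_le_Broken τ hu
  have hae : ∀ n < τ.N, (fun t => P.ρ * dt (τ.t n) (τ.t (n + 1)) u t (lift (φ t)) +
      P.a (lift (u t)) v (lift (φ t))) =ᵐ[volume.restrict (Ioc (τ.t n) (τ.t (n + 1)))]
      fun t => P.ρ * dt 0 P.T u t (lift (φ t)) + P.a (lift (u t)) v (lift (φ t)) := by
    intro n hn
    filter_upwards [dt_slab_of_mem_X hu hn] with t ht
    rw [ht]
  have hint : ∀ n < τ.N, IntegrableOn (fun t => P.ρ * dt 0 P.T u t (lift (φ t)) +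
      P.a (lift (u t)) v (lift (φ t))) (Ioc (τ.t n) (τ.t (n + 1))) := fun n hn =>
    (P.integrableOn_slab hd v (hu' n hn) (hφ n hn)).congr (hae n hn)
  rw [τ.integral_eq_sum hint, Atau, limPlus_of_mem_X hu (τ.N_pos P.T_pos)]
  have h0 : ∑ n ∈ Finset.Ico 1 τ.N, inner ℝ (P.ρ • jump u (τ.t n)) (limPlus φ (τ.t n)) = 0 :=
    Finset.sum_eq_zero fun n hn => by rw [jump_of_mem_X hu hn, smul_zero, inner_zero_left]
  rw [h0, add_zero, Finset.sum_congr rfl fun n hn =>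
    integral_congr_ae (hae n (Finset.mem_range.1 hn))]
  simp only [τ.t_zero]

lemma Atau_eq_A (hd : d = 2 ∨ d = 3) (v : Fin d → H01 P.Ω) {u φ : ℝ → L2 P.Ω}
    (hu : u ∈ X P.Ω P.T) (hφ : φ ∈ X P.Ω P.T) : P.Atau τ u v φ = P.A u v φ := by
  rw [Atau_of_mem_X hd v hu (XSub_le_Broken τ hφ), limPlus_of_mem_X hφ (τ.N_pos P.T_pos),
    τ.t_zero, A]

lemma Gtau_eq_G {φ : ℝ → L2 P.Ω} (hφ : φ ∈ X P.Ω P.T) : P.Gtau τ φ = P.G φ := by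
  rw [Gtau, G, limPlus_of_mem_X hφ (τ.N_pos P.T_pos), τ.t_zero]

end Problem

end

noncomputable section

/-! ### The error identity for a Lagrangian with bilinear constraint -/

/-- The trapezoidal rule with its exact remainder. -/
lemma trapezoidal_rule {f f₁ f₂ f₃ : ℝ → ℝ} (h₁ : ∀ s, HasDerivAt f (f₁ s) s)
    (h₂ : ∀ s, HasDerivAt f₁ (f₂ s) s) (h₃ : ∀ s, HasDerivAt f₂ (f₃ s) s)
    (hi : IntervalIntegrable f₃ volume 0 1) :
    f 1 - f 0 = (1 / 2) * f₁ 0 + (1 / 2) * f₁ 1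
      + (1 / 2) * ∫ s in (0 : ℝ)..1, f₃ s * (s * (s - 1)) := by
  have hF : ∀ s, HasDerivAt (fun s => f₂ s * (s * (s - 1)) - f₁ s * (2 * s - 1) + 2 * f s)
      (f₃ s * (s * (s - 1))) s := by
    intro s
    have d1 : HasDerivAt (fun s : ℝ => s * (s - 1)) (2 * s - 1) s := by
      have := (hasDerivAt_id s).mul ((hasDerivAt_id s).sub_const 1)
      convert! this using 1
      simp only [id]; ring
    have d2 : HasDerivAt (fun s : ℝ => 2 * s - 1) 2 s := by
      simpa using ((hasDerivAt_id s).const_mul 2).sub_const 1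
    have := (((h₃ s).mul d1).sub ((h₂ s).mul d2)).add ((h₁ s).const_mul 2)
    convert! this using 1
    ring
  have := intervalIntegral.integral_eq_sub_of_hasDerivAt (a := 0) (b := 1) (fun s _ => hF s)
    (hi.mul_continuousOn (by fun_prop))
  rw [this]
  ring

section

variable {V : Type*} [AddCommGroup V] [Module ℝ V]

lemma lineDeriv_add_smul (L : V → ℝ) (y e : V) (s : ℝ) :
    lineDeriv ℝ L (y + s • e) e = deriv (fun s : ℝ => L (y + s • e)) s := by
  have h : (fun t : ℝ => L (y + s • e + t • e)) =
      fun t => (fun s : ℝ => L (y + s • e)) (s + t) := by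
    funext t
    simp only [add_assoc, ← add_smul]
  rw [lineDeriv, h, deriv_comp_const_add (fun s : ℝ => L (y + s • e)), add_zero]

/-- The third directional derivative is the third derivative along the line. -/
lemma gateaux3_add_smul (L : V → ℝ) (y e : V) (s : ℝ) :
    gateaux3 L (y + s • e) e = deriv (deriv (deriv fun s : ℝ => L (y + s • e))) s := by
  have h1 : (fun s : ℝ => lineDeriv ℝ L (y + s • e) e) = deriv fun s : ℝ => L (y + s • e) :=
    funext fun s => lineDeriv_add_smul L y e s
  have h2 : (fun s : ℝ => lineDeriv ℝ (fun y₂ => lineDeriv ℝ L y₂ e) (y + s • e) e) =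
      deriv (deriv fun s : ℝ => L (y + s • e)) := by
    rw [← h1]
    exact funext fun s => lineDeriv_add_smul (fun y₂ => lineDeriv ℝ L y₂ e) y e s
  rw [← h2, gateaux3]
  exact lineDeriv_add_smul (fun y₁ => lineDeriv ℝ (fun y₂ => lineDeriv ℝ L y₂ e) y₁ e) y e s

lemma LineDifferentiableAt.differentiableAt_line {L : V → ℝ} {y e : V} {s : ℝ}
    (h : LineDifferentiableAt ℝ L (y + s • e) e) :
    DifferentiableAt ℝ (fun s : ℝ => L (y + s • e)) s := by
  have h1 : (fun t : ℝ => L (y + s • e + t • e)) =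
      fun t => (fun s : ℝ => L (y + s • e)) (t + s) := by
    funext t
    simp only [add_assoc, ← add_smul, add_comm s t]
  have h2 : DifferentiableAt ℝ (fun t => (fun s : ℝ => L (y + s • e)) (t + s)) 0 := by
    rw [← h1]; exact h
  have := (differentiableAt_comp_add_const (f := fun s : ℝ => L (y + s • e)) (a := 0) (b := s)).1 h2
  rwa [zero_add] at this

/-- `G` is linear and `A` bilinear on the subspace `B`. -/
structure IsBilinearOn (B : Submodule ℝ V) (G : V → ℝ) (A : V → V → ℝ) : Prop where
  add_smul : ∀ φ ∈ B, ∀ ψ ∈ B, ∀ c : ℝ, G (φ + c • ψ) = G φ + c * G ψ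
  add_smul_left : ∀ u ∈ B, ∀ w ∈ B, ∀ φ ∈ B, ∀ c : ℝ, A (u + c • w) φ = A u φ + c * A w φ
  add_smul_right : ∀ u ∈ B, ∀ φ ∈ B, ∀ ψ ∈ B, ∀ c : ℝ, A u (φ + c • ψ) = A u φ + c * A u ψ

/-- The Lagrangian `J(u) + G(z) - A(u)(z)`. -/
def lagrangian (J G : V → ℝ) (A : V → V → ℝ) (y : V × V) : ℝ := J y.1 + G y.2 - A y.1 y.2

namespace IsBilinearOn

variable {B : Submodule ℝ V} {J G : V → ℝ} {A : V → V → ℝ} {u z φ ψ : V}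

lemma lagrangian_line (h : IsBilinearOn B G A) (hu : u ∈ B) (hz : z ∈ B) (hφ : φ ∈ B)
    (hψ : ψ ∈ B) (s : ℝ) :
    lagrangian J G A ((u, z) + s • (φ, ψ)) =
      J (u + s • φ) + ((G z - A u z) + s * (G ψ - A u ψ - A φ z) - s ^ 2 * A φ ψ) := by
  change J (u + s • φ) + G (z + s • ψ) - A (u + s • φ) (z + s • ψ) = _
  rw [h.add_smul z hz ψ hψ, h.add_smul_left u hu φ hφ _ (B.add_mem hz (B.smul_mem s hψ)),
    h.add_smul_right u hu z hz ψ hψ, h.add_smul_right φ hφ z hz ψ hψ]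
  ring

lemma hasDerivAt_quadratic (a b c s : ℝ) :
    HasDerivAt (fun s : ℝ => a + s * b - s ^ 2 * c) (b - 2 * s * c) s := by
  have := (((hasDerivAt_id s).mul_const b).const_add a).sub
    (((hasDerivAt_id s).pow 2).mul_const c)
  convert! this using 1
  simp

lemma hasLineDerivAt_lagrangian (h : IsBilinearOn B G A) (hu : u ∈ B) (hz : z ∈ B) (hφ : φ ∈ B)
    (hψ : ψ ∈ B) {j : ℝ} (hJ : HasLineDerivAt ℝ J j u φ) :
    HasLineDerivAt ℝ (lagrangian J G A) (j + (G ψ - A u ψ - A φ z)) (u, z) (φ, ψ) := by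
  have h0 : HasDerivAt (fun t : ℝ => J (u + t • φ)) j 0 := hJ
  have h1 := h0.fun_add (hasDerivAt_quadratic (G z - A u z) (G ψ - A u ψ - A φ z) (A φ ψ) 0)
  rw [mul_zero, zero_mul, sub_zero] at h1
  unfold HasLineDerivAt
  simpa only [h.lagrangian_line hu hz hφ hψ] using h1

/-- The trapezoidal rule for the Lagrangian along the segment from `(u,z)` to `(u+φ,z+ψ)`. -/
lemma lagrangian_sub (h : IsBilinearOn B G A) {Y : Submodule ℝ V} (hY : Y ≤ B)
    (hJ : IsGateaux3On J Y) (hu : u ∈ Y) (hz : z ∈ Y) (hφ : φ ∈ Y) (hψ : ψ ∈ Y) {j₀ j₁ : ℝ}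
    (h₀ : HasLineDerivAt ℝ J j₀ u φ) (h₁ : HasLineDerivAt ℝ J j₁ (u + φ) φ) :
    lagrangian J G A (u + φ, z + ψ) - lagrangian J G A (u, z) =
      (1 / 2) * (j₀ + (G ψ - A u ψ - A φ z)) +
      (1 / 2) * (j₁ + (G ψ - A (u + φ) ψ - A φ (z + ψ))) +
      remainder (lagrangian J G A) (u, z) (φ, ψ) := by
  set q : ℝ → ℝ := fun s => (G z - A u z) + s * (G ψ - A u ψ - A φ z) - s ^ 2 * A φ ψ
  set k : ℝ → ℝ := fun s => J (u + s • φ)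
  set f : ℝ → ℝ := fun s => lagrangian J G A ((u, z) + s • (φ, ψ))
  have hf : f = fun s => k s + q s :=
    funext fun s => h.lagrangian_line (hY hu) (hY hz) (hY hφ) (hY hψ) s
  have hmem : ∀ s : ℝ, u + s • φ ∈ Y := fun s => Y.add_mem hu (Y.smul_mem s hφ)
  have hd := fun s : ℝ => hJ.1 (u + s • φ) (hmem s) φ hφ φ hφ φ hφ
  have ek1 : (fun s : ℝ => lineDeriv ℝ J (u + s • φ) φ) = deriv k :=
    funext fun s => lineDeriv_add_smul J u φ s
  have ek2 : (fun s : ℝ => lineDeriv ℝ (fun y₂ => lineDeriv ℝ J y₂ φ) (u + s • φ) φ) =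
      deriv (deriv k) := by
    rw [← ek1]
    exact funext fun s => lineDeriv_add_smul (fun y₂ => lineDeriv ℝ J y₂ φ) u φ s
  have k1 : ∀ s, HasDerivAt k (deriv k s) s := fun s =>
    ((hd s).1.differentiableAt_line).hasDerivAt
  have k2 : ∀ s, HasDerivAt (deriv k) (deriv (deriv k) s) s := fun s => by
    have := (hd s).2.1.differentiableAt_line
    rw [ek1] at this
    exact this.hasDerivAt
  have k3 : ∀ s, HasDerivAt (deriv (deriv k)) (deriv (deriv (deriv k)) s) s := fun s => by
    have := (hd s).2.2.differentiableAt_line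
    rw [ek2] at this
    exact this.hasDerivAt
  have f1 : ∀ s, HasDerivAt f (deriv k s + ((G ψ - A u ψ - A φ z) - 2 * s * A φ ψ)) s := fun s => by
    rw [hf]; exact (k1 s).add (hasDerivAt_quadratic _ _ _ s)
  have f2 : ∀ s, HasDerivAt (fun s => deriv k s + ((G ψ - A u ψ - A φ z) - 2 * s * A φ ψ))
      (deriv (deriv k) s + (- (2 * A φ ψ))) s := fun s => by
    refine (k2 s).add ?_
    have := (((hasDerivAt_id s).const_mul 2).mul_const (A φ ψ)).const_sub (G ψ - A u ψ - A φ z)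
    simpa using this
  have f3 : ∀ s, HasDerivAt (fun s => deriv (deriv k) s + (- (2 * A φ ψ)))
      (deriv (deriv (deriv k)) s) s := fun s => (k3 s).add_const _
  have hi : IntervalIntegrable (deriv (deriv (deriv k))) volume 0 1 := by
    have := hJ.2 u hu φ hφ
    simp only [gateaux3_add_smul] at this
    exact this
  have e3 : ∀ s, gateaux3 (lagrangian J G A) ((u, z) + s • (φ, ψ)) (φ, ψ) =
      deriv (deriv (deriv k)) s := fun s => by
    rw [gateaux3_add_smul]
    rw [show deriv (fun s : ℝ => lagrangian J G A ((u, z) + s • (φ, ψ))) = _ from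
      funext fun s => (f1 s).deriv, funext fun s => (f2 s).deriv]
    exact (f3 s).deriv
  have key := trapezoidal_rule f1 f2 f3 hi
  have v1 : f 1 = lagrangian J G A (u + φ, z + ψ) := by simp [f]
  have v0 : f 0 = lagrangian J G A (u, z) := by simp [f]
  have d0 : deriv k 0 = j₀ := HasLineDerivAt.lineDeriv h₀
  have d1 : deriv k 1 = j₁ := by
    rw [← ek1]
    simp only [one_smul]
    exact h₁.lineDeriv
  have a1 : A (u + φ) ψ = A u ψ + A φ ψ := by
    have := h.add_smul_left u (hY hu) φ (hY hφ) ψ (hY hψ) 1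
    rwa [one_smul, one_mul] at this
  have a2 : A φ (z + ψ) = A φ z + A φ ψ := by
    have := h.add_smul_right φ (hY hφ) z (hY hz) ψ (hY hψ) 1
    rwa [one_smul, one_mul] at this
  rw [v1, v0, d0, d1] at key
  rw [key, remainder, a1, a2]
  simp only [e3]
  ring

lemma map_sub (h : IsBilinearOn B G A) (hφ : φ ∈ B) (hψ : ψ ∈ B) : G (φ - ψ) = G φ - G ψ := by
  have := h.add_smul φ hφ ψ hψ (-1)
  rw [neg_one_smul, ← sub_eq_add_neg] at this
  rw [this]; ring

lemma sub_left (h : IsBilinearOn B G A) (hu : u ∈ B) (hφ : φ ∈ B) (hψ : ψ ∈ B) :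
    A (u - φ) ψ = A u ψ - A φ ψ := by
  have := h.add_smul_left u hu φ hφ ψ hψ (-1)
  rw [neg_one_smul, ← sub_eq_add_neg] at this
  rw [this]; ring

lemma sub_right (h : IsBilinearOn B G A) (hu : u ∈ B) (hφ : φ ∈ B) (hψ : ψ ∈ B) :
    A u (φ - ψ) = A u φ - A u ψ := by
  have := h.add_smul_right u hu φ hφ ψ hψ (-1)
  rw [neg_one_smul, ← sub_eq_add_neg] at this
  rw [this]; ring

lemma map_zero (h : IsBilinearOn B G A) : G 0 = 0 := by
  have := h.map_sub B.zero_mem B.zero_mem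
  simpa using this

lemma zero_left (h : IsBilinearOn B G A) (hφ : φ ∈ B) : A 0 φ = 0 := by
  have := h.sub_left B.zero_mem B.zero_mem hφ
  simpa using this

lemma zero_right (h : IsBilinearOn B G A) (hu : u ∈ B) : A u 0 = 0 := by
  have := h.sub_right hu B.zero_mem B.zero_mem
  simpa using this

/-- The directional derivative of the Lagrangian in its second argument. -/
lemma lineDeriv_snd (h : IsBilinearOn B G A) (hu : u ∈ B) (hz : z ∈ B) (hψ : ψ ∈ B) :
    lineDeriv ℝ (fun z' => lagrangian J G A (u, z')) z ψ = G ψ - A u ψ := by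
  have e : (fun s : ℝ => lagrangian J G A (u, z + s • ψ)) =
      fun s => J u + (G z - A u z) + s * (G ψ - A u ψ) - s ^ 2 * 0 := by
    funext s
    change J u + G (z + s • ψ) - A u (z + s • ψ) = _
    rw [h.add_smul z hz ψ hψ, h.add_smul_right u hu z hz ψ hψ]
    ring
  rw [lineDeriv, e, (hasDerivAt_quadratic _ _ _ 0).deriv]
  ring

/-- The directional derivative of the Lagrangian in its first argument. -/
lemma lineDeriv_fst (h : IsBilinearOn B G A) (hu : u ∈ B) (hz : z ∈ B) (hφ : φ ∈ B) {j : ℝ}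
    (hJ : HasLineDerivAt ℝ J j u φ) :
    lineDeriv ℝ (fun u' => lagrangian J G A (u', z)) u φ = j - A φ z := by
  have e : (fun s : ℝ => lagrangian J G A (u + s • φ, z)) =
      fun s => J (u + s • φ) + (G z - A u z + s * (- A φ z) - s ^ 2 * 0) := by
    funext s
    change J (u + s • φ) + G z - A (u + s • φ) z = _
    rw [h.add_smul_left u hu φ hφ z hz]
    ring
  have h0 : HasDerivAt (fun t : ℝ => J (u + t • φ)) j 0 := hJ
  rw [lineDeriv, e, (h0.fun_add (hasDerivAt_quadratic _ _ _ 0)).deriv]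
  ring

/-- At a stationary point of the Lagrangian the primal equation holds. -/
lemma primal_of_stationary (h : IsBilinearOn B G A) {D₁ D₂ : Set V} (hu : u ∈ B)
    (hz : z ∈ B) (h0 : (0 : V) ∈ D₁)
    (hs : IsStationaryPoint (lagrangian J G A) D₁ D₂ (u, z)) (hψ : ψ ∈ D₂)
    (hψ' : ψ ∈ B) : A u ψ = G ψ := by
  have hJ : HasLineDerivAt ℝ J 0 u 0 := by
    simpa [HasLineDerivAt] using hasDerivAt_const (0 : ℝ) (J u)
  have h1 := (hs 0 h0 ψ hψ).unique (h.hasLineDerivAt_lagrangian hu hz B.zero_mem hψ' hJ)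
  rw [h.zero_left hz] at h1
  linarith

/-- At a stationary point of the Lagrangian the dual equation holds. -/
lemma dual_of_stationary (h : IsBilinearOn B G A) {j : ℝ} {D₁ D₂ : Set V} (hu : u ∈ B)
    (hz : z ∈ B) (hJ : HasLineDerivAt ℝ J j u φ) (h0 : (0 : V) ∈ D₂)
    (hs : IsStationaryPoint (lagrangian J G A) D₁ D₂ (u, z)) (hφ : φ ∈ D₁)
    (hφ' : φ ∈ B) : A φ z = j := by
  have h1 := (hs φ hφ 0 h0).unique (h.hasLineDerivAt_lagrangian hu hz hφ' B.zero_mem hJ)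
  rw [h.map_zero, h.zero_right hu] at h1
  linarith

end IsBilinearOn

end

end

noncomputable section

/-! ### Consistency of the dG scheme -/

variable {d : ℕ}

namespace Problem

variable {P : Problem d} {τ : TimeGrid P.T}

lemma isBilinearOn_Atau (hd : d = 2 ∨ d = 3) (v : Fin d → H01 P.Ω) (τ : TimeGrid P.T) :
    IsBilinearOn (Broken P.Ω τ) (P.Gtau τ) (fun u φ => P.Atau τ u v φ) where
  add_smul _ hφ _ hψ c := Gtau_add_smul hφ hψ c
  add_smul_left _ hu _ hw _ hφ c := Atau_add_smul_left hd v hu hw hφ c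
  add_smul_right _ hu _ hφ _ hψ c := Atau_add_smul_right hd v hu hφ hψ c

lemma lagrTau_eq_lagrangian (τ : TimeGrid P.T) (J₁ : H01 P.Ω → ℝ) (J₂ : L2 P.Ω → ℝ)
    (v : Fin d → H01 P.Ω) :
    P.lagrTau τ J₁ J₂ v = lagrangian (P.J J₁ J₂) (P.Gtau τ) (fun u φ => P.Atau τ u v φ) := rfl

lemma smul_val_mem_X {p : ℝ → ℝ} (hp : ContDiff ℝ 1 p) (w : H01 P.Ω) :
    (fun t => p t • val w) ∈ X P.Ω P.T :=
  ⟨(hp.continuous.smul continuous_const).continuousOn,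
    (isRegularOn_smul_val hp w).exists_H01, _, isWeakDt_smul_val hp w⟩

lemma lift_smul_val (c : ℝ) (w : H01 P.Ω) : lift (c • val w) = c • w := by
  rw [← val_smul, lift_val P.isOpen]

/-- The residual of the transport equation, as a function of time with values in `H⁻¹(Ω)`. -/
def residual (P : Problem d) (hd : d = 2 ∨ d = 3) (v : Fin d → H01 P.Ω) (u : ℝ → L2 P.Ω) (t : ℝ) :
    Hm1 P.Ω :=
  P.ρ • dt 0 P.T u t + P.aForm hd v (lift (u t)) - P.g t

lemma memLp_residual (hd : d = 2 ∨ d = 3) (v : Fin d → H01 P.Ω) {u : ℝ → L2 P.Ω}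
    (hu : u ∈ X P.Ω P.T) : MemLp (P.residual hd v u) 2 (volume.restrict (Ioc 0 P.T)) := by
  have h := isRegularOn_of_mem_X hu le_rfl P.T_pos le_rfl
  exact ((h.isWeakDt_dt.1.const_smul P.ρ).add
    ((P.aForm hd v).comp_memLp' (h.memLp_lift P.isOpen))).sub P.g_mem

lemma memLp_lift_of_mem_Broken {φ : ℝ → L2 P.Ω} (hφ : φ ∈ Broken P.Ω τ) {n : ℕ} (hn : n < τ.N) :
    MemLp (fun t => lift (φ t)) 2 (volume.restrict (Ioc (τ.t n) (τ.t (n + 1)))) :=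
  (hφ n hn).memLp_lift P.isOpen

lemma Atau_sub_Gtau (hd : d = 2 ∨ d = 3) (v : Fin d → H01 P.Ω) {u φ : ℝ → L2 P.Ω}
    (hu : u ∈ X P.Ω P.T) (hφ : φ ∈ Broken P.Ω τ) :
    P.Atau τ u v φ - P.Gtau τ φ =
      (∫ t in Ioc 0 P.T, P.residual hd v u t (lift (φ t))) +
        inner ℝ (P.ρ • u 0 - P.u0) (limPlus φ (τ.t 0)) := by
  have hi : IntegrableOn (fun t => P.residual hd v u t (lift (φ t))) (Ioc 0 P.T) :=
    τ.integrableOn_of_slabs fun n hn => integrable_dual_apply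
      ((memLp_residual hd v hu).mono_measure (τ.slab_measure_le hn))
      (memLp_lift_of_mem_Broken hφ hn)
  have e : ∀ t, P.ρ * dt 0 P.T u t (lift (φ t)) + P.a (lift (u t)) v (lift (φ t)) =
      P.residual hd v u t (lift (φ t)) + P.g t (lift (φ t)) := fun t => by
    rw [residual, ← P.aForm_apply hd]
    simp only [sub_apply, add_apply, smul_apply, smul_eq_mul]
    ring
  rw [Atau_of_mem_X hd v hu hφ, Gtau]
  simp only [e]
  rw [integral_add hi (integrableOn_g_lift hφ), inner_sub_left]
  ring

/-- Consistency of the primal problem: a function of `X` that satisfies the variational equation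
for all test functions of `X` satisfies the dG equation for all piecewise regular test functions.
The equation holds in `H⁻¹(Ω)` at almost every time, and the initial condition holds in
`L²(Ω)`. -/
lemma Atau_eq_Gtau (hd : d = 2 ∨ d = 3) (v : Fin d → H01 P.Ω) {u : ℝ → L2 P.Ω}
    (hu : u ∈ X P.Ω P.T) (h : ∀ φ ∈ X P.Ω P.T, P.Atau τ u v φ = P.Gtau τ φ) {ψ : ℝ → L2 P.Ω}
    (hψ : ψ ∈ Broken P.Ω τ) : P.Atau τ u v ψ = P.Gtau τ ψ := by
  have key : ∀ p : ℝ → ℝ, ContDiff ℝ 1 p → ∀ w : H01 P.Ω,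
      (∫ t in Ioc 0 P.T, p t * P.residual hd v u t w) +
        p 0 * inner ℝ (P.ρ • u 0 - P.u0) (val w) = 0 := by
    intro p hp w
    have hX := smul_val_mem_X (P := P) hp w
    have h1 := Atau_sub_Gtau (τ := τ) hd v hu (XSub_le_Broken τ hX)
    rw [h _ hX, sub_self, limPlus_of_mem_X hX (τ.N_pos P.T_pos), τ.t_zero,
      real_inner_smul_right] at h1
    simp only [lift_smul_val, map_smul, smul_eq_mul] at h1
    exact h1.symm
  have hres : P.residual hd v u =ᵐ[volume.restrict (Ioc 0 P.T)] 0 := by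
    refine ae_eq_zero_of_forall_test_apply (memLp_residual hd v hu) fun η hη w => ?_
    have h1 := key η (hη.1.of_le (by simp)) w
    have h0 : η 0 = 0 := image_eq_zero_of_notMem_tsupport fun hh => lt_irrefl _ (hη.2.2 hh).1
    rwa [h0, zero_mul, add_zero] at h1
  have hinit : P.ρ • u 0 - P.u0 = 0 := by
    refine eq_zero_of_forall_inner_val P.isOpen fun w => ?_
    have h1 := key (fun _ => 1) contDiff_const w
    have h2 : ∫ t in Ioc 0 P.T, (1 : ℝ) * P.residual hd v u t w = 0 := by
      refine integral_eq_zero_of_ae ?_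
      filter_upwards [hres] with t ht
      rw [ht]; simp
    rwa [h2, zero_add, one_mul] at h1
  have h1 := Atau_sub_Gtau hd v hu hψ
  have h2 : ∫ t in Ioc 0 P.T, P.residual hd v u t (lift (ψ t)) = 0 := by
    refine integral_eq_zero_of_ae ?_
    filter_upwards [hres] with t ht
    rw [ht]; simp
  rw [h2, hinit, inner_zero_left, add_zero] at h1
  exact sub_eq_zero.1 h1

/-- The derivative of the goal functional at `y` in direction `φ`. -/
def goalDeriv (P : Problem d) (J₁' : H01 P.Ω → StrongDual ℝ (H01 P.Ω))
    (J₂' : L2 P.Ω → StrongDual ℝ (L2 P.Ω)) (y φ : ℝ → L2 P.Ω) : ℝ :=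
  (∫ t in Ioc 0 P.T, J₁' (lift (y t)) (lift (φ t))) + J₂' (y P.T) (φ P.T)

variable {J₁' : H01 P.Ω → StrongDual ℝ (H01 P.Ω)} {J₂' : L2 P.Ω → StrongDual ℝ (L2 P.Ω)}

lemma goalDeriv_add_smul {y φ ψ : ℝ → L2 P.Ω} (hφ : φ ∈ Broken P.Ω τ) (hψ : ψ ∈ Broken P.Ω τ)
    (iφ : IntegrableOn (fun t => J₁' (lift (y t)) (lift (φ t))) (Ioc 0 P.T))
    (iψ : IntegrableOn (fun t => J₁' (lift (y t)) (lift (ψ t))) (Ioc 0 P.T)) (c : ℝ) :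
    P.goalDeriv J₁' J₂' y (φ + c • ψ) =
      P.goalDeriv J₁' J₂' y φ + c * P.goalDeriv J₁' J₂' y ψ := by
  have h : ∫ t in Ioc 0 P.T, J₁' (lift (y t)) (lift ((φ + c • ψ) t)) =
      (∫ t in Ioc 0 P.T, J₁' (lift (y t)) (lift (φ t))) +
        c * ∫ t in Ioc 0 P.T, J₁' (lift (y t)) (lift (ψ t)) := by
    rw [← integral_const_mul, ← integral_add iφ (iψ.const_mul c)]
    refine integral_congr_ae ?_
    filter_upwards [lift_add_smul hφ hψ c] with t ht
    rw [ht, map_add, map_smul, smul_eq_mul]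
  have h2 : J₂' (y P.T) ((φ + c • ψ) P.T) =
      J₂' (y P.T) (φ P.T) + c * J₂' (y P.T) (ψ P.T) := by
    change J₂' (y P.T) (φ P.T + c • ψ P.T) = _
    rw [(J₂' (y P.T)).map_add (φ P.T) (c • ψ P.T), (J₂' (y P.T)).map_smul c (ψ P.T), smul_eq_mul]
  simp only [goalDeriv]
  rw [h, h2]
  ring

section Dual

variable {z : ℝ → L2 P.Ω}

lemma continuousOn_inner_val (hz : z ∈ X P.Ω P.T) {a b : ℝ} (ha : 0 ≤ a) (hb : b ≤ P.T)
    (w : H01 P.Ω) : ContinuousOn (fun t => inner ℝ (z t) (val w)) (Icc a b) :=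
  (hz.1.mono (Icc_subset_Icc ha hb)).inner continuousOn_const

lemma integrableOn_dt_apply (hz : z ∈ X P.Ω P.T) {a b : ℝ} (ha : 0 ≤ a) (hb : b ≤ P.T)
    (w : H01 P.Ω) : IntegrableOn (fun t => dt 0 P.T z t w) (Ioc a b) :=
  ((isRegularOn_of_mem_X hz le_rfl P.T_pos le_rfl).isWeakDt_dt.mono ha hb).integrable_apply w

/-- Integration by parts in time on a subinterval. -/
lemma integral_deriv_mul_inner (hz : z ∈ X P.Ω P.T) {a b : ℝ} (ha : 0 ≤ a) (hab : a < b)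
    (hb : b ≤ P.T) (w : H01 P.Ω) {p : ℝ → ℝ} (hp : ContDiff ℝ 1 p) :
    ∫ t in Ioc a b, deriv p t * inner ℝ (z t) (val w) =
      p b * inner ℝ (z b) (val w) - p a * inner ℝ (z a) (val w) -
        ∫ t in Ioc a b, p t * dt 0 P.T z t w :=
  integral_deriv_mul_of_weakDeriv hab (continuousOn_inner_val hz ha hb w)
    (integrableOn_dt_apply hz ha hb w)
    (fun η hη => ((isRegularOn_of_mem_X hz le_rfl P.T_pos le_rfl).isWeakDt_dt.mono ha hb).2 η hη w)
    hp

lemma integrableOn_mul_Ioc {a b : ℝ} {p f : ℝ → ℝ} (hp : Continuous p)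
    (hf : IntegrableOn f (Ioc a b)) : IntegrableOn (fun t => p t * f t) (Ioc a b) := by
  obtain ⟨M, hM⟩ := isCompact_Icc.exists_bound_of_continuousOn (s := Icc a b) hp.continuousOn
  exact hf.bdd_mul hp.aestronglyMeasurable ((ae_restrict_iff' measurableSet_Ioc).2
    (Filter.Eventually.of_forall fun t ht => hM t (Ioc_subset_Icc_self ht)))

lemma integrableOn_a_lift (hd : d = 2 ∨ d = 3) (v : Fin d → H01 P.Ω) (hz : z ∈ X P.Ω P.T) {a b : ℝ}
    (ha : 0 ≤ a) (hb : b ≤ P.T) (w : H01 P.Ω) :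
    IntegrableOn (fun t => P.a w v (lift (z t))) (Ioc a b) := by
  simp only [← P.aForm_apply hd]
  have h := ((isRegularOn_of_mem_X hz le_rfl P.T_pos le_rfl).memLp_lift P.isOpen).mono_measure
    (Measure.restrict_mono (Ioc_subset_Ioc ha hb) le_rfl)
  exact MemLp.integrable (q := 2) (by norm_num) ((P.aForm hd v w).comp_memLp' h)

lemma inner_val_lift_ae (hz : z ∈ X P.Ω P.T) {a b : ℝ} (ha : 0 ≤ a) (hb : b ≤ P.T) :
    ∀ᵐ t ∂(volume.restrict (Ioc a b)), val (lift (z t)) = z t := by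
  have := (isRegularOn_of_mem_X hz le_rfl P.T_pos le_rfl).eq_val_lift P.isOpen
  filter_upwards [ae_mono (Measure.restrict_mono (Ioc_subset_Ioc ha hb) le_rfl) this] with t ht
  exact ht.symm

/-- The dG form at the product of a function of time and a function of space, integrated by
parts. -/
lemma Atau_smul_val (hd : d = 2 ∨ d = 3) (v : Fin d → H01 P.Ω) (hz : z ∈ X P.Ω P.T)
    {p : ℝ → ℝ} (hp : ContDiff ℝ 1 p) (w : H01 P.Ω) :
    P.Atau τ (fun t => p t • val w) v z = P.ρ * (p P.T * inner ℝ (z P.T) (val w)) +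
      ∫ t in Ioc 0 P.T, p t * (- (P.ρ * dt 0 P.T z t w) + P.a w v (lift (z t))) := by
  have hX := smul_val_mem_X (P := P) hp w
  have ibp := integral_deriv_mul_inner hz le_rfl P.T_pos le_rfl w hp
  have i1 : IntegrableOn (fun t => deriv p t * inner ℝ (z t) (val w)) (Ioc 0 P.T) :=
    integrableOn_mul_Ioc (hp.continuous_deriv le_rfl)
      (((continuousOn_inner_val hz le_rfl le_rfl w).integrableOn_compact isCompact_Icc).mono_set
        Ioc_subset_Icc_self)
  have i2 := integrableOn_mul_Ioc hp.continuous (integrableOn_a_lift hd v hz le_rfl le_rfl w)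
  have i3 := integrableOn_mul_Ioc hp.continuous (integrableOn_dt_apply hz le_rfl le_rfl w)
  rw [Atau_eq_A hd v hX hz, A]
  have e1 : ∫ t in Ioc 0 P.T, (P.ρ * dt 0 P.T (fun t => p t • val w) t (lift (z t)) +
      P.a (lift (p t • val w)) v (lift (z t))) =
      ∫ t in Ioc 0 P.T, (P.ρ * (deriv p t * inner ℝ (z t) (val w)) +
        p t * P.a w v (lift (z t))) := by
    refine integral_congr_ae ?_
    filter_upwards [IsRegularOn.dt_ae_eq (isWeakDt_smul_val (a := 0) (b := P.T) hp w),
      inner_val_lift_ae hz le_rfl le_rfl] with t h1 h2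
    simp only [h1, lift_smul_val, ← P.aForm_apply hd, map_smul, smul_apply, innerVal_apply, h2,
      smul_eq_mul, real_inner_comm]
  have e2 : ∫ t in Ioc 0 P.T, p t * (- (P.ρ * dt 0 P.T z t w) + P.a w v (lift (z t))) =
      - (P.ρ * ∫ t in Ioc 0 P.T, p t * dt 0 P.T z t w) +
        ∫ t in Ioc 0 P.T, p t * P.a w v (lift (z t)) := by
    have i4 : IntegrableOn (fun t => -(P.ρ * (p t * dt 0 P.T z t w))) (Ioc 0 P.T) :=
      (i3.const_mul P.ρ).neg
    rw [← integral_const_mul, ← integral_neg, ← integral_add i4 i2]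
    refine integral_congr_ae (Filter.Eventually.of_forall fun t => ?_)
    simp only
    ring
  rw [e1, integral_add (i1.const_mul P.ρ) i2, integral_const_mul, ibp, e2,
    real_inner_smul_left, real_inner_smul_left, real_inner_comm (z 0) (val w)]
  ring

variable {u : ℝ → L2 P.Ω}

/-- The weak form of the dual equation at almost every time. As the derivative of the goal
functional is not known to be measurable with values in `H⁻¹(Ω)`, the exceptional set may depend on
the test function. -/
lemma dual_equation_ae (hd : d = 2 ∨ d = 3) (v : Fin d → H01 P.Ω) (hz : z ∈ X P.Ω P.T)
    (hi : ∀ w : H01 P.Ω, IntegrableOn (fun t => J₁' (lift (u t)) w) (Ioc 0 P.T))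
    (h : ∀ φ ∈ X P.Ω P.T, P.Atau τ φ v z = P.goalDeriv J₁' J₂' u φ) (w : H01 P.Ω) :
    ∀ᵐ t ∂(volume.restrict (Ioc 0 P.T)),
      J₁' (lift (u t)) w = - (P.ρ * dt 0 P.T z t w) + P.a w v (lift (z t)) := by
  have iK : IntegrableOn (fun t => - (P.ρ * dt 0 P.T z t w) + P.a w v (lift (z t))) (Ioc 0 P.T) :=
    ((integrableOn_dt_apply hz le_rfl le_rfl w).const_mul P.ρ).neg.add
      (integrableOn_a_lift hd v hz le_rfl le_rfl w)
  have h0 : (fun t => J₁' (lift (u t)) w - (- (P.ρ * dt 0 P.T z t w) + P.a w v (lift (z t))))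
      =ᵐ[volume.restrict (Ioo 0 P.T)] 0 := by
    refine ae_eq_zero_of_forall_test isOpen_Ioo
      (((hi w).sub iK).mono_set Ioo_subset_Ioc_self).locallyIntegrableOn fun η hη => ?_
    have h1 := h _ (smul_val_mem_X (P := P) (hη.1.of_le (by simp)) w)
    have hT : η P.T = 0 := image_eq_zero_of_notMem_tsupport fun hh => lt_irrefl _ (hη.2.2 hh).2
    rw [Atau_smul_val hd v hz (hη.1.of_le (by simp)), goalDeriv, hT, zero_smul, map_zero, zero_mul,
      mul_zero, zero_add, add_zero] at h1
    simp only [lift_smul_val, map_smul, smul_eq_mul] at h1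
    rw [← integral_Ioc_eq_integral_Ioo]
    simp only [smul_eq_mul, mul_sub]
    rw [integral_sub (hη.integrableOn_mul (hi w)) (hη.integrableOn_mul iK), h1, sub_self]
  rw [restrict_Ioo_eq_restrict_Ioc] at h0
  filter_upwards [h0] with t ht
  exact sub_eq_zero.1 ht

/-- The final condition of the dual problem. -/
lemma dual_final_condition (hd : d = 2 ∨ d = 3) (v : Fin d → H01 P.Ω) (hz : z ∈ X P.Ω P.T)
    (hi : ∀ w : H01 P.Ω, IntegrableOn (fun t => J₁' (lift (u t)) w) (Ioc 0 P.T))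
    (h : ∀ φ ∈ X P.Ω P.T, P.Atau τ φ v z = P.goalDeriv J₁' J₂' u φ) (q : L2 P.Ω) :
    J₂' (u P.T) q = P.ρ * inner ℝ q (z P.T) := by
  let q₀ := (InnerProductSpace.toDual ℝ (L2 P.Ω)).symm (J₂' (u P.T))
  have hq₀ : ∀ q, inner ℝ q₀ q = J₂' (u P.T) q := fun q => by
    rw [InnerProductSpace.toDual_symm_apply]
  have h0 : q₀ - P.ρ • z P.T = 0 := by
    refine eq_zero_of_forall_inner_val P.isOpen fun w => ?_
    have h1 := h _ (smul_val_mem_X (P := P) (p := fun _ => 1) contDiff_const w)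
    rw [Atau_smul_val hd v hz contDiff_const, goalDeriv] at h1
    simp only [one_smul, lift_val P.isOpen, one_mul] at h1
    rw [integral_congr_ae (dual_equation_ae hd v hz hi h w)] at h1
    rw [inner_sub_left, hq₀, real_inner_smul_left]
    linarith
  rw [← hq₀, sub_eq_zero.1 h0, real_inner_smul_left, real_inner_comm]

lemma sum_pow_inner {r : ℕ} (c : Fin (r + 1) → H01 P.Ω) (s : ℝ) (q : L2 P.Ω) :
    ∑ j : Fin (r + 1), s ^ (j : ℕ) * inner ℝ q (val (c j)) =
      inner ℝ (∑ j : Fin (r + 1), s ^ (j : ℕ) • val (c j)) q := by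
  rw [sum_inner]
  refine Finset.sum_congr rfl fun j _ => ?_
  rw [real_inner_smul_left, real_inner_comm]

lemma sum_pow_smul_val {r : ℕ} (c : Fin (r + 1) → H01 P.Ω) (s : ℝ) :
    ∑ j : Fin (r + 1), s ^ (j : ℕ) • val (c j) = val (∑ j : Fin (r + 1), s ^ (j : ℕ) • c j) := by
  rw [val_sum]; rfl

lemma lift_sum_pow {r : ℕ} (c : Fin (r + 1) → H01 P.Ω) (s : ℝ) :
    lift (∑ j : Fin (r + 1), s ^ (j : ℕ) • val (c j)) = ∑ j : Fin (r + 1), s ^ (j : ℕ) • c j := by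
  rw [sum_pow_smul_val, lift_val P.isOpen]

lemma continuous_sum_pow {r : ℕ} (c : Fin (r + 1) → H01 P.Ω) :
    Continuous fun s : ℝ => ∑ j : Fin (r + 1), s ^ (j : ℕ) • val (c j) :=
  continuous_finsetSum _ fun _ _ => (continuous_id.pow _).smul continuous_const

lemma limPlus_of_eq_sum {r : ℕ} {a b : ℝ} (hab : a < b) {φ : ℝ → L2 P.Ω}
    {c : Fin (r + 1) → H01 P.Ω}
    (hc : ∀ s ∈ Ioc a b, φ s = ∑ j : Fin (r + 1), s ^ (j : ℕ) • val (c j)) :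
    limPlus φ a = ∑ j : Fin (r + 1), a ^ (j : ℕ) • val (c j) := by
  refine limPlus_eq ((((continuous_sum_pow c).tendsto a).mono_left nhdsWithin_le_nhds).congr' ?_)
  filter_upwards [Ioc_mem_nhdsGT hab] with t ht using (hc t ht).symm

lemma limMinus_of_eq_sum {r : ℕ} {a b : ℝ} (hab : a < b) {φ : ℝ → L2 P.Ω}
    {c : Fin (r + 1) → H01 P.Ω}
    (hc : ∀ s ∈ Ioc a b, φ s = ∑ j : Fin (r + 1), s ^ (j : ℕ) • val (c j)) :
    limMinus φ b = φ b := by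
  rw [hc b ⟨hab, le_rfl⟩]
  refine limMinus_eq ((((continuous_sum_pow c).tendsto b).mono_left nhdsWithin_le_nhds).congr' ?_)
  filter_upwards [Ioo_mem_nhdsLT hab] with t ht using (hc t (Ioo_subset_Ioc_self ht)).symm

/-- The contribution of one time interval to the dG form at a polynomial in time, integrated by
parts. -/
lemma integral_slab_dual (hd : d = 2 ∨ d = 3) (v : Fin d → H01 P.Ω) (hz : z ∈ X P.Ω P.T)
    (hE : ∀ w : H01 P.Ω, ∀ᵐ t ∂(volume.restrict (Ioc 0 P.T)),
      J₁' (lift (u t)) w = - (P.ρ * dt 0 P.T z t w) + P.a w v (lift (z t)))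
    {r : ℕ} {a b : ℝ} (ha : 0 ≤ a) (hab : a < b) (hb : b ≤ P.T) {φ : ℝ → L2 P.Ω}
    (hiφ : IntegrableOn (fun t => J₁' (lift (u t)) (lift (φ t))) (Ioc a b))
    {c : Fin (r + 1) → H01 P.Ω}
    (hc : ∀ s ∈ Ioc a b, φ s = ∑ j : Fin (r + 1), s ^ (j : ℕ) • val (c j)) :
    ∫ t in Ioc a b, (P.ρ * dt a b φ t (lift (z t)) + P.a (lift (φ t)) v (lift (z t))) =
      (∫ t in Ioc a b, J₁' (lift (u t)) (lift (φ t))) +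
        P.ρ * (inner ℝ (φ b) (z b) - inner ℝ (limPlus φ a) (z a)) := by
  have hφe : ∀ᵐ t ∂(volume.restrict (Ioc a b)),
      φ t = ∑ j : Fin (r + 1), t ^ (j : ℕ) • val (c j) :=
    (ae_restrict_iff' measurableSet_Ioc).2 (Filter.Eventually.of_forall hc)
  have hdt : dt a b φ =ᵐ[volume.restrict (Ioc a b)]
      fun s => ∑ j : Fin (r + 1), deriv (fun t : ℝ => t ^ (j : ℕ)) s • innerVal (c j) :=
    IsRegularOn.dt_ae_eq ((isWeakDt_sum_pow c).1.congr (Filter.EventuallyEq.symm hφe))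
  have hE' : ∀ᵐ t ∂(volume.restrict (Ioc a b)), ∀ j, J₁' (lift (u t)) (c j) =
      - (P.ρ * dt 0 P.T z t (c j)) + P.a (c j) v (lift (z t)) :=
    ae_all_iff.2 fun j => ae_mono (Measure.restrict_mono (Ioc_subset_Ioc ha hb) le_rfl) (hE (c j))
  have hp : ∀ j : Fin (r + 1), ContDiff ℝ 1 (fun t : ℝ => t ^ (j : ℕ)) := fun j => contDiff_id.pow _
  have i1 : ∀ j : Fin (r + 1), IntegrableOn
      (fun t => deriv (fun t : ℝ => t ^ (j : ℕ)) t * inner ℝ (z t) (val (c j))) (Ioc a b) :=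
    fun j => integrableOn_mul_Ioc ((hp j).continuous_deriv le_rfl)
      (((continuousOn_inner_val hz ha hb (c j)).integrableOn_compact isCompact_Icc).mono_set
        Ioc_subset_Icc_self)
  have i2 : ∀ j : Fin (r + 1), IntegrableOn
      (fun t => t ^ (j : ℕ) * dt 0 P.T z t (c j)) (Ioc a b) := fun j =>
    integrableOn_mul_Ioc (hp j).continuous (integrableOn_dt_apply hz ha hb (c j))
  have i3 : ∀ j : Fin (r + 1), IntegrableOn
      (fun t => deriv (fun t : ℝ => t ^ (j : ℕ)) t * inner ℝ (z t) (val (c j)) +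
        t ^ (j : ℕ) * dt 0 P.T z t (c j)) (Ioc a b) := fun j => (i1 j).add (i2 j)
  have e1 : ∫ t in Ioc a b, (P.ρ * dt a b φ t (lift (z t)) + P.a (lift (φ t)) v (lift (z t))) =
      ∫ t in Ioc a b, (J₁' (lift (u t)) (lift (φ t)) + P.ρ * ∑ j : Fin (r + 1),
        (deriv (fun t : ℝ => t ^ (j : ℕ)) t * inner ℝ (z t) (val (c j)) +
          t ^ (j : ℕ) * dt 0 P.T z t (c j))) := by
    refine integral_congr_ae ?_
    filter_upwards [hφe, hdt, hE', inner_val_lift_ae hz ha hb] with t h1 h2 h3 h4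
    simp only [h2, h1, lift_sum_pow, ← P.aForm_apply hd, map_sum, map_smul, sum_apply, smul_apply,
      innerVal_apply, h4, smul_eq_mul, h3, Finset.mul_sum, ← Finset.sum_add_distrib]
    refine Finset.sum_congr rfl fun j _ => ?_
    rw [real_inner_comm (z t)]
    ring
  have e2 : ∀ j : Fin (r + 1), ∫ t in Ioc a b,
      (deriv (fun t : ℝ => t ^ (j : ℕ)) t * inner ℝ (z t) (val (c j)) +
        t ^ (j : ℕ) * dt 0 P.T z t (c j)) =
      b ^ (j : ℕ) * inner ℝ (z b) (val (c j)) - a ^ (j : ℕ) * inner ℝ (z a) (val (c j)) := by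
    intro j
    rw [integral_add (i1 j) (i2 j), integral_deriv_mul_inner hz ha hab hb (c j) (hp j)]
    ring
  rw [e1, integral_add hiφ ((integrable_finsetSum _ fun j _ => i3 j).const_mul P.ρ),
    integral_const_mul, integral_finsetSum _ fun j _ => i3 j, Finset.sum_congr rfl fun j _ => e2 j,
    Finset.sum_sub_distrib, sum_pow_inner, sum_pow_inner, limPlus_of_eq_sum hab hc,
    hc b ⟨hab, le_rfl⟩]

lemma telescope (p q : ℕ → ℝ) {N : ℕ} (hN : 0 < N) :
    ∑ n ∈ Finset.range N, (q (n + 1) - p n) + ∑ n ∈ Finset.Ico 1 N, (p n - q n) + p 0 = q N := by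
  induction N, hN using Nat.le_induction with
  | base => simp
  | succ n hn ih =>
    rw [Finset.sum_range_succ, Finset.sum_Ico_succ_top hn]
    linarith

/-- Consistency of the dual problem: a dual solution for all directions of `X` is one for all
directions of `X_τ`. -/
lemma Atau_eq_goalDeriv (hd : d = 2 ∨ d = 3) (v : Fin d → H01 P.Ω) (hz : z ∈ X P.Ω P.T)
    (hi : ∀ w : H01 P.Ω, IntegrableOn (fun t => J₁' (lift (u t)) w) (Ioc 0 P.T))
    (h : ∀ φ ∈ X P.Ω P.T, P.Atau τ φ v z = P.goalDeriv J₁' J₂' u φ) {r : ℕ} {φ : ℝ → L2 P.Ω}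
    (hφ : φ ∈ Xtau P.Ω τ r)
    (hiφ : IntegrableOn (fun t => J₁' (lift (u t)) (lift (φ t))) (Ioc 0 P.T)) :
    P.Atau τ φ v z = P.goalDeriv J₁' J₂' u φ := by
  have hE := dual_equation_ae hd v hz hi h
  have hiφ' : ∀ n < τ.N, IntegrableOn (fun t => J₁' (lift (u t)) (lift (φ t)))
      (Ioc (τ.t n) (τ.t (n + 1))) := fun n hn => hiφ.mono_set (τ.slab_subset hn)
  have h1 : ∀ n ∈ Finset.range τ.N, ∫ t in Ioc (τ.t n) (τ.t (n + 1)),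
      (P.ρ * dt (τ.t n) (τ.t (n + 1)) φ t (lift (z t)) + P.a (lift (φ t)) v (lift (z t))) =
      (∫ t in Ioc (τ.t n) (τ.t (n + 1)), J₁' (lift (u t)) (lift (φ t))) +
        P.ρ * (inner ℝ (φ (τ.t (n + 1))) (z (τ.t (n + 1))) -
          inner ℝ (limPlus φ (τ.t n)) (z (τ.t n))) := by
    intro n hn
    have hn' := Finset.mem_range.1 hn
    obtain ⟨c, hc⟩ := hφ n hn'
    exact integral_slab_dual hd v hz hE (τ.zero_le hn'.le) (τ.t_lt n hn') (τ.le_last hn')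
      (hiφ' n hn') hc
  have h2 : ∑ n ∈ Finset.Ico 1 τ.N, inner ℝ (P.ρ • jump φ (τ.t n)) (limPlus z (τ.t n)) =
      ∑ n ∈ Finset.Ico 1 τ.N, P.ρ * (inner ℝ (limPlus φ (τ.t n)) (z (τ.t n)) -
        inner ℝ (φ (τ.t n)) (z (τ.t n))) := by
    refine Finset.sum_congr rfl fun n hn => ?_
    obtain ⟨n1, n2⟩ := Finset.mem_Ico.1 hn
    obtain ⟨m, rfl⟩ : ∃ m, n = m + 1 := ⟨n - 1, by omega⟩
    obtain ⟨c, hc⟩ := hφ m (by omega)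
    rw [jump, limMinus_of_eq_sum (τ.t_lt m (by omega)) hc, limPlus_of_mem_X hz n2,
      real_inner_smul_left, inner_sub_left]
  have h3 := telescope (fun n => inner ℝ (limPlus φ (τ.t n)) (z (τ.t n)))
    (fun n => inner ℝ (φ (τ.t n)) (z (τ.t n))) (τ.N_pos P.T_pos)
  rw [Atau, Finset.sum_congr rfl h1, h2, Finset.sum_add_distrib, ← τ.integral_eq_sum hiφ',
    ← Finset.mul_sum, ← Finset.mul_sum, limPlus_of_mem_X hz (τ.N_pos P.T_pos),
    real_inner_smul_left, goalDeriv, dual_final_condition hd v hz hi h]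
  simp only [τ.t_last] at h3
  rw [← h3]
  ring

end Dual

end Problem

end

noncomputable section

/-! ### Weak divergences on mesh cells -/

variable {d : ℕ} {K : Set (E d)}

lemma integrable_inner_of_memLp {α F : Type*} [MeasurableSpace α] {μ : Measure α}
    [NormedAddCommGroup F] [InnerProductSpace ℝ F] {f g : α → F} (hf : MemLp f 2 μ)
    (hg : MemLp g 2 μ) : Integrable (fun x => inner ℝ (f x) (g x)) μ := by
  refine (MeasureTheory.L2.integrable_inner (𝕜 := ℝ) (hf.toLp f) (hg.toLp g)).congr ?_
  filter_upwards [hf.coeFn_toLp, hg.coeFn_toLp] with x h1 h2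
  rw [h1, h2]

/-- The graph of the weak divergence on `K`, as an operator from `L²(K)^d` to `L²(K)`. -/
def weakDivGraph (K : Set (E d)) : Submodule ℝ ((E d → E d) × (E d → ℝ)) where
  carrier := {y | MemLp y.1 2 (volume.restrict K) ∧ IsWeakDivOn K y.1 y.2}
  zero_mem' := by
    refine ⟨MemLp.zero, MemLp.zero, fun ψ _ => ?_⟩
    simp
  add_mem' := by
    rintro ⟨G, q⟩ ⟨G', q'⟩ ⟨hG, hq, h⟩ ⟨hG', hq', h'⟩
    refine ⟨hG.add hG', hq.add hq', fun ψ hψ => ?_⟩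
    change ∫ x in K, (q x + q' x) * ψ x = - ∫ x in K, inner ℝ (G x + G' x) (gradient ψ x)
    have i1 : ∀ {f : E d → ℝ}, MemLp f 2 (volume.restrict K) →
        Integrable (fun x => f x * ψ x) (volume.restrict K) := fun hf =>
      hf.integrable_mul (hψ.memLp 2 _)
    have i2 : ∀ {f : E d → E d}, MemLp f 2 (volume.restrict K) →
        Integrable (fun x => inner ℝ (f x) (gradient ψ x)) (volume.restrict K) := fun hf =>
      integrable_inner_of_memLp hf (hψ.memLp_gradient 2 _)
    simp only [add_mul, inner_add_left]
    have e := h ψ hψ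
    have e' := h' ψ hψ
    simp only at e e'
    rw [integral_add (i1 hq) (i1 hq'), integral_add (i2 hG) (i2 hG'), e, e']
    ring
  smul_mem' := by
    rintro c ⟨G, q⟩ ⟨hG, hq, h⟩
    refine ⟨hG.const_smul c, hq.const_smul c, fun ψ hψ => ?_⟩
    simp only [Prod.smul_mk, Pi.smul_apply, smul_eq_mul, mul_assoc, real_inner_smul_left]
    rw [integral_const_mul, integral_const_mul, h ψ hψ]
    ring

lemma IsWeakDivOn.congr {G G' : E d → E d} {q : E d → ℝ} (h : IsWeakDivOn K G q)
    (hG : G =ᵐ[volume.restrict K] G') : IsWeakDivOn K G' q := by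
  refine ⟨h.1, fun ψ hψ => ?_⟩
  rw [h.2 ψ hψ]
  congr 1
  refine integral_congr_ae ?_
  filter_upwards [hG] with x hx
  rw [hx]

lemma memLp_weakDivOn (G : E d → E d) : MemLp (weakDivOn K G) 2 (volume.restrict K) := by
  unfold weakDivOn
  split_ifs with h
  · exact h.choose_spec.1
  · exact MemLp.zero

lemma weakDivOn_ae_eq (hK : IsOpen K) {G : E d → E d} {q : E d → ℝ} (h : IsWeakDivOn K G q) :
    weakDivOn K G =ᵐ[volume.restrict K] q := by
  have h' : IsWeakDivOn K G (weakDivOn K G) := by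
    have hex : ∃ q, IsWeakDivOn K G q := ⟨q, h⟩
    rw [weakDivOn, dif_pos hex]
    exact hex.choose_spec
  have h0 : weakDivOn K G - q =ᵐ[volume.restrict K] 0 := by
    refine ae_eq_zero_of_forall_test hK
      (MemLp.locallyIntegrableOn_of_two hK (h'.1.sub h.1)) fun η hη => ?_
    have i1 : ∀ {f : E d → ℝ}, MemLp f 2 (volume.restrict K) →
        Integrable (fun x => f x * η x) (volume.restrict K) := fun hf =>
      hf.integrable_mul (hη.memLp 2 _)
    simp only [Pi.sub_apply, smul_eq_mul, mul_comm (η _), sub_mul]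
    rw [integral_sub (i1 h'.1) (i1 h.1), h'.2 η hη, h.2 η hη, sub_self]
  filter_upwards [h0] with x hx
  exact sub_eq_zero.1 hx

/-- The weak divergence of a polynomial in time with values in `L²(K)^d` is, at almost every time,
a polynomial in time with values in `L²(K)`. If some coefficient has no weak divergence in `L²(K)`,
then only finitely many values of the polynomial have one, because the values at any `r + 1` times
span the coefficients; elsewhere `weakDivOn` is zero by convention. -/
lemma exists_weakDivOn_sum_pow (hK : IsOpen K) {r : ℕ} (G : Fin (r + 1) → E d → E d)
    (hG : ∀ j, MemLp (G j) 2 (volume.restrict K)) :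
    ∃ q : Fin (r + 1) → E d → ℝ, (∀ j, MemLp (q j) 2 (volume.restrict K)) ∧
      ∀ᵐ t : ℝ, ∀ G' : E d → E d,
        G' =ᵐ[volume.restrict K] (fun x => ∑ j : Fin (r + 1), t ^ (j : ℕ) • G j x) →
        weakDivOn K G' =ᵐ[volume.restrict K] fun x => ∑ j : Fin (r + 1), t ^ (j : ℕ) * q j x := by
  by_cases hA : ∀ j, ∃ q, IsWeakDivOn K (G j) q
  · choose q hq using hA
    refine ⟨q, fun j => (hq j).1, Filter.Eventually.of_forall fun t G' hG' => ?_⟩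
    have h : ∑ j : Fin (r + 1), t ^ (j : ℕ) • (G j, q j) ∈ weakDivGraph K :=
      Submodule.sum_mem _ fun j _ => Submodule.smul_mem _ _ ⟨hG j, hq j⟩
    have h1 : (∑ j : Fin (r + 1), t ^ (j : ℕ) • (G j, q j)).1 =
        fun x => ∑ j : Fin (r + 1), t ^ (j : ℕ) • G j x := by
      rw [Prod.fst_sum]; ext1 x; simp
    have h2 : (∑ j : Fin (r + 1), t ^ (j : ℕ) • (G j, q j)).2 =
        fun x => ∑ j : Fin (r + 1), t ^ (j : ℕ) * q j x := by
      rw [Prod.snd_sum]; ext1 x; simp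
    have h3 := h.2
    rw [h1, h2] at h3
    exact weakDivOn_ae_eq hK (h3.congr hG'.symm)
  · let Z : Submodule ℝ (Fin (r + 1) → ℝ) :=
      ((weakDivGraph K).map (LinearMap.fst ℝ _ _)).comap (Fintype.linearCombination ℝ G)
    let B : Set ℝ := {t | (fun j : Fin (r + 1) => t ^ (j : ℕ)) ∈ Z}
    have hB : B.Finite := by
      by_contra hB
      obtain ⟨s, hs, hcard⟩ := Set.Infinite.exists_subset_card_eq hB (r + 1)
      let e := s.orderEmbOfFin hcard
      have hli : LinearIndependent ℝ (Matrix.vandermonde fun i => e i) :=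
        Matrix.linearIndependent_rows_of_det_ne_zero
          (Matrix.det_vandermonde_ne_zero_iff.2 e.injective)
      have htop := hli.span_eq_top_of_card_eq_finrank (by simp)
      have hle : Submodule.span ℝ (Set.range (Matrix.vandermonde fun i => e i)) ≤ Z := by
        rw [Submodule.span_le]
        rintro _ ⟨i, rfl⟩
        exact hs (s.orderEmbOfFin_mem hcard i)
      refine hA fun j => ?_
      have hj : (Pi.single j (1 : ℝ) : Fin (r + 1) → ℝ) ∈ Z := hle (htop ▸ Submodule.mem_top)
      obtain ⟨⟨G', q⟩, h1, h2⟩ := hj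
      rw [Fintype.linearCombination_apply_single, one_smul] at h2
      exact ⟨q, h2 ▸ h1.2⟩
    refine ⟨fun _ => 0, fun _ => MemLp.zero, ?_⟩
    filter_upwards [compl_mem_ae_iff.2 (hB.measure_zero volume)] with t ht G' hG'
    have hno : ¬ ∃ q, IsWeakDivOn K G' q := by
      rintro ⟨q, hq⟩
      suffices h : (fun j : Fin (r + 1) => t ^ (j : ℕ)) ∈ Z from ht h
      refine ⟨(fun x => ∑ j : Fin (r + 1), t ^ (j : ℕ) • G j x, q), ⟨?_, hq.congr hG'⟩, ?_⟩
      · exact memLp_finsetSum Finset.univ (f := fun (j : Fin (r + 1)) x => t ^ (j : ℕ) • G j x)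
          fun j _ => (hG j).const_smul (t ^ (j : ℕ))
      · ext1 x
        simp [Fintype.linearCombination_apply]
    rw [weakDivOn, dif_neg hno]
    filter_upwards with x
    simp

/-! ### Mesh cells are open -/

lemma contDiff_polyMap (F : Fin d → MvPolynomial (Fin d) ℝ) : ContDiff ℝ ∞ (polyMap F) := by
  refine (PiLp.contDiff_toLp).comp (contDiff_pi.2 fun i => ?_)
  have h : AnalyticOnNhd ℝ (fun x : E d => MvPolynomial.aeval (fun j => x j) (F i)) univ :=
    AnalyticOnNhd.aeval_mvPolynomial
      (fun j => (EuclideanSpace.proj j : E d →L[ℝ] ℝ).analyticOnNhd _) _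
  exact h.contDiff

lemma isOpen_refCube : IsOpen (refCube d) := by
  have : refCube d = ⋂ i, (fun x : E d => x i) ⁻¹' Ioo 0 1 := by
    ext x; simp [refCube]
  rw [this]
  exact isOpen_iInter_of_finite fun i => isOpen_Ioo.preimage (by fun_prop)

/-- Mesh cells are open by the inverse function theorem. -/
lemma Mesh.isOpen_cell {Ω : Set (E d)} (M : Mesh Ω) (K : Fin M.card) : IsOpen (M.cell K) := by
  rw [isOpen_iff_mem_nhds]
  rintro _ ⟨x, hx, rfl⟩
  have hdet := M.det_ne K x fun i => Ioo_subset_Icc_self (hx i)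
  have h1 : HasStrictFDerivAt (polyMap (M.map K)) (fderiv ℝ (polyMap (M.map K)) x) x :=
    (contDiff_polyMap _).contDiffAt.hasStrictFDerivAt (by simp)
  have h2 : HasStrictFDerivAt (polyMap (M.map K))
      (((fderiv ℝ (polyMap (M.map K)) x).toContinuousLinearEquivOfDetNeZero hdet :
        E d ≃L[ℝ] E d) : E d →L[ℝ] E d) x := by
    rwa [ContinuousLinearMap.coe_toContinuousLinearEquivOfDetNeZero]
  rw [← h2.map_nhds_eq_of_equiv]
  exact Filter.image_mem_map (isOpen_refCube.mem_nhds hx)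

/-! ### Advection of functions in `H¹₀(Ω)` by a bounded field -/

section Supg

variable {Ω : Set (E d)}

/-- The field `b` is essentially bounded. -/
def IsBoundedField (b : Fin d → H01 Ω) : Prop :=
  ∀ i, MemLp (val (b i)) ⊤ (volume.restrict Ω)

lemma isBoundedField_of_mem_Vh (hb : Bornology.IsBounded Ω) (hΩ : IsOpen Ω) {M : Mesh Ω} {p : ℕ}
    {b : Fin d → H01 Ω} (h : ∀ i, val (b i) ∈ M.Vh p) : IsBoundedField b := by
  intro i
  obtain ⟨f, hf, hbf, -⟩ := h i
  obtain ⟨C, hC⟩ := (Metric.isCompact_of_isClosed_isBounded isClosed_closure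
    hb.closure).exists_bound_of_continuousOn hf
  refine memLp_top_of_bound (Lp.aestronglyMeasurable _) C ?_
  filter_upwards [hbf, ae_restrict_mem hΩ.measurableSet] with x hx hxΩ
  rw [hx]
  exact hC x (subset_closure hxΩ)

variable {b : Fin d → H01 Ω} {K : Set (E d)}

lemma memLp_restrict_of_subset (hKΩ : K ⊆ Ω) {F : Type*} [NormedAddCommGroup F] {f : E d → F}
    (hf : MemLp f 2 (volume.restrict Ω)) : MemLp f 2 (volume.restrict K) :=
  hf.mono_measure (Measure.restrict_mono hKΩ le_rfl)

lemma memLp_adv (hb : IsBoundedField b) (w : H01 Ω) :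
    MemLp (adv b (grad w)) 2 (volume.restrict Ω) := by
  refine memLp_finsetSum _ fun i _ => ?_
  have h1 : MemLp (fun x => grad w x i) 2 (volume.restrict Ω) :=
    (EuclideanSpace.proj i : E d →L[ℝ] ℝ).comp_memLp' (Lp.memLp (grad w))
  exact MemLp.mul' h1 (hb i)

lemma adv_grad_add_smul (b : Fin d → H01 Ω) (w w' : H01 Ω) (c : ℝ) :
    adv b (grad (w + c • w')) =ᵐ[volume.restrict Ω]
      fun x => adv b (grad w) x + c * adv b (grad w') x := by
  rw [grad_add, grad_smul]
  filter_upwards [Lp.coeFn_add (grad w) (c • grad w'), Lp.coeFn_smul c (grad w')] with x h1 h2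
  simp only [adv, h1, Pi.add_apply, h2, Pi.smul_apply, PiLp.add_apply, PiLp.smul_apply, smul_eq_mul,
    Finset.mul_sum, ← Finset.sum_add_distrib]
  exact Finset.sum_congr rfl fun i _ => by ring

lemma integral_mul_adv_add_smul (hKΩ : K ⊆ Ω) (hb : IsBoundedField b) {f : E d → ℝ}
    (hf : MemLp f 2 (volume.restrict K)) (w w' : H01 Ω) (c : ℝ) :
    ∫ x in K, f x * adv b (grad (w + c • w')) x =
      (∫ x in K, f x * adv b (grad w) x) + c * ∫ x in K, f x * adv b (grad w') x := by
  have hi : ∀ w : H01 Ω, IntegrableOn (fun x => f x * adv b (grad w) x) K := fun w =>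
    hf.integrable_mul (memLp_restrict_of_subset hKΩ (memLp_adv hb w))
  rw [← integral_const_mul, ← integral_add (hi w) ((hi w').const_mul c)]
  refine integral_congr_ae ?_
  filter_upwards [ae_mono (Measure.restrict_mono hKΩ le_rfl) (adv_grad_add_smul b w w' c)]
    with x hx
  rw [hx]
  ring

lemma integral_mul_adv_sum (hKΩ : K ⊆ Ω) (hb : IsBoundedField b) {f : E d → ℝ}
    (hf : MemLp f 2 (volume.restrict K)) {ι : Type*} (s : Finset ι) (a : ι → ℝ) (w : ι → H01 Ω) :
    ∫ x in K, f x * adv b (grad (∑ j ∈ s, a j • w j)) x =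
      ∑ j ∈ s, a j * ∫ x in K, f x * adv b (grad (w j)) x := by
  let L : H01 Ω →ₗ[ℝ] ℝ :=
    IsLinearMap.mk' (fun w => ∫ x in K, f x * adv b (grad w) x)
      { map_add := fun w w' => by
          have := integral_mul_adv_add_smul hKΩ hb hf w w' 1
          rwa [one_smul, one_mul] at this
        map_smul := fun c w => by
          have h0 := integral_mul_adv_add_smul hKΩ hb hf 0 0 (-1)
          have := integral_mul_adv_add_smul hKΩ hb hf 0 w c
          rw [smul_zero, add_zero] at h0
          rw [zero_add] at this
          rw [this, smul_eq_mul]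
          linarith }
  change L (∑ j ∈ s, a j • w j) = ∑ j ∈ s, a j * L (w j)
  simp only [map_sum, map_smul, smul_eq_mul]

end Supg

end

noncomputable section

/-! ### The strong residual and the linearity of the stabilization term -/

variable {d : ℕ} {P : Problem d} {D : SpaceDisc P} {b : Fin d → H01 P.Ω} {K : Set (E d)}
  {g u : ℝ → L2 P.Ω} {r : ℕ}

namespace SpaceDisc

lemma coeFn_sum_smul {α F ι : Type*} [MeasurableSpace α] {μ : Measure α} [NormedAddCommGroup F]
    [NormedSpace ℝ F] (s : Finset ι) (a : ι → ℝ) (f : ι → Lp F 2 μ) :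
    ⇑(∑ j ∈ s, a j • f j : Lp F 2 μ) =ᵐ[μ] fun x => ∑ j ∈ s, a j • f j x := by
  classical
  induction s using Finset.induction_on with
  | empty =>
    filter_upwards [Lp.coeFn_zero F 2 μ] with x hx
    simpa using hx
  | insert i s hi ih =>
    rw [Finset.sum_insert hi]
    filter_upwards [ih, Lp.coeFn_add (a i • f i) (∑ j ∈ s, a j • f j), Lp.coeFn_smul (a i) (f i)]
      with x h1 h2 h3
    rw [Finset.sum_insert hi, h2, Pi.add_apply, h1, h3, Pi.smul_apply]

lemma memLp_res (hKΩ : K ⊆ P.Ω) (hb : IsBoundedField b) (t : ℝ) :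
    MemLp (D.res g u b K t) 2 (volume.restrict K) := by
  have h : ∀ f : L2 P.Ω, MemLp f 2 (volume.restrict K) := fun f =>
    memLp_restrict_of_subset hKΩ (Lp.memLp f)
  have hα : MemLp (fun x => P.α x * u t x) 2 (volume.restrict P.Ω) :=
    MemLp.mul' (Lp.memLp (u t)) P.α_mem
  exact (((((h (deriv u t)).const_mul P.ρ).sub (memLp_weakDivOn _)).add
    (memLp_restrict_of_subset hKΩ (memLp_adv hb _))).add
    (memLp_restrict_of_subset hKΩ hα)).sub (h (g t))

lemma deriv_eq_of_eq_sum {a a' : ℝ} {c : Fin (r + 1) → H01 P.Ω}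
    (hc : ∀ s ∈ Ioc a a', u s = ∑ j : Fin (r + 1), s ^ (j : ℕ) • val (c j)) {t : ℝ}
    (ht : t ∈ Ioo a a') :
    deriv u t = ∑ j : Fin (r + 1), deriv (fun s : ℝ => s ^ (j : ℕ)) t • val (c j) := by
  have h : u =ᶠ[nhds t] fun s => ∑ j : Fin (r + 1), s ^ (j : ℕ) • val (c j) := by
    filter_upwards [Ioo_mem_nhds ht.1 ht.2] with s hs
    exact hc s (Ioo_subset_Ioc_self hs)
  rw [h.deriv_eq]
  refine HasDerivAt.deriv (HasDerivAt.fun_sum fun j _ => HasDerivAt.smul_const ?_ _)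
  exact ((differentiable_id.pow _) t).hasDerivAt

/-- The functional `f ↦ ∫_K f m` on `L²(Ω)` is represented by the extension of `m` by zero. -/
lemma exists_integral_mul_eq_inner (hK : IsOpen K) (hKΩ : K ⊆ P.Ω) {m : E d → ℝ}
    (hm : MemLp m 2 (volume.restrict K)) :
    ∃ m' : L2 P.Ω, ∀ f : L2 P.Ω, ∫ x in K, f x * m x = inner ℝ m' f := by
  have hm' : MemLp (K.indicator m) 2 (volume.restrict P.Ω) := by
    rw [memLp_indicator_iff_restrict hK.measurableSet,
      Measure.restrict_restrict hK.measurableSet, inter_eq_left.2 hKΩ]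
    exact hm
  refine ⟨hm'.toLp _, fun f => ?_⟩
  rw [MeasureTheory.L2.inner_def]
  have : ∫ x in P.Ω, inner ℝ (hm'.toLp _ x) (f x) =
      ∫ x in P.Ω, K.indicator (fun x => f x * m x) x := by
    refine integral_congr_ae ?_
    filter_upwards [hm'.coeFn_toLp] with x hx
    rw [hx, real_inner_eq_mul]
    by_cases h : x ∈ K
    · simp [h, mul_comm]
    · simp [h]
  rw [this, integral_indicator hK.measurableSet, Measure.restrict_restrict hK.measurableSet,
    inter_eq_left.2 hKΩ]

/-- The moments of the strong residual on a cell are integrable in time. -/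
lemma integrableOn_integral_res_mul (hK : IsOpen K) (hKΩ : K ⊆ P.Ω) (hb : IsBoundedField b)
    {a a' : ℝ} (hg : MemLp g 2 (volume.restrict (Ioc a a'))) {c : Fin (r + 1) → H01 P.Ω}
    (hc : ∀ s ∈ Ioc a a', u s = ∑ j : Fin (r + 1), s ^ (j : ℕ) • val (c j)) {m : E d → ℝ}
    (hm : MemLp m 2 (volume.restrict K)) :
    IntegrableOn (fun t => ∫ x in K, D.res g u b K t x * m x) (Ioc a a') := by
  have hG : ∀ j, MemLp (fun x => P.ε • grad (c j) x) 2 (volume.restrict K) := fun j =>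
    (memLp_restrict_of_subset hKΩ (Lp.memLp (grad (c j)))).const_smul P.ε
  obtain ⟨q, hq, hqt⟩ := exists_weakDivOn_sum_pow hK (fun j x => P.ε • grad (c j) x) hG
  obtain ⟨m', hm'⟩ := exists_integral_mul_eq_inner hK hKΩ hm
  have h2 : ∀ {f : E d → ℝ}, MemLp f 2 (volume.restrict P.Ω) → MemLp f 2 (volume.restrict K) :=
    fun hf => memLp_restrict_of_subset hKΩ hf
  have hα : ∀ w : L2 P.Ω, MemLp (fun x => P.α x * w x) 2 (volume.restrict K) := fun w =>
    h2 (MemLp.mul' (Lp.memLp w) P.α_mem)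
  let R : Fin (r + 1) → ℝ → E d → ℝ := fun j t x =>
    P.ρ * (deriv (fun s : ℝ => s ^ (j : ℕ)) t * val (c j) x) - t ^ (j : ℕ) * q j x +
      t ^ (j : ℕ) * adv b (grad (c j)) x + t ^ (j : ℕ) * (P.α x * val (c j) x)
  have hres : ∀ᵐ t ∂(volume.restrict (Ioc a a')), D.res g u b K t =ᵐ[volume.restrict K]
      fun x => (∑ j, R j t x) - g t x := by
    rw [← restrict_Ioo_eq_restrict_Ioc]
    filter_upwards [ae_restrict_mem measurableSet_Ioo, ae_restrict_of_ae hqt] with t ht hqt'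
    have hu := hc t (Ioo_subset_Ioc_self ht)
    have hlift : lift (u t) = ∑ j : Fin (r + 1), t ^ (j : ℕ) • c j := by
      rw [hu, Problem.lift_sum_pow]
    have hK' : ∀ {p : E d → Prop}, (∀ᵐ x ∂(volume.restrict P.Ω), p x) →
        ∀ᵐ x ∂(volume.restrict K), p x := fun h => ae_mono (Measure.restrict_mono hKΩ le_rfl) h
    have hgrad : ∀ᵐ x ∂(volume.restrict K),
        grad (lift (u t)) x = ∑ j : Fin (r + 1), t ^ (j : ℕ) • grad (c j) x := by
      rw [hlift, grad_sum]
      exact hK' (coeFn_sum_smul _ (fun j : Fin (r + 1) => t ^ (j : ℕ)) fun j => grad (c j))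
    have hdiv := hqt' (fun x => P.ε • grad (lift (u t)) x) (by
      filter_upwards [hgrad] with x hx
      rw [hx, Finset.smul_sum]
      exact Finset.sum_congr rfl fun j _ => smul_comm _ _ _)
    have hval : ∀ᵐ x ∂(volume.restrict K),
        u t x = ∑ j : Fin (r + 1), t ^ (j : ℕ) • val (c j) x := by
      rw [hu]
      exact hK' (coeFn_sum_smul _ _ _)
    have hderiv : ∀ᵐ x ∂(volume.restrict K), deriv u t x =
        ∑ j : Fin (r + 1), deriv (fun s : ℝ => s ^ (j : ℕ)) t • val (c j) x := by
      rw [deriv_eq_of_eq_sum hc ht]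
      exact hK' (coeFn_sum_smul _ _ _)
    filter_upwards [hgrad, hdiv, hval, hderiv] with x h1 h3 h4 h5
    have h6 : adv b (grad (lift (u t))) x =
        ∑ j : Fin (r + 1), t ^ (j : ℕ) * adv b (grad (c j)) x := by
      simp only [adv, h1, WithLp.ofLp_sum, WithLp.ofLp_smul, Finset.sum_apply, Pi.smul_apply,
        smul_eq_mul, Finset.mul_sum]
      rw [Finset.sum_comm]
      exact Finset.sum_congr rfl fun j _ => Finset.sum_congr rfl fun i _ => by ring
    rw [res, h3, h4, h5, h6]
    simp only [R, smul_eq_mul, Finset.sum_add_distrib, Finset.sum_sub_distrib, Finset.mul_sum]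
    congr 2
    exact Finset.sum_congr rfl fun j _ => by ring
  let F : Fin (r + 1) → ℝ → ℝ := fun j t =>
    P.ρ * (deriv (fun s : ℝ => s ^ (j : ℕ)) t * ∫ x in K, val (c j) x * m x)
      - t ^ (j : ℕ) * (∫ x in K, q j x * m x)
      + t ^ (j : ℕ) * (∫ x in K, adv b (grad (c j)) x * m x)
      + t ^ (j : ℕ) * (∫ x in K, P.α x * val (c j) x * m x)
  have hF : ∀ᵐ t ∂(volume.restrict (Ioc a a')),
      (∑ j, F j t) - inner ℝ m' (g t) = ∫ x in K, D.res g u b K t x * m x := by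
    filter_upwards [hres] with t ht
    have i0 : ∀ {f : E d → ℝ}, MemLp f 2 (volume.restrict K) → ∀ a : ℝ,
        Integrable (fun x => a * (f x * m x)) (volume.restrict K) := fun hf a =>
      (hf.integrable_mul hm).const_mul a
    have hv : ∀ j, MemLp (fun x => val (c j) x) 2 (volume.restrict K) := fun j =>
      h2 (Lp.memLp (val (c j)))
    have ha : ∀ j, MemLp (fun x => adv b (grad (c j)) x) 2 (volume.restrict K) := fun j =>
      h2 (memLp_adv hb (c j))
    have hR : ∀ j, (fun x => R j t x * m x) = fun x =>
        P.ρ * deriv (fun s : ℝ => s ^ (j : ℕ)) t * (val (c j) x * m x)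
          - t ^ (j : ℕ) * (q j x * m x) + t ^ (j : ℕ) * (adv b (grad (c j)) x * m x)
          + t ^ (j : ℕ) * (P.α x * val (c j) x * m x) := fun j => by
      ext x
      simp only [R]
      ring
    have iR : ∀ j, Integrable (fun x => R j t x * m x) (volume.restrict K) := fun j => by
      rw [hR]
      exact (((i0 (hv j) _).sub (i0 (hq j) _)).add (i0 (ha j) _)).add (i0 (hα (val (c j))) _)
    have eR : ∀ j, ∫ x in K, R j t x * m x = F j t := fun j => by
      have i12 : Integrable (fun x => P.ρ * deriv (fun s : ℝ => s ^ (j : ℕ)) t *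
          (val (c j) x * m x) - t ^ (j : ℕ) * (q j x * m x)) (volume.restrict K) :=
        (i0 (hv j) _).sub (i0 (hq j) _)
      have i123 : Integrable (fun x => P.ρ * deriv (fun s : ℝ => s ^ (j : ℕ)) t *
          (val (c j) x * m x) - t ^ (j : ℕ) * (q j x * m x) +
          t ^ (j : ℕ) * (adv b (grad (c j)) x * m x)) (volume.restrict K) :=
        i12.add (i0 (ha j) _)
      rw [hR, integral_add i123 (i0 (hα (val (c j))) _), integral_add i12 (i0 (ha j) _),
        integral_sub (i0 (hv j) _) (i0 (hq j) _)]
      simp only [integral_const_mul, F]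
      ring
    have ig : Integrable (fun x => g t x * m x) (volume.restrict K) :=
      (h2 (Lp.memLp (g t))).integrable_mul hm
    have iS : Integrable (fun x => ∑ j, R j t x * m x) (volume.restrict K) :=
      integrable_finsetSum _ fun j _ => iR j
    calc (∑ j, F j t) - inner ℝ m' (g t)
        = ∫ x in K, ((∑ j, R j t x * m x) - g t x * m x) := by
          rw [integral_sub iS ig, integral_finsetSum _ fun j _ => iR j, hm' (g t)]
          simp only [eR]
      _ = _ := by
          refine integral_congr_ae ?_
          filter_upwards [ht] with x hx
          rw [hx, sub_mul, Finset.sum_mul]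
  have iF : Continuous fun t => ∑ j, F j t := by
    refine continuous_finsetSum _ fun j _ => ?_
    have h1 : Continuous (deriv fun s : ℝ => s ^ (j : ℕ)) :=
      (contDiff_id.pow _ : ContDiff ℝ 1 fun s : ℝ => s ^ (j : ℕ)).continuous_deriv le_rfl
    fun_prop
  refine IntegrableOn.congr_fun_ae (f := fun t => (∑ j, F j t) - inner ℝ m' (g t)) ?_ hF
  refine Integrable.sub ?_ ?_
  · exact (iF.continuousOn.integrableOn_compact isCompact_Icc).mono_set Ioc_subset_Icc_self
  · exact (hg.const_inner m').integrable (by norm_num)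

variable {τ : TimeGrid P.T} {φ ψ : ℝ → L2 P.Ω}

lemma integrableOn_slab_res (hK : IsOpen K) (hKΩ : K ⊆ P.Ω) (hb : IsBoundedField b)
    (hg : MemLp g 2 (volume.restrict (Ioc 0 P.T))) (hu : u ∈ Xtau P.Ω τ r)
    (hφ : φ ∈ Xtau P.Ω τ r) {n : ℕ} (hn : n < τ.N) :
    IntegrableOn (fun t => ∫ x in K, D.res g u b K t x * adv b (grad (lift (φ t))) x)
      (Ioc (τ.t n) (τ.t (n + 1))) := by
  obtain ⟨c, hc⟩ := hu n hn
  obtain ⟨k, hk⟩ := hφ n hn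
  have hg' := hg.mono_measure (Measure.restrict_mono (τ.slab_subset hn) le_rfl)
  have hi : IntegrableOn (fun t => ∑ j : Fin (r + 1), t ^ (j : ℕ) *
      ∫ x in K, D.res g u b K t x * adv b (grad (k j)) x) (Ioc (τ.t n) (τ.t (n + 1))) :=
    integrable_finsetSum _ fun j _ => Problem.integrableOn_mul_Ioc (continuous_id.pow _)
      (integrableOn_integral_res_mul hK hKΩ hb hg' hc
        (memLp_restrict_of_subset hKΩ (memLp_adv hb (k j))))
  refine hi.congr_fun (fun t ht => ?_) measurableSet_Ioc
  simp only [hk t ht, Problem.lift_sum_pow]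
  rw [integral_mul_adv_sum hKΩ hb (memLp_res hKΩ hb t)]

lemma lift_val_add_smul_val (w w' : H01 P.Ω) (c : ℝ) :
    lift (val w + c • val w') = lift (val w) + c • lift (val w') := by
  rw [← val_smul, ← val_add, lift_val P.isOpen, lift_val P.isOpen, lift_val P.isOpen]

lemma lift_add_smul_of_mem_Xtau (hφ : φ ∈ Xtau P.Ω τ r) (hψ : ψ ∈ Xtau P.Ω τ r) (c : ℝ) {n : ℕ}
    (hn : n < τ.N) {t : ℝ} (ht : t ∈ Ioc (τ.t n) (τ.t (n + 1))) :
    lift (φ t + c • ψ t) = lift (φ t) + c • lift (ψ t) := by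
  obtain ⟨k, hk⟩ := hφ n hn
  obtain ⟨l, hl⟩ := hψ n hn
  rw [hk t ht, hl t ht, Problem.sum_pow_smul_val, Problem.sum_pow_smul_val, lift_val_add_smul_val]

lemma lift_limPlus_add_smul (hφ : φ ∈ Xtau P.Ω τ r) (hψ : ψ ∈ Xtau P.Ω τ r) (c : ℝ) {n : ℕ}
    (hn : n < τ.N) :
    lift (limPlus (φ + c • ψ) (τ.t n)) =
      lift (limPlus φ (τ.t n)) + c • lift (limPlus ψ (τ.t n)) := by
  rw [Problem.limPlus_add_smul (XtauSub_le_Broken τ r hφ) (XtauSub_le_Broken τ r hψ) c hn]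
  obtain ⟨k, hk⟩ := hφ n hn
  obtain ⟨l, hl⟩ := hψ n hn
  rw [Problem.limPlus_of_eq_sum (τ.t_lt n hn) hk, Problem.limPlus_of_eq_sum (τ.t_lt n hn) hl,
    Problem.sum_pow_smul_val, Problem.sum_pow_smul_val, lift_val_add_smul_val]

/-- The stabilization term is linear in the test function. -/
lemma S_add_smul (hb : IsBoundedField b) (hg : MemLp g 2 (volume.restrict (Ioc 0 P.T)))
    (hu : u ∈ Xtau P.Ω τ r) (hφ : φ ∈ Xtau P.Ω τ r) (hψ : ψ ∈ Xtau P.Ω τ r) (c : ℝ) :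
    D.S τ g u b (φ + c • ψ) = D.S τ g u b φ + c * D.S τ g u b ψ := by
  have hopen : ∀ n K, IsOpen ((D.mesh n).cell K) := fun n K => (D.mesh n).isOpen_cell K
  have hsub : ∀ n K, (D.mesh n).cell K ⊆ P.Ω := fun n K => (D.mesh n).subset K
  have h2 : ∀ n K, ∀ f : L2 P.Ω, MemLp f 2 (volume.restrict ((D.mesh n).cell K)) := fun n K f =>
    memLp_restrict_of_subset (hsub n K) (Lp.memLp f)
  have h1 : ∀ n ∈ Finset.range τ.N, ∫ t in Ioc (τ.t n) (τ.t (n + 1)),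
      ∑ K, D.δ (n + 1) K * ∫ x in (D.mesh (n + 1)).cell K,
        D.res g u b ((D.mesh (n + 1)).cell K) t x * adv b (grad (lift ((φ + c • ψ) t))) x =
      (∫ t in Ioc (τ.t n) (τ.t (n + 1)), ∑ K, D.δ (n + 1) K * ∫ x in (D.mesh (n + 1)).cell K,
        D.res g u b ((D.mesh (n + 1)).cell K) t x * adv b (grad (lift (φ t))) x) +
      c * ∫ t in Ioc (τ.t n) (τ.t (n + 1)), ∑ K, D.δ (n + 1) K * ∫ x in (D.mesh (n + 1)).cell K,
        D.res g u b ((D.mesh (n + 1)).cell K) t x * adv b (grad (lift (ψ t))) x := by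
    intro n hn
    have hn' := Finset.mem_range.1 hn
    have hi : ∀ {φ : ℝ → L2 P.Ω}, φ ∈ Xtau P.Ω τ r → IntegrableOn
        (fun t => ∑ K, D.δ (n + 1) K * ∫ x in (D.mesh (n + 1)).cell K,
          D.res g u b ((D.mesh (n + 1)).cell K) t x * adv b (grad (lift (φ t))) x)
        (Ioc (τ.t n) (τ.t (n + 1))) := fun hφ =>
      integrable_finsetSum _ fun K _ => (integrableOn_slab_res (hopen _ K) (hsub _ K) hb hg hu hφ
        hn').const_mul _
    rw [← integral_const_mul, ← integral_add (hi hφ) ((hi hψ).const_mul c)]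
    refine setIntegral_congr_fun measurableSet_Ioc fun t ht => ?_
    simp only [Pi.add_apply, Pi.smul_apply, lift_add_smul_of_mem_Xtau hφ hψ c hn' ht,
      Finset.mul_sum, ← Finset.sum_add_distrib]
    refine Finset.sum_congr rfl fun K _ => ?_
    rw [integral_mul_adv_add_smul (hsub _ K) hb (memLp_res (hsub _ K) hb t)]
    ring
  have h3 : ∀ n ∈ Finset.Ico 1 τ.N, ∑ K, D.δ (n + 1) K * ∫ x in (D.mesh (n + 1)).cell K,
        (P.ρ * jump u (τ.t n) x) * adv b (grad (lift (limPlus (φ + c • ψ) (τ.t n)))) x =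
      (∑ K, D.δ (n + 1) K * ∫ x in (D.mesh (n + 1)).cell K,
        (P.ρ * jump u (τ.t n) x) * adv b (grad (lift (limPlus φ (τ.t n)))) x) +
      c * ∑ K, D.δ (n + 1) K * ∫ x in (D.mesh (n + 1)).cell K,
        (P.ρ * jump u (τ.t n) x) * adv b (grad (lift (limPlus ψ (τ.t n)))) x := by
    intro n hn
    simp only [lift_limPlus_add_smul hφ hψ c (Finset.mem_Ico.1 hn).2, Finset.mul_sum,
      ← Finset.sum_add_distrib]
    refine Finset.sum_congr rfl fun K _ => ?_
    rw [integral_mul_adv_add_smul (f := fun x => P.ρ * jump u (τ.t n) x) (hsub _ K) hb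
      ((h2 _ K _).const_mul P.ρ)]
    ring
  have h4 : ∑ K, D.δ 1 K * ∫ x in (D.mesh 1).cell K, (P.ρ * limPlus u (τ.t 0) x - P.u0 x) *
        adv b (grad (lift (limPlus (φ + c • ψ) (τ.t 0)))) x =
      (∑ K, D.δ 1 K * ∫ x in (D.mesh 1).cell K, (P.ρ * limPlus u (τ.t 0) x - P.u0 x) *
        adv b (grad (lift (limPlus φ (τ.t 0)))) x) +
      c * ∑ K, D.δ 1 K * ∫ x in (D.mesh 1).cell K, (P.ρ * limPlus u (τ.t 0) x - P.u0 x) *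
        adv b (grad (lift (limPlus ψ (τ.t 0)))) x := by
    simp only [lift_limPlus_add_smul hφ hψ c (τ.N_pos P.T_pos), Finset.mul_sum,
      ← Finset.sum_add_distrib]
    refine Finset.sum_congr rfl fun K _ => ?_
    rw [integral_mul_adv_add_smul (f := fun x => P.ρ * limPlus u (τ.t 0) x - P.u0 x) (hsub _ K) hb
      (((h2 _ K _).const_mul P.ρ).sub (h2 _ K _))]
    ring
  rw [S, S, S, Finset.sum_congr rfl h1, Finset.sum_congr rfl h3, h4, Finset.sum_add_distrib,
    Finset.sum_add_distrib, ← Finset.mul_sum, ← Finset.mul_sum]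
  ring

lemma Xtauh_subset (D : SpaceDisc P) (τ : TimeGrid P.T) (r : ℕ) :
    D.Xtauh τ r ⊆ Xtau P.Ω τ r := fun _ hu n hn => by
  obtain ⟨c, -, hc⟩ := hu.1 n hn
  exact ⟨c, hc⟩

end SpaceDisc

end

noncomputable section

/-! ### Stationary points and the error representations -/

variable {d : ℕ} {P : Problem d} {τ : TimeGrid P.T} {r : ℕ}

lemma Mesh.sub_mem_Hh {Ω : Set (E d)} (M : Mesh Ω) {p : ℕ} {w w' : H01 Ω} (hw : w ∈ M.Hh p)
    (hw' : w' ∈ M.Hh p) : w - w' ∈ M.Hh p := by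
  obtain ⟨f, h1, h2, h3⟩ := hw
  obtain ⟨f', h1', h2', h3'⟩ := hw'
  refine ⟨f - f', h1.sub h1', ?_, fun K => ?_⟩
  · rw [val_sub]
    exact (Lp.coeFn_sub _ _).trans (h2.sub h2')
  · obtain ⟨q, hq, e⟩ := h3 K
    obtain ⟨q', hq', e'⟩ := h3' K
    refine ⟨q - q', fun i => (MvPolynomial.degreeOf_sub_le i q q').trans (max_le (hq i) (hq' i)),
      fun x hx => ?_⟩
    rw [Pi.sub_apply, e x hx, e' x hx, map_sub]

lemma SpaceDisc.sub_mem_Xtauh {D : SpaceDisc P} {u w : ℝ → L2 P.Ω} (hu : u ∈ D.Xtauh τ r)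
    (hw : w ∈ D.Xtauh τ r) : u - w ∈ D.Xtauh τ r := by
  obtain ⟨hu, a, ha, hua⟩ := hu
  obtain ⟨hw, b, hb, hwb⟩ := hw
  refine ⟨fun n hn => ?_, a - b, Mesh.sub_mem_Hh _ ha hb, ?_⟩
  · obtain ⟨c, hc, h⟩ := hu n hn
    obtain ⟨k, hk, h'⟩ := hw n hn
    refine ⟨fun j => c j - k j, fun j => Mesh.sub_mem_Hh _ (hc j) (hk j), fun s hs => ?_⟩
    rw [Pi.sub_apply, h s hs, h' s hs, ← Finset.sum_sub_distrib]
    exact Finset.sum_congr rfl fun j _ => by rw [val_sub, smul_sub]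
  · rw [Pi.sub_apply, hua, hwb, val_sub]

variable {J₁ : H01 P.Ω → ℝ} {J₂ : L2 P.Ω → ℝ}

/-- The Lagrangians `L` and `L_τ` agree on `X × X`, so that they have the same stationary points
there. -/
lemma isStationaryPoint_lagrTau (hd : d = 2 ∨ d = 3) {v : Fin d → H01 P.Ω} {u z : ℝ → L2 P.Ω}
    (hu : u ∈ X P.Ω P.T) (hz : z ∈ X P.Ω P.T)
    (h : IsStationaryPoint (P.lagr J₁ J₂ v) (X P.Ω P.T) (X P.Ω P.T) (u, z)) :
    IsStationaryPoint (P.lagrTau τ J₁ J₂ v) (X P.Ω P.T) (X P.Ω P.T) (u, z) := by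
  intro φ hφ ψ hψ
  have h1 := h φ hφ ψ hψ
  have e : (fun s : ℝ => P.lagrTau τ J₁ J₂ v ((u, z) + s • (φ, ψ))) =
      fun s : ℝ => P.lagr J₁ J₂ v ((u, z) + s • (φ, ψ)) := by
    funext s
    have k1 : u + s • φ ∈ X P.Ω P.T :=
      (XSub P.Ω P.T).add_mem hu ((XSub P.Ω P.T).smul_mem s hφ)
    have k2 : z + s • ψ ∈ X P.Ω P.T :=
      (XSub P.Ω P.T).add_mem hz ((XSub P.Ω P.T).smul_mem s hψ)
    change P.J J₁ J₂ (u + s • φ) + P.Gtau τ (z + s • ψ) - P.Atau τ (u + s • φ) v (z + s • ψ) =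
      P.J J₁ J₂ (u + s • φ) + P.G (z + s • ψ) - P.A (u + s • φ) v (z + s • ψ)
    rw [Problem.Atau_eq_A hd v k1 k2, Problem.Gtau_eq_G k2]
  unfold HasLineDerivAt at h1 ⊢
  rwa [e]

/-- The fully discrete Lagrangian is `L_τ - D_τh`. -/
lemma SpaceDisc.lagrTauH_eq (hd : d = 2 ∨ d = 3) (D : SpaceDisc P) (g : ℝ → L2 P.Ω)
    (v b : Fin d → H01 P.Ω) {u z : ℝ → L2 P.Ω} (hu : u ∈ Broken P.Ω τ) (hz : z ∈ Broken P.Ω τ) :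
    D.lagrTauH τ g J₁ J₂ b (u, z) = P.lagrTau τ J₁ J₂ v (u, z) - D.Dtauh τ g v b (u, z) := by
  have h := Problem.Atau_sub_Atau hd v b hu hz
  simp only [lagrTauH, Problem.lagrTau, Dtauh, AS]
  linarith

lemma SpaceDisc.AS_eq_Gtau {D : SpaceDisc P} {g : ℝ → L2 P.Ω} {b : Fin d → H01 P.Ω}
    (hd : d = 2 ∨ d = 3) (hb : IsBoundedField b) (hg : MemLp g 2 (volume.restrict (Ioc 0 P.T)))
    {u z φ : ℝ → L2 P.Ω} (hu : u ∈ D.Xtauh τ r) (hz : z ∈ D.Xtauh τ r) (hφ : φ ∈ D.Xtauh τ r)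
    (h : IsStationaryPoint (D.lagrTauH τ g J₁ J₂ b) (D.Xtauh τ r) (D.Xtauh τ r) (u, z)) :
    D.AS τ g u b φ = P.Gtau τ φ := by
  have hB : ∀ {w : ℝ → L2 P.Ω}, w ∈ D.Xtauh τ r → w ∈ Broken P.Ω τ := fun hw =>
    XtauSub_le_Broken τ r (D.Xtauh_subset τ r hw)
  have hX : ∀ {w : ℝ → L2 P.Ω}, w ∈ D.Xtauh τ r → w ∈ Xtau P.Ω τ r := fun hw =>
    D.Xtauh_subset τ r hw
  have h0 : (0 : ℝ → L2 P.Ω) ∈ D.Xtauh τ r := by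
    have := SpaceDisc.sub_mem_Xtauh hu hu
    rwa [sub_self] at this
  have h1 := h 0 h0 φ hφ
  have e : (fun s : ℝ => D.lagrTauH τ g J₁ J₂ b ((u, z) + s • ((0 : ℝ → L2 P.Ω), φ))) =
      fun s : ℝ => D.lagrTauH τ g J₁ J₂ b (u, z) + s * (P.Gtau τ φ - D.AS τ g u b φ) := by
    funext s
    change P.J J₁ J₂ (u + s • (0 : ℝ → L2 P.Ω)) + P.Gtau τ (z + s • φ) -
      (P.Atau τ (u + s • (0 : ℝ → L2 P.Ω)) b (z + s • φ) +
        D.S τ g (u + s • (0 : ℝ → L2 P.Ω)) b (z + s • φ)) =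
      P.J J₁ J₂ u + P.Gtau τ z - (P.Atau τ u b z + D.S τ g u b z) +
        s * (P.Gtau τ φ - (P.Atau τ u b φ + D.S τ g u b φ))
    rw [smul_zero, add_zero, Problem.Gtau_add_smul (hB hz) (hB hφ),
      Problem.Atau_add_smul_right hd b (hB hu) (hB hz) (hB hφ),
      SpaceDisc.S_add_smul hb hg (hX hu) (hX hz) (hX hφ)]
    ring
  unfold HasLineDerivAt at h1
  rw [e] at h1
  have h2 : HasDerivAt (fun s : ℝ => D.lagrTauH τ g J₁ J₂ b (u, z) +
      s * (P.Gtau τ φ - D.AS τ g u b φ)) (1 * (P.Gtau τ φ - D.AS τ g u b φ)) 0 :=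
    ((hasDerivAt_id (0 : ℝ)).mul_const _).const_add _
  have := h1.unique h2
  linarith

end

end TransportDWR

theorem theorem1 {d : ℕ} (hd : d = 2 ∨ d = 3) (P : Problem d)
    -- the Stokes flow
    (v : Fin d → H01 P.Ω) (p : L2 P.Ω) (hv : P.IsStokesSolution v p)
    -- the discretization in time
    (τ : TimeGrid P.T) (r : ℕ)
    -- the goal functional
    (J₁ : H01 P.Ω → ℝ) (J₂ : L2 P.Ω → ℝ)
    (hJ : IsAdmissibleGoal P J₁ J₂ (X P.Ω P.T + Xtau P.Ω τ r))
    -- the stationary points of the continuous and of the semidiscrete Lagrangian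
    (u z : ℝ → L2 P.Ω) (hu : u ∈ X P.Ω P.T) (hz : z ∈ X P.Ω P.T)
    (hstat : IsStationaryPoint (P.lagr J₁ J₂ v) (X P.Ω P.T) (X P.Ω P.T) (u, z))
    (uτ zτ : ℝ → L2 P.Ω) (huτ : uτ ∈ Xtau P.Ω τ r) (hzτ : zτ ∈ Xtau P.Ω τ r)
    (hstatτ : IsStationaryPoint (P.lagrTau τ J₁ J₂ v) (Xtau P.Ω τ r) (Xtau P.Ω τ r) (uτ, zτ)) :
    -- the error in time
    (∀ u' ∈ Xtau P.Ω τ r, ∀ z' ∈ Xtau P.Ω τ r,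
      P.J J₁ J₂ u - P.J J₁ J₂ uτ =
        (1 / 2) * P.primalRes τ J₁ J₂ v uτ zτ (z - z')
        + (1 / 2) * P.dualRes τ J₁ J₂ v uτ zτ (u - u')
        + remainder (P.lagrTau τ J₁ J₂ v) (uτ, zτ) (u - uτ, z - zτ)) ∧
    -- the error in space, for each fully discrete SUPG-stabilized scheme
    (∀ (D : SpaceDisc P) (g : ℝ → L2 P.Ω),
      MemLp g 2 (volume.restrict (Ioc 0 P.T)) →
      (∀ᵐ t ∂(volume.restrict (Ioc 0 P.T)), ∀ w : H01 P.Ω, P.g t w = inner ℝ (g t) (val w)) →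
      ∀ (vh : Fin d → H01 P.Ω) (ph : L2 P.Ω), D.IsStokesSolution vh ph →
      ∀ uh ∈ D.Xtauh τ r, ∀ zh ∈ D.Xtauh τ r,
      IsStationaryPoint (D.lagrTauH τ g J₁ J₂ vh) (D.Xtauh τ r) (D.Xtauh τ r) (uh, zh) →
      -- the perturbed Galerkin orthogonality
      (∀ φ ∈ D.Xtauh τ r,
        P.Atau τ (uτ - uh) vh φ = D.S τ g uh vh φ - coupling P τ v vh uτ φ) ∧
      -- the error representation
      ∀ u' ∈ D.Xtauh τ r, ∀ z' ∈ D.Xtauh τ r,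
        P.J J₁ J₂ uτ - P.J J₁ J₂ uh =
          (1 / 2) * P.primalRes τ J₁ J₂ v uh zh (zτ - z')
          + (1 / 2) * P.dualRes τ J₁ J₂ v uh zh (uτ - u')
          + (1 / 2) * lineDeriv ℝ (D.Dtauh τ g v vh) (uh, zh) (u' - uh, z' - zh)
          + D.Dtauh τ g v vh (uh, zh)
          + remainder (P.lagrTau τ J₁ J₂ v) (uh, zh) (uτ - uh, zτ - zh)) := by
  have hτB : ∀ {w : ℝ → L2 P.Ω}, w ∈ Xtau P.Ω τ r → w ∈ Broken P.Ω τ := fun hw =>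
    XtauSub_le_Broken τ r hw
  have hXB : ∀ {w : ℝ → L2 P.Ω}, w ∈ X P.Ω P.T → w ∈ Broken P.Ω τ := fun hw =>
    XSub_le_Broken τ hw
  have hbil := Problem.isBilinearOn_Atau hd v τ
  rw [add_coe_eq_sup] at hJ
  set Y : Submodule ℝ (ℝ → L2 P.Ω) := XSub P.Ω P.T ⊔ XtauSub P.Ω τ r
  have hYB : Y ≤ Broken P.Ω τ := sup_le (XSub_le_Broken τ) (XtauSub_le_Broken τ r)
  have hXY : ∀ {w : ℝ → L2 P.Ω}, w ∈ X P.Ω P.T → w ∈ Y := fun hw =>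
    (le_sup_left : XSub P.Ω P.T ≤ Y) hw
  have hτY : ∀ {w : ℝ → L2 P.Ω}, w ∈ Xtau P.Ω τ r → w ∈ Y := fun hw =>
    (le_sup_right : XtauSub P.Ω τ r ≤ Y) hw
  obtain ⟨hG3, -, J₁', J₂', -, -, hJ'⟩ := hJ
  have hder : ∀ y ∈ Y, ∀ φ ∈ Y, HasLineDerivAt ℝ (P.J J₁ J₂) (P.goalDeriv J₁' J₂' y φ) y φ :=
    fun y hy φ hφ => (hJ' y hy φ hφ).2
  have hsub : ∀ y ∈ Y, ∀ φ ∈ Y, ∀ ψ ∈ Y,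
      P.goalDeriv J₁' J₂' y (φ - ψ) = P.goalDeriv J₁' J₂' y φ - P.goalDeriv J₁' J₂' y ψ := by
    intro y hy φ hφ ψ hψ
    have := Problem.goalDeriv_add_smul (J₂' := J₂') (hYB hφ) (hYB hψ) (hJ' y hy φ hφ).1
      (hJ' y hy ψ hψ).1 (-1)
    rw [neg_one_smul, ← sub_eq_add_neg] at this
    rw [this]; ring
  have hlag := Problem.lagrTau_eq_lagrangian (P := P) τ J₁ J₂ v
  rw [hlag] at hstatτ
  have hGs : ∀ φ ∈ Broken P.Ω τ, ∀ ψ ∈ Broken P.Ω τ,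
      P.Gtau τ (φ - ψ) = P.Gtau τ φ - P.Gtau τ ψ := fun φ hφ ψ hψ => hbil.map_sub hφ hψ
  have hAl : ∀ φ ∈ Broken P.Ω τ, ∀ ψ ∈ Broken P.Ω τ, ∀ w ∈ Broken P.Ω τ,
      P.Atau τ (φ - ψ) v w = P.Atau τ φ v w - P.Atau τ ψ v w := fun φ hφ ψ hψ w hw =>
    hbil.sub_left hφ hψ hw
  have hAr : ∀ w ∈ Broken P.Ω τ, ∀ φ ∈ Broken P.Ω τ, ∀ ψ ∈ Broken P.Ω τ,
      P.Atau τ w v (φ - ψ) = P.Atau τ w v φ - P.Atau τ w v ψ := fun w hw φ hφ ψ hψ =>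
    hbil.sub_right hw hφ hψ
  -- the semidiscrete primal and dual equations
  have hpτ : ∀ φ ∈ Xtau P.Ω τ r, P.Atau τ uτ v φ = P.Gtau τ φ := fun φ hφ =>
    hbil.primal_of_stationary (hτB huτ) (hτB hzτ) (XtauSub P.Ω τ r).zero_mem hstatτ hφ (hτB hφ)
  have hdτ : ∀ φ ∈ Xtau P.Ω τ r, P.Atau τ φ v zτ = P.goalDeriv J₁' J₂' uτ φ := fun φ hφ =>
    hbil.dual_of_stationary (hτB huτ) (hτB hzτ) (hder _ (hτY huτ) _ (hτY hφ))
      (XtauSub P.Ω τ r).zero_mem hstatτ hφ (hτB hφ)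
  have hτsub : ∀ {w w' : ℝ → L2 P.Ω}, w ∈ Xtau P.Ω τ r → w' ∈ Xtau P.Ω τ r →
      w - w' ∈ Xtau P.Ω τ r := fun hw hw' => (XtauSub P.Ω τ r).sub_mem hw hw'
  have hp : ∀ w ∈ Broken P.Ω τ, ∀ q ∈ Broken P.Ω τ, ∀ φ ∈ Broken P.Ω τ,
      P.primalRes τ J₁ J₂ v w q φ = P.Gtau τ φ - P.Atau τ w v φ := fun w hw q hq φ hφ => by
    rw [Problem.primalRes, hlag]
    exact hbil.lineDeriv_snd hw hq hφ
  have hdu : ∀ w ∈ Y, ∀ q ∈ Y, ∀ φ ∈ Y, P.dualRes τ J₁ J₂ v w q φ =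
      P.goalDeriv J₁' J₂' w φ - P.Atau τ φ v q := fun w hw q hq φ hφ => by
    rw [Problem.dualRes, hlag]
    exact hbil.lineDeriv_fst (hYB hw) (hYB hq) (hYB hφ) (hder w hw φ hφ)
  refine ⟨fun u' hu' z' hz' => ?_, fun D g hg _ vh ph hvh uh huh zh hzh hstath => ⟨?_, ?_⟩⟩
  -- in the space `X` of `u` and `z`, the derivative of `L_τ` at `(u,z)` vanishes; by consistency it
  -- vanishes on `X_τ` too, and hence in the direction of the error
  · have hstat' := isStationaryPoint_lagrTau (τ := τ) hd hu hz hstat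
    rw [hlag] at hstat'
    have hpX : ∀ φ ∈ X P.Ω P.T, P.Atau τ u v φ = P.Gtau τ φ := fun φ hφ =>
      hbil.primal_of_stationary (hXB hu) (hXB hz) (XSub P.Ω P.T).zero_mem hstat' hφ (hXB hφ)
    have hdX : ∀ φ ∈ X P.Ω P.T, P.Atau τ φ v z = P.goalDeriv J₁' J₂' u φ := fun φ hφ =>
      hbil.dual_of_stationary (hXB hu) (hXB hz) (hder _ (hXY hu) _ (hXY hφ))
        (XSub P.Ω P.T).zero_mem hstat' hφ (hXB hφ)
    have hi : ∀ w : H01 P.Ω, IntegrableOn (fun t => J₁' (lift (u t)) w) (Ioc 0 P.T) := fun w => by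
      have := (hJ' u (hXY hu) _ (hXY (Problem.smul_val_mem_X (p := fun _ => 1) contDiff_const w))).1
      simpa only [one_smul, lift_val P.isOpen] using this
    have hpB : ∀ φ ∈ Broken P.Ω τ, P.Atau τ u v φ = P.Gtau τ φ := fun φ hφ =>
      Problem.Atau_eq_Gtau hd v hu hpX hφ
    have hdY : ∀ φ ∈ Xtau P.Ω τ r, P.Atau τ φ v z = P.goalDeriv J₁' J₂' u φ := fun φ hφ =>
      Problem.Atau_eq_goalDeriv hd v hz hi hdX hφ (hJ' u (hXY hu) φ (hτY hφ)).1
    have hφ : u - uτ ∈ Y := Y.sub_mem (hXY hu) (hτY huτ)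
    have hψ : z - zτ ∈ Y := Y.sub_mem (hXY hz) (hτY hzτ)
    have e1 : uτ + (u - uτ) = u := add_sub_cancel _ _
    have e2 : zτ + (z - zτ) = z := add_sub_cancel _ _
    have key := hbil.lagrangian_sub hYB hG3 (hτY huτ) (hτY hzτ) hφ hψ
      (hder _ (hτY huτ) _ hφ) (by rw [e1]; exact hder _ (hXY hu) _ hφ)
    rw [e1, e2, ← hlag] at key
    have hL1 : P.lagrTau τ J₁ J₂ v (u, z) = P.J J₁ J₂ u := by
      rw [Problem.lagrTau, hpX z hz]; ring
    have hL0 : P.lagrTau τ J₁ J₂ v (uτ, zτ) = P.J J₁ J₂ uτ := by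
      rw [Problem.lagrTau, hpτ zτ hzτ]; ring
    rw [hL1, hL0] at key
    rw [key, hp _ (hτB huτ) _ (hτB hzτ) _ ((Broken P.Ω τ).sub_mem (hXB hz) (hτB hz')),
      hdu _ (hτY huτ) _ (hτY hzτ) _ (Y.sub_mem (hXY hu) (hτY hu')),
      hsub _ (hτY huτ) _ (hXY hu) _ (hτY huτ), hsub _ (hXY hu) _ (hXY hu) _ (hτY huτ),
      hsub _ (hτY huτ) _ (hXY hu) _ (hτY hu'), hGs _ (hXB hz) _ (hτB hzτ),
      hGs _ (hXB hz) _ (hτB hz'), hAr _ (hτB huτ) _ (hXB hz) _ (hτB hzτ),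
      hAr _ (hτB huτ) _ (hXB hz) _ (hτB hz'), hAr _ (hXB hu) _ (hXB hz) _ (hτB hzτ),
      hAl _ (hXB hu) _ (hτB huτ) _ (hτB hzτ), hAl _ (hXB hu) _ (hτB huτ) _ (hXB hz),
      hAl _ (hXB hu) _ (hτB hu') _ (hτB hzτ)]
    linarith [hpX z hz, hpB _ (hτB hzτ), hpτ _ hzτ, hpτ _ hz', hdX u hu, hdY _ huτ, hdτ _ huτ,
      hdτ _ hu']
  -- the discrete equation, tested in the larger space `X_τ` of the semidiscrete one
  · intro φ hφ
    have hb : IsBoundedField vh := isBoundedField_of_mem_Vh P.bounded P.isOpen hvh.1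
    have hX := D.Xtauh_subset τ r
    have h1 := SpaceDisc.AS_eq_Gtau hd hb hg huh hzh hφ hstath
    have h2 := hpτ φ (hX hφ)
    have h3 := Problem.Atau_sub_Atau hd v vh (hτB huτ) (hτB (hX hφ))
    have h4 : P.Atau τ (uτ - uh) vh φ = P.Atau τ uτ vh φ - P.Atau τ uh vh φ :=
      (Problem.isBilinearOn_Atau hd vh τ).sub_left (hτB huτ) (hτB (hX huh)) (hτB (hX hφ))
    rw [SpaceDisc.AS] at h1
    linarith
  · intro u' hu' z' hz'
    have hb : IsBoundedField vh := isBoundedField_of_mem_Vh P.bounded P.isOpen hvh.1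
    have hX := D.Xtauh_subset τ r
    have huh' := hX huh
    have hzh' := hX hzh
    have e1 : uh + (uτ - uh) = uτ := add_sub_cancel _ _
    have e2 : zh + (zτ - zh) = zτ := add_sub_cancel _ _
    have hφ := hτsub huτ huh'
    have hψ := hτsub hzτ hzh'
    have key := hbil.lagrangian_sub hYB hG3 (hτY huh') (hτY hzh') (hτY hφ) (hτY hψ)
      (hder _ (hτY huh') _ (hτY hφ)) (by rw [e1]; exact hder _ (hτY huτ) _ (hτY hφ))
    rw [e1, e2, ← hlag] at key
    have hL1 : P.lagrTau τ J₁ J₂ v (uτ, zτ) = P.J J₁ J₂ uτ := by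
      rw [Problem.lagrTau, hpτ zτ hzτ]; ring
    have hL0 : P.lagrTau τ J₁ J₂ v (uh, zh) = P.J J₁ J₂ uh + D.Dtauh τ g v vh (uh, zh) := by
      have h1 := SpaceDisc.AS_eq_Gtau hd hb hg huh hzh hzh hstath
      have h2 := D.lagrTauH_eq (J₁ := J₁) (J₂ := J₂) hd g v vh (hτB huh') (hτB hzh')
      rw [SpaceDisc.lagrTauH, h1] at h2
      linarith
    have hu'X := hX hu'
    have hz'X := hX hz'
    -- `L_τ - D_τh` is the fully discrete Lagrangian; its derivative vanishes in discrete directions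
    have hD : lineDeriv ℝ (D.Dtauh τ g v vh) (uh, zh) (u' - uh, z' - zh) =
        P.goalDeriv J₁' J₂' uh (u' - uh) +
          (P.Gtau τ (z' - zh) - P.Atau τ uh v (z' - zh) - P.Atau τ (u' - uh) v zh) := by
      have h1 : HasDerivAt _ _ _ :=
        hstath _ (SpaceDisc.sub_mem_Xtauh hu' huh) _ (SpaceDisc.sub_mem_Xtauh hz' hzh)
      have h2 : HasDerivAt _ _ _ := hbil.hasLineDerivAt_lagrangian (hτB huh') (hτB hzh')
        (hτB (hτsub hu'X huh')) (hτB (hτsub hz'X hzh'))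
        (hder _ (hτY huh') _ (hτY (hτsub hu'X huh')))
      have h3 := h2.fun_sub h1
      rw [sub_zero] at h3
      refine Eq.trans ?_ h3.deriv
      rw [lineDeriv]
      congr 1
      funext s
      have k1 : uh + s • (u' - uh) ∈ Broken P.Ω τ :=
        (Broken P.Ω τ).add_mem (hτB huh') ((Broken P.Ω τ).smul_mem s (hτB (hτsub hu'X huh')))
      have k2 : zh + s • (z' - zh) ∈ Broken P.Ω τ :=
        (Broken P.Ω τ).add_mem (hτB hzh') ((Broken P.Ω τ).smul_mem s (hτB (hτsub hz'X hzh')))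
      have h4 := D.lagrTauH_eq (J₁ := J₁) (J₂ := J₂) hd g v vh k1 k2
      rw [hlag] at h4
      change D.Dtauh τ g v vh (uh + s • (u' - uh), zh + s • (z' - zh)) =
        lagrangian _ _ _ (uh + s • (u' - uh), zh + s • (z' - zh)) -
          D.lagrTauH τ g J₁ J₂ vh (uh + s • (u' - uh), zh + s • (z' - zh))
      rw [h4]
      ring
    rw [hL1, hL0, hpτ _ hψ, hdτ _ hφ] at key
    rw [hD, hp _ (hτB huh') _ (hτB hzh') _ (hτB (hτsub hzτ hz'X)),
      hdu _ (hτY huh') _ (hτY hzh') _ (hτY (hτsub huτ hu'X))]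
    rw [hsub _ (hτY huh') _ (hτY huτ) _ (hτY huh'), hGs _ (hτB hzτ) _ (hτB hzh'),
      hAr _ (hτB huh') _ (hτB hzτ) _ (hτB hzh'), hAl _ (hτB huτ) _ (hτB huh') _ (hτB hzh')] at key
    rw [hsub _ (hτY huh') _ (hτY huτ) _ (hτY hu'X), hsub _ (hτY huh') _ (hτY hu'X) _ (hτY huh'),
      hGs _ (hτB hzτ) _ (hτB hz'X), hGs _ (hτB hz'X) _ (hτB hzh'),
      hAr _ (hτB huh') _ (hτB hzτ) _ (hτB hz'X), hAr _ (hτB huh') _ (hτB hz'X) _ (hτB hzh'),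
      hAl _ (hτB huτ) _ (hτB hu'X) _ (hτB hzh'), hAl _ (hτB hu'X) _ (hτB huh') _ (hτB hzh')]
    linarith
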